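/- Let $d\ge 3$ be fixed. A $d$-polytope is the convex hull of finitely many points of some $\mathbb{R}^N$ whose affine hull has dimension $d$; a vertex of a $d$-polytope is called nonsimple if it is contained in more than $d$ edges; the $k$-skeleton of a polytope is the poset, under inclusion, of its faces of dimension at most $k$. Let $P$ be a $d$-polytope each of whose facets contains at most $d-2$ nonsimple vertices of $P$. Then $P$ is reconstructible from its 2-skeleton: for every $d$-polytope $Q$, every isomorphism from the 2-skeleton of $P$ to the 2-skeleton of $Q$ extends to an isomorphism from the face lattice of $P$ to the face lattice of $Q$. Furthermore, all the facets can be found from the 2-skeleton in time linear in the number of vertices: for each $d\ge 3$ there are a program for a unit-cost random access machine (whose only arithmetic operations are successor and predecessor) and a constant $C$, both depending only on $d$, such that for every such $P$ with $n$ vertices, labelled $0,\dots,n-1$ in any way, the program, given $n$ and the lists (in any order) of the vertex sets of the edges and of the 2-faces of $P$, halts after at most $Cn$ steps and outputs the list of the vertex sets of all facets of $P$, each facet exactly once. -/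

import Mathlib

namespace Recon

/-! ### Polytopes, faces, skeleta -/

section Polytopes

variable {E : Type*} [NormedAddCommGroup E] [NormedSpace ℝ E]

/-- A `d`-polytope: the convex hull of finitely many points (at least one) whose affine hull has
dimension `d`. The ambient space may have a larger dimension. -/
def IsDPolytope (d : ℕ) (P : Set E) : Prop :=
  P.Nonempty ∧ (∃ s : Set E, s.Finite ∧ P = convexHull ℝ s) ∧
    Module.finrank ℝ (vectorSpan ℝ P) = d

/-- The faces of a polytope `P`, ordered by inclusion: the empty set and the sets of maximizers over
`P` of linear functionals (the functional `0` gives `P` itself). -/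
abbrev Face (P : Set E) : Type _ := {F : Set E // IsExposed ℝ P F}

/-- `F` is a (nonempty) `k`-dimensional face of `P`. -/
def IsKFace (P : Set E) (k : ℕ) (F : Set E) : Prop :=
  IsExposed ℝ P F ∧ F.Nonempty ∧ Module.finrank ℝ (vectorSpan ℝ F) = k

/-- The `k`-skeleton of `P`: the poset of all faces of dimension at most `k`. The empty face, of
dimension `-1`, belongs to it. -/
abbrev Skeleton (k : ℕ) (P : Set E) : Type _ :=
  {F : Face P // Module.finrank ℝ (vectorSpan ℝ F.1) ≤ k}

/-- A vertex of a `d`-polytope `P` is nonsimple if more than `d` edges of `P` contain it. -/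
def IsNonsimpleVertex (d : ℕ) (P : Set E) (v : E) : Prop :=
  v ∈ P.extremePoints ℝ ∧ d < {e : Set E | IsKFace P 1 e ∧ v ∈ e}.ncard

/-- Every facet of the `d`-polytope `P` contains at most `m` nonsimple vertices of `P`. -/
def FacetNonsimpleAtMost (d m : ℕ) (P : Set E) : Prop :=
  ∀ F : Set E, IsKFace P (d - 1) F → {v : E | IsNonsimpleVertex d P v ∧ v ∈ F}.ncard ≤ m

/-- The `d`-polytope `P` is reconstructible from its `k`-skeleton: every isomorphism from the
`k`-skeleton of `P` to the `k`-skeleton of a `d`-polytope `Q` extends to an isomorphism of the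
entire face lattices. -/
def ReconstructibleFromSkeleton (d k : ℕ) (P : Set E) : Prop :=
  ∀ (N : ℕ) (Q : Set (EuclideanSpace ℝ (Fin N))), IsDPolytope d Q →
    ∀ φ : Skeleton k P ≃o Skeleton k Q,
      ∃ Φ : Face P ≃o Face Q, ∀ F : Skeleton k P, Φ F.1 = (φ F).1

/-- With the vertices of `P` labelled by `0, …, n - 1`, the list `L` enumerates the `k`-faces of `P`:
each entry of `L` lists, in some order and without repetition, the labels of the vertices of a
`k`-face, and every `k`-face occurs exactly once, the order being arbitrary. -/
def ListsKFaces {n : ℕ} (P : Set E) (label : Fin n ≃ P.extremePoints ℝ) (k : ℕ)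
    (L : List (List (Fin n))) : Prop :=
  (∀ l ∈ L, l.Nodup) ∧ (L.map List.toFinset).Nodup ∧
    ∀ S : Finset (Fin n), S ∈ L.map List.toFinset ↔
      ∃ F : Set E, IsKFace P k F ∧ ∀ i : Fin n, i ∈ S ↔ (label i : E) ∈ F

end Polytopes

/-! ### Random access machines with unit cost

Programs act on registers and on one-way infinite arrays, all holding natural numbers; a program
names finitely many of them. The only arithmetic is successor and predecessor, so that in time `t`
the stored numbers grow by at most `t`: unit cost hides no work with long numbers. -/

/-- Tests comparing the contents of two registers. -/
inductive Test : Type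
  | eq (x y : ℕ)
  | ne (x y : ℕ)
  | lt (x y : ℕ)

/-- Structured programs. Registers and arrays are named by natural numbers. -/
inductive Prog : Type
  /-- do nothing -/
  | skip
  /-- `x := c` for a constant `c` -/
  | const (x c : ℕ)
  /-- `x := y` -/
  | copy (x y : ℕ)
  /-- `x := y + 1` -/
  | succ (x y : ℕ)
  /-- `x := y - 1`, where `0 - 1 = 0` -/
  | pred (x y : ℕ)
  /-- `x := a[y]` -/
  | load (x a y : ℕ)
  /-- `a[x] := y` -/
  | store (a x y : ℕ)
  | seq (p q : Prog)
  | ite (b : Test) (p q : Prog)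
  | loop (b : Test) (p : Prog)

/-- Memory: contents of the registers and of the arrays. -/
structure Mem where
  reg : ℕ → ℕ
  arr : ℕ → ℕ → ℕ

def Mem.setReg (σ : Mem) (x v : ℕ) : Mem :=
  { σ with reg := Function.update σ.reg x v }

def Mem.setArr (σ : Mem) (a i v : ℕ) : Mem :=
  { σ with arr := Function.update σ.arr a (Function.update (σ.arr a) i v) }

def Test.Holds (σ : Mem) : Test → Prop
  | .eq x y => σ.reg x = σ.reg y
  | .ne x y => σ.reg x ≠ σ.reg y
  | .lt x y => σ.reg x < σ.reg y

/-- `Exec p σ t τ`: started with memory `σ`, the program `p` halts after exactly `t` steps with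
memory `τ`. Each elementary instruction and each evaluation of a test is one step. -/
inductive Exec : Prog → Mem → ℕ → Mem → Prop
  | skip (σ) : Exec .skip σ 1 σ
  | const (σ x c) : Exec (.const x c) σ 1 (σ.setReg x c)
  | copy (σ x y) : Exec (.copy x y) σ 1 (σ.setReg x (σ.reg y))
  | succ (σ x y) : Exec (.succ x y) σ 1 (σ.setReg x (σ.reg y + 1))
  | pred (σ x y) : Exec (.pred x y) σ 1 (σ.setReg x (σ.reg y - 1))
  | load (σ x a y) : Exec (.load x a y) σ 1 (σ.setReg x (σ.arr a (σ.reg y)))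
  | store (σ a x y) : Exec (.store a x y) σ 1 (σ.setArr a (σ.reg x) (σ.reg y))
  | seq {p q σ τ ρ s t} : Exec p σ s τ → Exec q τ t ρ → Exec (.seq p q) σ (s + t) ρ
  | ite_true {b p q σ τ t} : b.Holds σ → Exec p σ t τ → Exec (.ite b p q) σ (t + 1) τ
  | ite_false {b p q σ τ t} : ¬ b.Holds σ → Exec q σ t τ → Exec (.ite b p q) σ (t + 1) τ
  | loop_stop {b p σ} : ¬ b.Holds σ → Exec (.loop b p) σ 1 σ
  | loop_step {b p σ τ ρ s t} : b.Holds σ → Exec p σ s τ → Exec (.loop b p) τ t ρ →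
      Exec (.loop b p) σ (s + t + 1) ρ

/-- Initial memory: the input word in array `0`, everything else zero. -/
def initMem (w : List ℕ) : Mem where
  reg := fun _ => 0
  arr := fun a i => if a = 0 then w.getD i 0 else 0

/-- The output word `w` stands in array `1`, from position `0` on. -/
def Mem.Outputs (σ : Mem) (w : List ℕ) : Prop :=
  ∀ i (hi : i < w.length), σ.arr 1 i = w[i]

/-- A list of lists as a word: the number of lists, then each list preceded by its length. -/
def encode {n : ℕ} (L : List (List (Fin n))) : List ℕ :=
  L.length :: L.flatMap (fun l => l.length :: l.map Fin.val)

/-- The 2-skeleton as an input word: the number of vertices, the list of the edges and the list of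
the 2-faces, each given by its vertices. -/
def encodeTwoSkeleton (n : ℕ) (edges twoFaces : List (List (Fin n))) : List ℕ :=
  n :: (encode edges ++ encode twoFaces)

/-- On every encoding of the 2-skeleton of the `d`-polytope `P` with any labelling of its `n`
vertices, the program `p` halts within `C * n` steps and outputs the list of all facets of `P`. -/
def FindsFacetsWithin (p : Prog) (C d : ℕ) {E : Type*} [NormedAddCommGroup E] [NormedSpace ℝ E]
    (P : Set E) : Prop :=
  ∀ (n : ℕ) (label : Fin n ≃ P.extremePoints ℝ) (edges twoFaces : List (List (Fin n))),
    ListsKFaces P label 1 edges → ListsKFaces P label 2 twoFaces →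
      ∃ (t : ℕ) (τ : Mem) (facets : List (List (Fin n))),
        Exec p (initMem (encodeTwoSkeleton n edges twoFaces)) t τ ∧ t ≤ C * n ∧
          ListsKFaces P label (d - 1) facets ∧ τ.Outputs (encode facets)

end Recon

/-!
**Setting.** A polytope is studied through the configuration of its vertices, lifted to height one
(`VertexConfig`, `config`). A face is then a set `T` of indices for which some linear functional
vanishes on `T` and is negative elsewhere (`IsFace`), and its rank `rk`, the dimension of the span, is
the dimension of the face plus one. This makes the face lattice of a `d`-polytope a finite set of
index sets, and two polytopes with isomorphic 2-skeleta become two configurations on the same index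
set with the same faces of rank at most three (`SameSkeleton`).

**Carrying a missing edge along.** A facet `F` through a simple vertex `v` misses exactly one
neighbour `u` of `v` and is determined by the pair `(v, u)` (`VertexConfig.Simple.facet_unique`). If
`v'` is another simple vertex of `F` adjacent to `v`, the 2-face spanned at `v` by `u` and `v'` has at
`v'` a second edge, to `u'`, and `F` misses `u'` (`VertexConfig.Linked.misses`). As `F` has at most
`d - 2` nonsimple vertices, its simple vertices induce a connected graph by Balinski's theorem
(`VertexConfig.balinski`); so all pairs belonging to `F` are reached from one of them by moves that
are visible in the 2-skeleton (`VertexConfig.FewNonsimple.mem_of_linked`). Each vertex of `F` has a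
simple neighbour in `F`, so these pairs also reveal the vertices of `F`
(`VertexConfig.FewNonsimple.mem_facet_iff`).

**Reconstruction.** Let `A` be the configuration with few nonsimple vertices, and `B` another one with
the same 2-skeleton. A facet of `A` and a facet of `B` that miss the same neighbour at a common simple
vertex coincide (`VertexConfig.SameSkeleton.facet_eq`), so that all facets of `A` are facets of `B`.
There are no others, because the facets of a polytope are connected through their common ridges
(`VertexConfig.facet_connected`). All faces are intersections of facets, whence
`VertexConfig.SameSkeleton.isFace_iff` and `reconstructible`.

**The algorithm.** Call the directed edges darts. A pair `(v, u)` as above is a dart with a simple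
source, and the moves between pairs are links between darts, so the facets correspond to the components
of the link graph. The program `findFacets` stores the darts in linked lists by their sources, then
reads the 2-faces and stores the links along them, and finally runs a breadth-first search in the link
graph. Each component yields a facet: for every dart `p` of the component, the source of `p` and the
targets of the other darts with this source are output, unless they are stamped already. A simple
vertex is the source of `d` darts, so the running time is linear in the size of the input. In turn, this is linear
in the number of vertices (`VertexConfig.FewNonsimple.sum_card_properFaces_le`): every proper face lies
in a facet, at most `d - 2` vertices of which are nonsimple, and a simple vertex lies in exactly `2 ^ d`
faces.

Running times are treated in a program logic, `WP p Q σ` saying that `p`, started in `σ`, halts and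
that its running time and final memory satisfy `Q`; loops are paid for by a potential (`wp_loop`).

The arrays of the program: `0` input; `1` output; `2, 3, 4, 5, 6` for the darts the sources, the
targets, the list successors, the list heads and the out-degrees; `7` marks of the vertices of the
current 2-face; `8, 9, 10, 11` the same as `2, 3, 4, 5` for the links; `12` the queue; `13` marks of
the darts that have entered the queue; `14` stamps of the vertices, a vertex being stamped with the
number of the last facet it was output for. Some registers keep one meaning throughout: `0` holds
zero, `1` the reading position, `2` the dimension, `7` and `18` the next free numbers of darts and
links, `22` the number of facets begun, `23` the writing position, `24` and `25` the ends of the queue,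
and `36` the number one once the search has begun.
-/

set_option linter.unusedSectionVars false

namespace Recon

/-! ### Faces of vector configurations -/

section Faces

variable {ι W : Type*} [Fintype ι] [DecidableEq ι] [AddCommGroup W] [Module ℝ W]
  [FiniteDimensional ℝ W]

/-- A set `T` of indices is a face of the vector configuration `x` if some linear functional vanishes
on the vectors indexed by `T` and is negative on all others. A polytope is encoded by its vertices
lifted to height one, so that affine functionals become linear; the index set `univ` and, for a
configuration at height one, the set `∅` are faces. -/
def IsFace (x : ι → W) (T : Finset ι) : Prop :=
  ∃ l : W →ₗ[ℝ] ℝ, (∀ i ∈ T, l (x i) = 0) ∧ ∀ i ∉ T, l (x i) < 0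

/-- The linear span of the vectors indexed by `T`. -/
def spn (x : ι → W) (T : Finset ι) : Submodule ℝ W := Submodule.span ℝ (x '' T)

/-- The rank of `T`; for a face of a polytope this is its dimension plus one. -/
noncomputable def rk (x : ι → W) (T : Finset ι) : ℕ := Module.finrank ℝ (spn x T)

variable {x : ι → W}

theorem mem_spn {T : Finset ι} {i : ι} (hi : i ∈ T) : x i ∈ spn x T :=
  Submodule.subset_span ⟨i, hi, rfl⟩

theorem spn_mono {S T : Finset ι} (h : S ⊆ T) : spn x S ≤ spn x T :=
  Submodule.span_mono (Set.image_mono (by exact_mod_cast h))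

theorem spn_le {T : Finset ι} {p : Submodule ℝ W} (h : ∀ i ∈ T, x i ∈ p) : spn x T ≤ p := by
  refine Submodule.span_le.2 ?_
  rintro _ ⟨i, hi, rfl⟩
  exact h i hi

theorem rk_mono {S T : Finset ι} (h : S ⊆ T) : rk x S ≤ rk x T :=
  Submodule.finrank_mono (spn_mono h)

theorem eq_zero_of_mem_spn {T : Finset ι} {l : W →ₗ[ℝ] ℝ} (h : ∀ i ∈ T, l (x i) = 0) {w : W}
    (hw : w ∈ spn x T) : l w = 0 :=
  spn_le (p := LinearMap.ker l) (fun i hi => LinearMap.mem_ker.2 (h i hi)) hw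

theorem rk_insert_le (T : Finset ι) (i : ι) : rk x (insert i T) ≤ rk x T + 1 := by
  have h : spn x (insert i T) = Submodule.span ℝ {x i} ⊔ spn x T := by
    rw [spn, spn, Finset.coe_insert, Set.image_insert_eq, Submodule.span_insert]
  rw [rk, h]
  have h1 := Submodule.finrank_add_le_finrank_add_finrank (Submodule.span ℝ {x i}) (spn x T)
  have h2 := finrank_span_le_card (R := ℝ) ({x i} : Set W)
  simp only [Set.toFinset_singleton, Finset.card_singleton] at h2
  have : rk x T = Module.finrank ℝ (spn x T) := rfl
  omega

theorem rk_empty : rk x ∅ = 0 := by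
  rw [rk, spn, Finset.coe_empty, Set.image_empty, Submodule.span_empty, finrank_bot]

theorem rk_le_card (T : Finset ι) : rk x T ≤ T.card := by
  induction T using Finset.induction_on with
  | empty => simp [rk_empty]
  | insert i T hi ih =>
    rw [Finset.card_insert_of_notMem hi]
    exact (rk_insert_le T i).trans (by omega)

theorem isFace_univ : IsFace x Finset.univ := ⟨0, by simp, by simp⟩

theorem IsFace.inter {S T : Finset ι} (hS : IsFace x S) (hT : IsFace x T) :
    IsFace x (S ∩ T) := by
  obtain ⟨l, l0, l1⟩ := hS
  obtain ⟨m, m0, m1⟩ := hT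
  have hl : ∀ i, l (x i) ≤ 0 := fun i => by
    by_cases h : i ∈ S
    · exact (l0 i h).le
    · exact (l1 i h).le
  have hm : ∀ i, m (x i) ≤ 0 := fun i => by
    by_cases h : i ∈ T
    · exact (m0 i h).le
    · exact (m1 i h).le
  refine ⟨l + m, fun i hi => ?_, fun i hi => ?_⟩
  · rw [Finset.mem_inter] at hi
    simp [l0 i hi.1, m0 i hi.2]
  · rw [Finset.mem_inter, not_and_or] at hi
    rw [LinearMap.add_apply]
    rcases hi with hi | hi
    · linarith [l1 i hi, hm i]
    · linarith [m1 i hi, hl i]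

theorem IsFace.mem_of_mem_spn {T : Finset ι} (hT : IsFace x T) {i : ι} (hi : x i ∈ spn x T) :
    i ∈ T := by
  obtain ⟨l, l0, l1⟩ := hT
  by_contra h
  exact (l1 i h).ne (eq_zero_of_mem_spn l0 hi)

theorem IsFace.subset_of_rk_le {F G : Finset ι} (hF : IsFace x F) (h : F ⊆ G)
    (hr : rk x G ≤ rk x F) : G ⊆ F := fun i hi =>
  hF.mem_of_mem_spn (by
    rw [Submodule.eq_of_le_of_finrank_le (spn_mono h) hr]
    exact mem_spn hi)

theorem IsFace.rk_lt {F G : Finset ι} (hF : IsFace x F) (h : F ⊂ G) : rk x F < rk x G := by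
  by_contra hr
  exact h.2 (hF.subset_of_rk_le h.1 (not_lt.1 hr))

/-- A face of a face is a face: a large multiple of a functional defining the big face dominates. -/
theorem IsFace.trans {G T : Finset ι} (hG : IsFace x G) (hTG : T ⊆ G) {l : W →ₗ[ℝ] ℝ}
    (l0 : ∀ i ∈ T, l (x i) = 0) (l1 : ∀ i ∈ G, i ∉ T → l (x i) < 0) : IsFace x T := by
  obtain ⟨g, g0, g1⟩ := hG
  have : ∃ M : ℝ, ∀ i ∉ G, l (x i) + M * g (x i) < 0 := by
    have h : ∀ᶠ M : ℝ in Filter.atTop, ∀ i : ι, i ∉ G → l (x i) + M * g (x i) < 0 := by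
      rw [Filter.eventually_all]
      intro i
      filter_upwards [Filter.eventually_gt_atTop (l (x i) / -(g (x i)))] with M hM hi
      have := g1 i hi
      rw [div_lt_iff₀ (by linarith)] at hM
      linarith
    exact h.exists
  obtain ⟨M, hM⟩ := this
  refine ⟨l + M • g, fun i hi => by simp [l0 i hi, g0 i (hTG hi)], fun i hi => ?_⟩
  by_cases h : i ∈ G
  · simpa [g0 i h] using l1 i h hi
  · simpa using hM i h

/-- Tilting a functional `l ≤ 0` towards `m` until a new point is reached. -/
theorem exists_tilt (G : Finset ι) (l m : W →ₗ[ℝ] ℝ) (hl : ∀ i ∈ G, l (x i) ≤ 0)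
    (hlm : ∀ i ∈ G, 0 < m (x i) → l (x i) < 0) (hm : ∃ i ∈ G, 0 < m (x i)) :
    ∃ t : ℝ, 0 < t ∧ (∀ i ∈ G, l (x i) + t * m (x i) ≤ 0) ∧
      ∃ s ∈ G, 0 < m (x s) ∧ l (x s) + t * m (x s) = 0 := by
  obtain ⟨w, hw, hmw⟩ := hm
  obtain ⟨s, hs, hmin⟩ := Finset.exists_min_image (G.filter fun i => 0 < m (x i))
    (fun i => -l (x i) / m (x i)) ⟨w, by simp [hw, hmw]⟩
  rw [Finset.mem_filter] at hs
  have ht : 0 < -l (x s) / m (x s) := div_pos (by linarith [hlm s hs.1 hs.2]) hs.2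
  refine ⟨-l (x s) / m (x s), ht, fun i hi => ?_, s, hs.1, hs.2, ?_⟩
  · by_cases h : 0 < m (x i)
    · have := hmin i (by simp [hi, h])
      rw [le_div_iff₀ h] at this
      linarith
    · have := mul_nonneg ht.le (neg_nonneg.2 (not_lt.1 h))
      linarith [hl i hi]
  · rw [div_mul_cancel₀ _ hs.2.ne']
    ring

/-- The zero set of a tilted functional is a face. -/
theorem exists_face_of_tilt {F G : Finset ι} (hG : IsFace x G) (hFG : F ⊆ G) {l m : W →ₗ[ℝ] ℝ}
    (l0 : ∀ i ∈ F, l (x i) = 0) (l1 : ∀ i ∉ F, l (x i) < 0) (m0 : ∀ i ∈ F, m (x i) = 0)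
    (hm : ∃ i ∈ G, 0 < m (x i)) :
    ∃ t : ℝ, 0 < t ∧ ∃ H, IsFace x H ∧ F ⊆ H ∧ H ⊆ G ∧ (∃ s ∈ H, 0 < m (x s)) ∧
      ∀ i ∈ G, i ∈ H ↔ l (x i) + t * m (x i) = 0 := by
  have hlm : ∀ i ∈ G, 0 < m (x i) → l (x i) < 0 := fun i _ hi =>
    l1 i fun h => hi.ne' (m0 i h)
  have hl : ∀ i ∈ G, l (x i) ≤ 0 := fun i _ => by
    by_cases h : i ∈ F
    · exact (l0 i h).le
    · exact (l1 i h).le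
  obtain ⟨t, ht, hle, s, hs, hms, hs0⟩ := exists_tilt G l m hl hlm hm
  refine ⟨t, ht, G.filter fun i => l (x i) + t * m (x i) = 0, ?_, ?_, Finset.filter_subset _ _,
    ⟨s, by simp [hs, hs0], hms⟩, fun i hi => by simp [hi]⟩
  · refine hG.trans (Finset.filter_subset _ _) (l := l + t • m) ?_ ?_
    · intro i hi
      simpa using (Finset.mem_filter.1 hi).2
    · intro i hi hi'
      have := hle i hi
      refine lt_of_le_of_ne (by simpa using this) fun h => hi' ?_
      simpa [hi] using h
  · intro i hi
    simp [hFG hi, l0 i hi, m0 i hi]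

/-- A proper face `F` of a face `G` lies in a facet of `G` that avoids a given `v ∈ G \ F`. -/
theorem IsFace.exists_facet {F G : Finset ι} (hF : IsFace x F) (hG : IsFace x G) (hFG : F ⊆ G)
    {v : ι} (hv : v ∈ G) (hvF : v ∉ F) :
    ∃ H, IsFace x H ∧ F ⊆ H ∧ H ⊆ G ∧ v ∉ H ∧ rk x H + 1 = rk x G := by
  induction hn : (G \ F).card using Nat.strong_induction_on generalizing F with
  | _ n ih =>
    subst hn
    have hlt : rk x F < rk x G := hF.rk_lt ⟨hFG, fun h => hvF (h hv)⟩
    by_cases hr : rk x F + 1 = rk x G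
    · exact ⟨F, hF, subset_rfl, hFG, hvF, hr⟩
    have h1 : ∃ u ∈ G, x u ∉ spn x (insert v F) := by
      by_contra! hcon
      have h2 : rk x G ≤ rk x (insert v F) := Submodule.finrank_mono (spn_le hcon)
      have h3 := rk_insert_le (x := x) F v
      omega
    obtain ⟨u, hu, hus⟩ := h1
    obtain ⟨m', hm'u, hm'⟩ := Submodule.exists_le_ker_of_notMem hus
    obtain ⟨m, hmu, hm⟩ : ∃ m : W →ₗ[ℝ] ℝ, 0 < m (x u) ∧ ∀ i ∈ insert v F, m (x i) = 0 := by
      have h0 : ∀ i ∈ insert v F, m' (x i) = 0 := fun i hi => LinearMap.mem_ker.1 (hm' (mem_spn hi))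
      rcases lt_or_gt_of_ne hm'u with h | h
      · exact ⟨-m', by simpa using h, fun i hi => by simpa using h0 i hi⟩
      · exact ⟨m', h, h0⟩
    obtain ⟨l, l0, l1⟩ := id hF
    obtain ⟨t, ht, H, hH, hFH, hHG, ⟨s, hs, hms⟩, hHi⟩ := exists_face_of_tilt hG hFG l0 l1
      (fun i hi => hm i (Finset.mem_insert_of_mem hi)) ⟨u, hu, hmu⟩
    have hvH : v ∉ H := by
      rw [hHi v hv, hm v (Finset.mem_insert_self _ _)]
      simpa using (l1 v hvF).ne
    have hsF : s ∉ F := fun h => hms.ne' (hm s (Finset.mem_insert_of_mem h))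
    obtain ⟨K, hK, hHK, hKG, hvK, hrK⟩ := ih (G \ H).card (Finset.card_lt_card
      ⟨Finset.sdiff_subset_sdiff subset_rfl hFH, fun h => by
        have := h (Finset.mem_sdiff.2 ⟨hHG hs, hsF⟩)
        exact (Finset.mem_sdiff.1 this).2 hs⟩) hH hHG hvH rfl
    exact ⟨K, hK, hFH.trans hHK, hKG, hvK, hrK⟩

/-- Local optimality is global: if a functional `m` vanishing on the face `F` is positive somewhere
on a face `G ⊇ F`, then it is positive somewhere on a face of `G` that has one rank more than `F`.
In a minimal counterexample `G`, tilting a functional that defines `F` towards `m` yields no smaller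
face, so `m` is positive on all of `G \ F`, and every facet of `G` through `F` contradicts
minimality. -/
theorem IsFace.exists_improving {F G : Finset ι} (hF : IsFace x F) (hG : IsFace x G) (hFG : F ⊆ G)
    {m : W →ₗ[ℝ] ℝ} (m0 : ∀ i ∈ F, m (x i) = 0) (hm : ∃ i ∈ G, 0 < m (x i)) :
    ∃ H, IsFace x H ∧ F ⊆ H ∧ H ⊆ G ∧ rk x H = rk x F + 1 ∧ ∃ s ∈ H, 0 < m (x s) := by
  induction hn : G.card using Nat.strong_induction_on generalizing G with
  | _ n ih =>
    subst hn
    have key : ∀ H, IsFace x H → F ⊆ H → H ⊆ G → H ≠ G → (∃ s ∈ H, 0 < m (x s)) →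
        ∃ H, IsFace x H ∧ F ⊆ H ∧ H ⊆ G ∧ rk x H = rk x F + 1 ∧ ∃ s ∈ H, 0 < m (x s) := by
      intro H hH hFH hHG hne hs
      obtain ⟨K, h1, h2, h3, h4, h5⟩ := ih H.card
        (Finset.card_lt_card ⟨hHG, fun h => hne (subset_antisymm hHG h)⟩) hH hFH hs rfl
      exact ⟨K, h1, h2, h3.trans hHG, h4, h5⟩
    obtain ⟨w, hw, hmw⟩ := id hm
    have hwF : w ∉ F := fun h => hmw.ne' (m0 w h)
    have hlt : rk x F < rk x G := hF.rk_lt ⟨hFG, fun h => hwF (h hw)⟩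
    by_cases hr : rk x G = rk x F + 1
    · exact ⟨G, hG, hFG, subset_rfl, hr, hm⟩
    obtain ⟨l, l0, l1⟩ := id hF
    obtain ⟨t, ht, H, hH, hFH, hHG, hs, hHi⟩ := exists_face_of_tilt hG hFG l0 l1 m0 hm
    by_cases hne : H = G
    · subst hne
      obtain ⟨K, hK, hFK, hKG, hwK, hrK⟩ := hF.exists_facet hG hFG hw hwF
      have : ∃ s ∈ K, s ∉ F := by
        by_contra! hcon
        have := rk_mono (x := x) (show K ⊆ F from hcon)
        omega
      obtain ⟨s, hsK, hsF⟩ := this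
      refine key K hK hFK hKG (fun h => hwK (h ▸ hw)) ⟨s, hsK, ?_⟩
      have h1 := (hHi s (hKG hsK)).1 (hKG hsK)
      have h2 := l1 s hsF
      exact pos_of_mul_pos_right (a := t) (by linarith) ht.le
    · exact key H hH hFH hHG hne hs

/-- Over a face `F`, a face of one rank more is a ray. -/
theorem IsFace.exists_pos_sub_mem {F H : Finset ι} (hF : IsFace x F) (hFH : F ⊆ H)
    (hr : rk x H = rk x F + 1) {s t : ι} (hs : s ∈ H) (hsF : s ∉ F) (ht : t ∈ H) (htF : t ∉ F) :
    ∃ c : ℝ, 0 < c ∧ x t - c • x s ∈ spn x F := by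
  have h1 : spn x (insert s F) = spn x H := by
    refine Submodule.eq_of_le_of_finrank_le (spn_mono (Finset.insert_subset hs hFH)) ?_
    have := hF.rk_lt (Finset.ssubset_insert hsF)
    change rk x H ≤ rk x (insert s F)
    omega
  have h2 : x t ∈ spn x (insert s F) := h1 ▸ mem_spn ht
  rw [spn, Finset.coe_insert, Set.image_insert_eq, Submodule.mem_span_insert] at h2
  obtain ⟨c, z, hz, hc⟩ := h2
  obtain ⟨l, l0, l1⟩ := id hF
  have hlz : l z = 0 := eq_zero_of_mem_spn l0 hz
  have h3 : l (x t) = c * l (x s) := by rw [hc]; simp [hlz]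
  refine ⟨c, ?_, by rw [hc]; simpa [spn] using hz⟩
  have h4 := l1 t htF
  have h5 := l1 s hsF
  by_contra hc0
  nlinarith

/-- Between a face and a bigger one lies a face of one rank more than the smaller one. -/
theorem IsFace.exists_rk_succ {F G : Finset ι} (hF : IsFace x F) (hG : IsFace x G) (hFG : F ⊂ G) :
    ∃ H, IsFace x H ∧ F ⊆ H ∧ H ⊆ G ∧ rk x H = rk x F + 1 := by
  obtain ⟨w, hw, hwF⟩ := Finset.exists_of_ssubset hFG
  obtain ⟨l, l0, l1⟩ := id hF
  obtain ⟨H, h1, h2, h3, h4, -⟩ := hF.exists_improving hG hFG.1 (m := -l)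
    (fun i hi => by simp [l0 i hi]) ⟨w, hw, by simpa using l1 w hwF⟩
  exact ⟨H, h1, h2, h3, h4⟩

end Faces

/-! ### Vertex configurations: neighbours, simple vertices, connectivity -/

section VertexConfigs

variable {ι W : Type*} [Fintype ι] [DecidableEq ι] [AddCommGroup W] [Module ℝ W]
  [FiniteDimensional ℝ W]

/-- The vertices of a polytope, lifted to height one: a configuration at height one all of whose
singletons are faces. -/
structure VertexConfig (ι W : Type*) [AddCommGroup W] [Module ℝ W] where
  pt : ι → W
  height : W →ₗ[ℝ] ℝ
  height_pt : ∀ i, height (pt i) = 1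
  isFace_singleton : ∀ i, IsFace pt {i}

namespace VertexConfig

/-- The rank of the whole configuration, one more than the dimension of the polytope. -/
noncomputable def rank (C : VertexConfig ι W) : ℕ := rk C.pt Finset.univ

/-- A facet is a face of corank one. -/
def IsFacet (C : VertexConfig ι W) (F : Finset ι) : Prop := IsFace C.pt F ∧ rk C.pt F + 1 = C.rank

open Classical in
/-- The vertices joined to `i` by an edge. -/
noncomputable def nbr (C : VertexConfig ι W) (i : ι) : Finset ι :=
  Finset.univ.filter fun j => j ≠ i ∧ IsFace C.pt {i, j}

/-- A vertex is simple if its number of neighbours is the dimension, the least possible number. -/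
def Simple (C : VertexConfig ι W) (i : ι) : Prop := (C.nbr i).card + 1 = C.rank

variable (C : VertexConfig ι W)

theorem mem_nbr {i j : ι} : j ∈ C.nbr i ↔ j ≠ i ∧ IsFace C.pt {i, j} := by
  simp [nbr]

theorem mem_nbr_comm {i j : ι} : j ∈ C.nbr i ↔ i ∈ C.nbr j := by
  rw [mem_nbr, mem_nbr, ne_comm, Finset.pair_comm]

theorem isFace_empty : IsFace C.pt ∅ := ⟨-C.height, by simp, by simp [C.height_pt]⟩

theorem rk_singleton (i : ι) : rk C.pt {i} = 1 := by
  have h1 := (C.isFace_empty).rk_lt (G := {i}) (by simp)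
  have h2 := rk_le_card (x := C.pt) {i}
  rw [rk_empty] at h1
  rw [Finset.card_singleton] at h2
  omega

/-- An edge has no third vertex `k`: from each of its ends `k` would be a combination of the ends with
a negative coefficient at that end, as `{k}` is a face, but a positive one at the other end. -/
theorem eq_pair_of_rk_eq_two {G : Finset ι} (hr : rk C.pt G = 2) {i j : ι}
    (hi : i ∈ G) (hj : j ∈ G) (hij : i ≠ j) : G = {i, j} := by
  refine subset_antisymm (fun k hk => ?_) (Finset.insert_subset hi (Finset.singleton_subset_iff.2 hj))
  by_contra hne
  simp only [Finset.mem_insert, Finset.mem_singleton, not_or] at hne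
  have key : ∀ i j : ι, i ∈ G → j ∈ G → i ≠ j → k ≠ i → k ≠ j →
      ∃ c b : ℝ, 0 < c ∧ b < 0 ∧ C.pt k = c • C.pt j + b • C.pt i := by
    intro i j hi hj hij hki hkj
    obtain ⟨c, hc, h⟩ := (C.isFace_singleton i).exists_pos_sub_mem (H := G)
      (Finset.singleton_subset_iff.2 hi) (by rw [hr, C.rk_singleton]) hj
      (by simpa using hij.symm) hk (by simpa using hki)
    rw [spn, Finset.coe_singleton, Set.image_singleton, Submodule.mem_span_singleton] at h
    obtain ⟨b, hb⟩ := h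
    have hb' : C.pt k = c • C.pt j + b • C.pt i := by rw [hb]; abel
    refine ⟨c, b, hc, ?_, hb'⟩
    obtain ⟨l, l0, l1⟩ := C.isFace_singleton k
    have h0 := l0 k (by simp)
    have h1 := l1 i (by simpa using hki.symm)
    have h2 := l1 j (by simpa using hkj.symm)
    rw [hb'] at h0
    simp only [map_add, map_smul, smul_eq_mul] at h0
    nlinarith
  obtain ⟨c, b, hc, hb, h1⟩ := key i j hi hj hij hne.1 hne.2
  obtain ⟨c', b', hc', hb', h2⟩ := key j i hj hi hij.symm hne.2 hne.1
  obtain ⟨l, l0, l1⟩ := C.isFace_singleton i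
  have h3 := congrArg l (h1.symm.trans h2)
  have h4 := l1 j (by simpa using hij.symm)
  simp only [map_add, map_smul, smul_eq_mul, l0 i (Finset.mem_singleton_self i)] at h3
  nlinarith

theorem rk_pair {i j : ι} (hij : j ≠ i) : rk C.pt {i, j} = 2 := by
  have h1 := (C.isFace_singleton i).rk_lt (G := {i, j}) (by
    refine ⟨by simp, fun h => ?_⟩
    have := h (show j ∈ {i, j} by simp)
    exact hij (by simpa using this))
  have h2 := rk_le_card (x := C.pt) {i, j}
  rw [Finset.card_pair hij.symm] at h2
  rw [C.rk_singleton] at h1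
  omega

/-- If `i` does not maximize the linear functional `l` over the face `G`, then some neighbour of `i`
in `G` improves on `i`. -/
theorem exists_improving_nbr {G : Finset ι} (hG : IsFace C.pt G) {i : ι} (hi : i ∈ G)
    (l : W →ₗ[ℝ] ℝ) (hl : ∃ w ∈ G, l (C.pt i) < l (C.pt w)) :
    ∃ j ∈ C.nbr i, j ∈ G ∧ l (C.pt i) < l (C.pt j) := by
  obtain ⟨w, hw, hlw⟩ := hl
  have hm : ∀ j, (l - l (C.pt i) • C.height) (C.pt j) = l (C.pt j) - l (C.pt i) := fun j => by
    simp [C.height_pt]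
  obtain ⟨H, hH, hiH, hHG, hr, s, hs, hms⟩ := (C.isFace_singleton i).exists_improving hG
    (Finset.singleton_subset_iff.2 hi) (m := l - l (C.pt i) • C.height)
    (fun j hj => by rw [Finset.mem_singleton.1 hj, hm, sub_self]) ⟨w, hw, by rw [hm]; linarith⟩
  rw [hm] at hms
  rw [C.rk_singleton] at hr
  have hsi : s ≠ i := by
    rintro rfl
    simp at hms
  have hHe := C.eq_pair_of_rk_eq_two hr (hiH (Finset.mem_singleton_self i)) hs hsi.symm
  exact ⟨s, C.mem_nbr.2 ⟨hsi, hHe ▸ hH⟩, hHG hs, by linarith⟩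

/-- The edges of a face `G` at one of its vertices span `G`. -/
theorem spn_nbr {G : Finset ι} (hG : IsFace C.pt G) {i : ι} (hi : i ∈ G) :
    spn C.pt (insert i (C.nbr i ∩ G)) = spn C.pt G := by
  refine le_antisymm (spn_mono (Finset.insert_subset hi Finset.inter_subset_right))
    (spn_le fun w hw => ?_)
  by_contra hcon
  obtain ⟨m, hmw, hm⟩ := Submodule.exists_le_ker_of_notMem hcon
  have h0 : ∀ j ∈ insert i (C.nbr i ∩ G), m (C.pt j) = 0 := fun j hj =>
    LinearMap.mem_ker.1 (hm (mem_spn hj))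
  have key : ∀ l : W →ₗ[ℝ] ℝ, (∀ j ∈ insert i (C.nbr i ∩ G), l (C.pt j) = 0) →
      ¬ 0 < l (C.pt w) := by
    intro l hl hlw
    obtain ⟨j, hj, hjG, hlj⟩ := C.exists_improving_nbr hG hi l
      ⟨w, hw, by rwa [hl i (Finset.mem_insert_self _ _)]⟩
    rw [hl i (Finset.mem_insert_self _ _),
      hl j (Finset.mem_insert_of_mem (Finset.mem_inter.2 ⟨hj, hjG⟩))] at hlj
    exact lt_irrefl _ hlj
  have h1 := key m h0
  have h2 := key (-m) fun j hj => by simp [h0 j hj]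
  simp only [LinearMap.neg_apply, Left.neg_pos_iff] at h2
  exact hmw (le_antisymm (not_lt.1 h1) (not_lt.1 h2))

theorem rk_le_card_nbr {G : Finset ι} (hG : IsFace C.pt G) {i : ι} (hi : i ∈ G) :
    rk C.pt G ≤ (C.nbr i ∩ G).card + 1 := by
  have h := rk_le_card (x := C.pt) (insert i (C.nbr i ∩ G))
  rw [rk, C.spn_nbr hG hi] at h
  exact h.trans (Finset.card_insert_le _ _)

theorem rank_le_card_nbr (i : ι) : C.rank ≤ (C.nbr i).card + 1 := by
  simpa [rank] using C.rk_le_card_nbr isFace_univ (Finset.mem_univ i)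

/-- A face is determined by its edges at any one of its vertices. -/
theorem face_ext {F G : Finset ι} (hF : IsFace C.pt F) (hG : IsFace C.pt G) {i : ι} (hiF : i ∈ F)
    (hiG : i ∈ G) (h : C.nbr i ∩ F = C.nbr i ∩ G) : F = G := by
  have hs : spn C.pt F = spn C.pt G := by rw [← C.spn_nbr hF hiF, h, C.spn_nbr hG hiG]
  ext j
  exact ⟨fun hj => hG.mem_of_mem_spn (hs ▸ mem_spn hj), fun hj => hF.mem_of_mem_spn (hs ▸ mem_spn hj)⟩

theorem rk_union_le (S T : Finset ι) : rk C.pt (S ∪ T) ≤ rk C.pt S + T.card := by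
  induction T using Finset.induction_on with
  | empty => simp
  | insert i T hi ih =>
    rw [Finset.union_insert, Finset.card_insert_of_notMem hi]
    exact (rk_insert_le _ _).trans (by omega)

variable {C}

/-- The edges at a simple vertex are independent. -/
theorem Simple.le_rk {i : ι} (hs : C.Simple i) {I : Finset ι} (hI : I ⊆ C.nbr i) :
    I.card + 1 ≤ rk C.pt (insert i I) := by
  have h1 : C.rank = rk C.pt (insert i (C.nbr i)) := by
    have := C.spn_nbr isFace_univ (Finset.mem_univ i)
    rw [Finset.inter_univ] at this
    rw [rank, rk, rk, this]
  have h2 := C.rk_union_le (insert i I) (C.nbr i \ I)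
  rw [Finset.insert_union, Finset.union_sdiff_of_subset hI, ← h1, Finset.card_sdiff_of_subset hI] at h2
  have h3 := Finset.card_le_card hI
  have : (C.nbr i).card + 1 = C.rank := hs
  omega

theorem Simple.rk_eq {i : ι} (hs : C.Simple i) {G : Finset ι} (hG : IsFace C.pt G) (hi : i ∈ G) :
    rk C.pt G = (C.nbr i ∩ G).card + 1 := by
  refine le_antisymm (C.rk_le_card_nbr hG hi) ?_
  have h := hs.le_rk (I := C.nbr i ∩ G) Finset.inter_subset_left
  rwa [rk, C.spn_nbr hG hi] at h

/-- At a simple vertex, every set of edges spans a face: the functional that vanishes on these edges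
and is `-1` along the other ones is nonpositive, as no neighbour improves on the vertex. -/
theorem Simple.exists_face {i : ι} (hs : C.Simple i) {I : Finset ι} (hI : I ⊆ C.nbr i) :
    ∃ G, IsFace C.pt G ∧ i ∈ G ∧ C.nbr i ∩ G = I := by
  have h1 : ∀ j ∈ C.nbr i, ∃ m : W →ₗ[ℝ] ℝ, m (C.pt i) = 0 ∧
      (∀ k ∈ C.nbr i, k ≠ j → m (C.pt k) = 0) ∧ m (C.pt j) < 0 := by
    intro j hj
    have hnot : C.pt j ∉ spn C.pt (insert i ((C.nbr i).erase j)) := by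
      intro hcon
      have h2 : spn C.pt (insert i (C.nbr i)) ≤ spn C.pt (insert i ((C.nbr i).erase j)) := by
        refine spn_le fun k hk => ?_
        by_cases hkj : k = j
        · exact hkj ▸ hcon
        · refine mem_spn ?_
          rw [Finset.mem_insert] at hk ⊢
          exact hk.imp_right fun h => Finset.mem_erase.2 ⟨hkj, h⟩
      have h3 := hs.le_rk (I := C.nbr i) subset_rfl
      have h4 := rk_le_card (x := C.pt) (insert i ((C.nbr i).erase j))
      have h5 : rk C.pt _ ≤ rk C.pt _ := Submodule.finrank_mono h2
      have h6 := Finset.card_insert_le i ((C.nbr i).erase j)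
      rw [Finset.card_erase_of_mem hj] at h6
      have h7 := Finset.card_pos.2 ⟨j, hj⟩
      omega
    obtain ⟨m, hmj, hm⟩ := Submodule.exists_le_ker_of_notMem hnot
    have h0 : ∀ k ∈ insert i ((C.nbr i).erase j), m (C.pt k) = 0 := fun k hk =>
      LinearMap.mem_ker.1 (hm (mem_spn hk))
    have h0' : ∀ k ∈ C.nbr i, k ≠ j → m (C.pt k) = 0 := fun k hk hkj =>
      h0 k (Finset.mem_insert_of_mem (Finset.mem_erase.2 ⟨hkj, hk⟩))
    rcases lt_or_gt_of_ne hmj with h | h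
    · exact ⟨m, h0 i (Finset.mem_insert_self _ _), h0', h⟩
    · exact ⟨-m, by simp [h0 i (Finset.mem_insert_self _ _)], fun k hk hkj => by
        simp [h0' k hk hkj], by simpa using h⟩
  choose! m hm0 hm1 hm2 using h1
  set f : W →ₗ[ℝ] ℝ := ∑ j ∈ C.nbr i \ I, m j with hf
  have f0 : f (C.pt i) = 0 := by
    rw [hf, LinearMap.sum_apply]
    exact Finset.sum_eq_zero fun j hj => hm0 j (Finset.mem_sdiff.1 hj).1
  have f1 : ∀ k ∈ I, f (C.pt k) = 0 := fun k hk => by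
    rw [hf, LinearMap.sum_apply]
    refine Finset.sum_eq_zero fun j hj => hm1 j (Finset.mem_sdiff.1 hj).1 k (hI hk) ?_
    rintro rfl
    exact (Finset.mem_sdiff.1 hj).2 hk
  have f2 : ∀ k ∈ C.nbr i, k ∉ I → f (C.pt k) < 0 := fun k hk hkI => by
    have hkm : k ∈ C.nbr i \ I := Finset.mem_sdiff.2 ⟨hk, hkI⟩
    rw [hf, LinearMap.sum_apply, Finset.sum_eq_single_of_mem k hkm]
    · exact hm2 k hk
    · exact fun j hj hjk => hm1 j (Finset.mem_sdiff.1 hj).1 k hk hjk.symm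
  have f3 : ∀ k, f (C.pt k) ≤ 0 := by
    intro k
    by_contra hk
    obtain ⟨j, hj, -, hfj⟩ := C.exists_improving_nbr isFace_univ (Finset.mem_univ i) f
      ⟨k, Finset.mem_univ k, by rw [f0]; exact not_le.1 hk⟩
    rw [f0] at hfj
    by_cases hjI : j ∈ I
    · exact hfj.ne' (f1 j hjI)
    · exact hfj.not_gt (f2 j hj hjI)
  refine ⟨Finset.univ.filter fun k => f (C.pt k) = 0, ⟨f, by simp, fun k hk => ?_⟩, by simp [f0], ?_⟩
  · exact lt_of_le_of_ne (f3 k) (by simpa using hk)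
  · ext k
    simp only [Finset.mem_inter, Finset.mem_filter, Finset.mem_univ, true_and]
    refine ⟨fun h => ?_, fun h => ⟨hI h, f1 k h⟩⟩
    by_contra hkI
    exact (f2 k h.1 hkI).ne h.2

variable (C)

/-- Adjacency within the set `S`. -/
def AdjIn (S : Finset ι) (a b : ι) : Prop := b ∈ C.nbr a ∧ a ∈ S ∧ b ∈ S

theorem AdjIn.symm {S : Finset ι} {a b : ι} (h : C.AdjIn S a b) : C.AdjIn S b a :=
  ⟨C.mem_nbr_comm.1 h.1, h.2.2, h.2.1⟩

theorem AdjIn.reflTransGen_symm {S : Finset ι} {a b : ι}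
    (h : Relation.ReflTransGen (C.AdjIn S) a b) : Relation.ReflTransGen (C.AdjIn S) b a := by
  induction h with
  | refl => exact .refl
  | tail _ h ih => exact ih.head (AdjIn.symm C h)

/-- From every vertex of a face an `l`-increasing path leads to a vertex maximizing `l`. -/
theorem exists_climb {G : Finset ι} (hG : IsFace C.pt G) (l : W →ₗ[ℝ] ℝ) {i : ι} (hi : i ∈ G) :
    ∃ k ∈ G, (∀ j ∈ G, l (C.pt j) ≤ l (C.pt k)) ∧
      Relation.ReflTransGen (C.AdjIn (G.filter fun j => j = i ∨ l (C.pt i) < l (C.pt j))) i k := by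
  induction hn : (G.filter fun j => l (C.pt i) < l (C.pt j)).card using Nat.strong_induction_on
    generalizing i with
  | _ n ih =>
    subst hn
    by_cases hmax : ∀ j ∈ G, l (C.pt j) ≤ l (C.pt i)
    · exact ⟨i, hi, hmax, .refl⟩
    push Not at hmax
    obtain ⟨j, hj, hjG, hlj⟩ := C.exists_improving_nbr hG hi l hmax
    obtain ⟨k, hk, hkm, hpath⟩ := ih _ (Finset.card_lt_card (by
      refine ⟨fun a ha => ?_, fun h => ?_⟩
      · simp only [Finset.mem_filter] at ha ⊢
        exact ⟨ha.1, hlj.trans ha.2⟩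
      · have := h (Finset.mem_filter.2 ⟨hjG, hlj⟩)
        simp at this)) hjG rfl
    refine ⟨k, hk, hkm, Relation.ReflTransGen.head (b := j) ⟨hj, by simp [hi], by simp [hjG, hlj]⟩
      (Relation.ReflTransGen.mono (fun a b hab => ⟨hab.1, ?_, ?_⟩) _ _ hpath)⟩
    · have := hab.2.1
      simp only [Finset.mem_filter] at this ⊢
      exact ⟨this.1, .inr (this.2.elim (fun h => h ▸ hlj) hlj.trans)⟩
    · have := hab.2.2
      simp only [Finset.mem_filter] at this ⊢
      exact ⟨this.1, .inr (this.2.elim (fun h => h ▸ hlj) hlj.trans)⟩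

theorem AdjIn.mono {S T : Finset ι} (h : S ⊆ T) {a b : ι}
    (hab : Relation.ReflTransGen (C.AdjIn S) a b) : Relation.ReflTransGen (C.AdjIn T) a b :=
  Relation.ReflTransGen.mono (fun _ _ h' => ⟨h'.1, h h'.2.1, h h'.2.2⟩) _ _ hab

/-- The graph of a face is connected: climb to the target along a functional that it maximizes. -/
theorem connected_face {G : Finset ι} (hG : IsFace C.pt G) {i k : ι} (hi : i ∈ G) (hk : k ∈ G) :
    Relation.ReflTransGen (C.AdjIn G) i k := by
  obtain ⟨l, l0, l1⟩ := C.isFace_singleton k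
  obtain ⟨k', hk', hmax, hpath⟩ := C.exists_climb hG l hi
  have : k' = k := by
    by_contra hne
    have h1 := hmax k hk
    rw [l0 k (by simp)] at h1
    exact h1.not_gt (l1 k' (by simpa using hne))
  subst this
  exact AdjIn.mono C (Finset.filter_subset _ _) hpath

/-- All vertices outside `T` at which `l` is nonnegative, where `T` lies in the kernel of `l` and
`l` takes positive values, are connected outside `T`, through the face on which `l` is maximal. -/
theorem connected_upper {G T : Finset ι} (hG : IsFace C.pt G) {l : W →ₗ[ℝ] ℝ}
    (hT : ∀ i ∈ T, l (C.pt i) = 0) (hpos : ∃ w ∈ G, 0 < l (C.pt w)) {i k : ι}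
    (hi : i ∈ G \ T) (hk : k ∈ G \ T) (hli : 0 ≤ l (C.pt i)) (hlk : 0 ≤ l (C.pt k)) :
    Relation.ReflTransGen (C.AdjIn (G \ T)) i k := by
  obtain ⟨w, hw, hlw⟩ := hpos
  have climb : ∀ i ∈ G \ T, 0 ≤ l (C.pt i) → ∃ k ∈ G, (∀ j ∈ G, l (C.pt j) ≤ l (C.pt k)) ∧
      Relation.ReflTransGen (C.AdjIn (G \ T)) i k := by
    intro i hi hli
    obtain ⟨k, hk, hmax, hpath⟩ := C.exists_climb hG l (Finset.mem_sdiff.1 hi).1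
    refine ⟨k, hk, hmax, AdjIn.mono C (fun j hj => ?_) hpath⟩
    obtain ⟨hjG, hj⟩ := Finset.mem_filter.1 hj
    rcases hj with rfl | hj
    · exact hi
    · exact Finset.mem_sdiff.2 ⟨hjG, fun h => (hli.trans_lt hj).ne' (hT j h)⟩
  obtain ⟨i', hi', hmaxi, hpi⟩ := climb i hi hli
  obtain ⟨k', hk', hmaxk, hpk⟩ := climb k hk hlk
  have htop : IsFace C.pt (G.filter fun j => l (C.pt j) = l (C.pt i')) := by
    refine hG.trans (Finset.filter_subset _ _) (l := l - l (C.pt i') • C.height) ?_ ?_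
    · intro j hj
      simp [C.height_pt, (Finset.mem_filter.1 hj).2]
    · intro j hj hj'
      have h1 := hmaxi j hj
      have h2 : l (C.pt j) ≠ l (C.pt i') := fun h => hj' (Finset.mem_filter.2 ⟨hj, h⟩)
      simpa [C.height_pt] using lt_of_le_of_ne h1 h2
  have hmid := C.connected_face htop (i := i') (k := k') (by simp [hi'])
    (Finset.mem_filter.2 ⟨hk', le_antisymm (hmaxi k' hk') (hmaxk i' hi')⟩)
  have hsub : (G.filter fun j => l (C.pt j) = l (C.pt i')) ⊆ G \ T := fun j hj => by
    obtain ⟨hjG, hj⟩ := Finset.mem_filter.1 hj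
    refine Finset.mem_sdiff.2 ⟨hjG, fun h => ?_⟩
    have := hmaxi w hw
    rw [← hj, hT j h] at this
    exact hlw.not_ge this
  exact (hpi.trans (AdjIn.mono C hsub hmid)).trans (AdjIn.reflTransGen_symm C hpk)

/-- Balinski's theorem: removing fewer vertices than its dimension does not disconnect the graph of
a face. Given one remaining vertex, a functional vanishing there and on the removed set splits the
other vertices into those that can climb and those that can descend. -/
theorem balinski {G T : Finset ι} (hG : IsFace C.pt G) (hT : T.card + 2 ≤ rk C.pt G) {i k : ι}
    (hi : i ∈ G \ T) (hk : k ∈ G \ T) : Relation.ReflTransGen (C.AdjIn (G \ T)) i k := by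
  have h1 : ∃ u ∈ G, C.pt u ∉ spn C.pt (insert i T) := by
    by_contra! hcon
    have h2 : rk C.pt G ≤ rk C.pt (insert i T) := Submodule.finrank_mono (spn_le hcon)
    have h3 := rk_le_card (x := C.pt) (insert i T)
    have h4 := Finset.card_insert_le i T
    omega
  obtain ⟨u, hu, hus⟩ := h1
  obtain ⟨m, hmu, hm⟩ := Submodule.exists_le_ker_of_notMem hus
  have h0 : ∀ j ∈ insert i T, m (C.pt j) = 0 := fun j hj => LinearMap.mem_ker.1 (hm (mem_spn hj))
  have key : ∀ l : W →ₗ[ℝ] ℝ, (∀ j ∈ insert i T, l (C.pt j) = 0) → 0 < l (C.pt u) →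
      Relation.ReflTransGen (C.AdjIn (G \ T)) i k := by
    intro l hl hlu
    have hli := hl i (Finset.mem_insert_self _ _)
    have hlT : ∀ j ∈ T, l (C.pt j) = 0 := fun j hj => hl j (Finset.mem_insert_of_mem hj)
    rcases le_or_gt 0 (l (C.pt k)) with hlk | hlk
    · exact C.connected_upper hG hlT ⟨u, hu, hlu⟩ hi hk hli.ge hlk
    · exact C.connected_upper hG (l := -l) (fun j hj => by simp [hlT j hj])
        ⟨k, (Finset.mem_sdiff.1 hk).1, by simpa using hlk⟩ hi hk (by simp [hli])
        (by simpa using hlk.le)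
  rcases lt_or_gt_of_ne hmu with h | h
  · exact key (-m) (fun j hj => by simp [h0 j hj]) (by simpa using h)
  · exact key m h0 h

variable {C}

/-- A family of facets that is closed under passing to a neighbour across a ridge contains, together
with one facet through a face `K`, all facets through `K`. By induction on the corank of `K` this
holds at the faces of one rank more, and these are connected by the graph of the quotient by `K`,
in which one climbs towards a target `H'`. -/
theorem facet_connected {𝒢 : Finset ι → Prop}
    (h𝒢 : ∀ F F', 𝒢 F → C.IsFacet F → C.IsFacet F' → rk C.pt (F ∩ F') + 2 = C.rank → 𝒢 F')
    {K : Finset ι} (hK : IsFace C.pt K) {F F' : Finset ι} (hF : C.IsFacet F) (hF' : C.IsFacet F')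
    (hKF : K ⊆ F) (hKF' : K ⊆ F') (hg : 𝒢 F) : 𝒢 F' := by
  induction hn : C.rank - rk C.pt K using Nat.strong_induction_on generalizing K F F' with
  | _ n ih =>
    subst hn
    have hrF := hF.2
    have hrF' := hF'.2
    have hKr := rk_mono (x := C.pt) hKF
    by_cases c1 : rk C.pt K + 1 = C.rank
    · have e1 := subset_antisymm hKF (hK.subset_of_rk_le hKF (by omega))
      have e2 := subset_antisymm hKF' (hK.subset_of_rk_le hKF' (by omega))
      rwa [← e2, e1]
    by_cases hFF : F = F'
    · rwa [← hFF]
    by_cases c2 : rk C.pt K + 2 = C.rank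
    · refine h𝒢 F F' hg hF hF' ?_
      have h1 := rk_mono (x := C.pt) (Finset.subset_inter hKF hKF')
      have h2 := (hF.1.inter hF'.1).rk_lt (G := F) ⟨Finset.inter_subset_left, fun h => hFF
        (subset_antisymm (h.trans Finset.inter_subset_right)
          (hF.1.subset_of_rk_le (h.trans Finset.inter_subset_right) (by omega)))⟩
      omega
    -- the inductive step at a face of rank one more, as soon as one facet through it is in `𝒢`
    have hstep : ∀ H, IsFace C.pt H → rk C.pt H = rk C.pt K + 1 → (∃ F, C.IsFacet F ∧ H ⊆ F ∧ 𝒢 F) →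
        ∀ F', C.IsFacet F' → H ⊆ F' → 𝒢 F' := by
      rintro H hH hrH ⟨F, hF, hHF, hgF⟩ F' hF' hHF'
      exact ih (C.rank - rk C.pt H) (by omega) hH hF hF' hHF hHF' hgF rfl
    have hss : ∀ F, C.IsFacet F → K ⊆ F → K ⊂ F := fun F hF h => ⟨h, fun h' => by
      have := rk_mono (x := C.pt) h'
      have := hF.2
      omega⟩
    obtain ⟨H', hH', hKH', hH'F, hrH'⟩ := hK.exists_rk_succ hF'.1 (hss F' hF' hKF')
    obtain ⟨H₀, hH₀, hKH₀, hH₀F, hrH₀⟩ := hK.exists_rk_succ hF.1 (hss F hF hKF)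
    obtain ⟨f, f0, f1⟩ := id hK
    obtain ⟨l, l0, l1⟩ := id hH'
    have hmem : ∀ H, rk C.pt H = rk C.pt K + 1 → ∃ s ∈ H, s ∉ K := by
      intro H hr
      by_contra! hcon
      have := rk_mono (x := C.pt) (show H ⊆ K from hcon)
      omega
    -- climbing in the quotient by `K`: its vertices are the faces `H` of one rank more, represented by
    -- some `s ∈ H \ K`, and the slope `l / (-f)` at `s` does not depend on the choice of `s`; it is
    -- zero for `H'` and negative for the others
    have main : ∀ (k : ℕ) (s : ι) (H : Finset ι), s ∈ H → s ∉ K → IsFace C.pt H → K ⊆ H →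
        rk C.pt H = rk C.pt K + 1 → (∃ F, C.IsFacet F ∧ H ⊆ F ∧ 𝒢 F) →
        (Finset.univ.filter fun j => j ∉ K ∧
          l (C.pt s) / -f (C.pt s) < l (C.pt j) / -f (C.pt j)).card = k → 𝒢 F' := by
      intro k
      induction k using Nat.strong_induction_on with
      | _ k ihk =>
        intro s H hsH hsK hH hKH hrH hgood hk
        by_cases hsH' : s ∈ H'
        · have h1 : rk C.pt K < rk C.pt (H ∩ H') := hK.rk_lt ⟨Finset.subset_inter hKH hKH', fun h =>
            hsK (h (Finset.mem_inter.2 ⟨hsH, hsH'⟩))⟩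
          have h2 : H ⊆ H' := ((hH.inter hH').subset_of_rk_le Finset.inter_subset_left
            (by omega)).trans Finset.inter_subset_right
          exact hstep H hH hrH hgood F' hF' (h2.trans hH'F)
        have hls := l1 s hsH'
        have hfs := f1 s hsK
        set c : ℝ := l (C.pt s) / -f (C.pt s) with hc
        have hcneg : c < 0 := div_neg_of_neg_of_pos hls (by linarith)
        set m : W →ₗ[ℝ] ℝ := l + c • f with hm
        have hmv : ∀ w, m w = l w + c * f w := fun w => by simp [hm]
        have hmK : ∀ i ∈ K, m (C.pt i) = 0 := fun i hi => by
          rw [hmv, l0 i (hKH' hi), f0 i hi]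
          ring
        have hms : m (C.pt s) = 0 := by
          rw [hmv, hc, div_neg, neg_mul, div_mul_cancel₀ _ hfs.ne]
          ring
        have hmH : ∀ i ∈ H, m (C.pt i) = 0 := by
          intro i hi
          by_cases hiK : i ∈ K
          · exact hmK i hiK
          obtain ⟨a, -, ha⟩ := hK.exists_pos_sub_mem hKH hrH hsH hsK hi hiK
          have := eq_zero_of_mem_spn hmK ha
          simpa [hms] using this
        obtain ⟨w, hwH', hwK⟩ := hmem H' hrH'
        have hmw : 0 < m (C.pt w) := by
          rw [hmv, l0 w hwH', zero_add]
          exact mul_pos_of_neg_of_neg hcneg (f1 w hwK)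
        -- `m` vanishes on `H` and is positive where the slope exceeds `c`; so some `J` of one rank more
        -- than `H` contains a face `H₁` over `K` of bigger slope, and `H`, `H₁` share a facet `F₁`
        obtain ⟨J, hJ, hHJ, -, hrJ, t, htJ, hmt⟩ := hH.exists_improving isFace_univ
          (Finset.subset_univ H) hmH ⟨w, Finset.mem_univ w, hmw⟩
        obtain ⟨H₁, hH₁, hKH₁, hH₁J, hrH₁, s₁, hs₁, hms₁⟩ := hK.exists_improving hJ (hKH.trans hHJ)
          hmK ⟨t, htJ, hmt⟩
        have hJu : ∃ v, v ∉ J := by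
          by_contra! hcon
          have : J = Finset.univ := Finset.eq_univ_iff_forall.2 hcon
          have : rk C.pt J = C.rank := by rw [this, rank]
          omega
        obtain ⟨v, hv⟩ := hJu
        obtain ⟨F₁, hF₁, hJF₁, -, -, hrF₁⟩ := hJ.exists_facet isFace_univ (Finset.subset_univ J)
          (Finset.mem_univ v) hv
        have hgF₁ := hstep H hH hrH hgood F₁ ⟨hF₁, hrF₁⟩ (hHJ.trans hJF₁)
        have hs₁K : s₁ ∉ K := fun h => hms₁.ne' (hmK s₁ h)
        have hfs₁ := f1 s₁ hs₁K
        have hcs₁ : c < l (C.pt s₁) / -f (C.pt s₁) := by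
          rw [lt_div_iff₀ (by linarith)]
          rw [hmv] at hms₁
          linarith
        refine ihk _ ?_ s₁ H₁ hs₁ hs₁K hH₁ hKH₁ hrH₁ ⟨F₁, ⟨hF₁, hrF₁⟩, hH₁J.trans hJF₁, hgF₁⟩ rfl
        rw [← hk]
        refine Finset.card_lt_card ⟨fun j hj => ?_, fun h => ?_⟩
        · simp only [Finset.mem_filter] at hj ⊢
          exact ⟨hj.1, hj.2.1, hcs₁.trans hj.2.2⟩
        · have := h (Finset.mem_filter.2 ⟨Finset.mem_univ s₁, hs₁K, hcs₁⟩)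
          simp at this
    obtain ⟨s, hs, hsK⟩ := hmem H₀ hrH₀
    exact main _ s H₀ hs hsK hH₀ hKH₀ hrH₀ ⟨F, hF, hH₀F, hg⟩ rfl

end VertexConfig

end VertexConfigs

/-! ### Facets with few nonsimple vertices -/

section FewNonsimple

variable {ι W : Type*} [Fintype ι] [DecidableEq ι] [AddCommGroup W] [Module ℝ W]
  [FiniteDimensional ℝ W]

namespace VertexConfig

open Classical in
/-- The nonsimple vertices in `F`. -/
noncomputable def nonsimple (C : VertexConfig ι W) (F : Finset ι) : Finset ι :=
  F.filter fun i => ¬ C.Simple i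

/-- Every facet has at most `d - 2` nonsimple vertices, where `d` is the rank of the facets. -/
def FewNonsimple (C : VertexConfig ι W) : Prop :=
  ∀ F, C.IsFacet F → (C.nonsimple F).card + 2 ≤ rk C.pt F

/-- The facet `F` contains `v` but misses its neighbour `u`. When `v` is simple, this is the only
neighbour of `v` that `F` misses, and it determines `F`. -/
def Misses (C : VertexConfig ι W) (F : Finset ι) (v u : ι) : Prop :=
  v ∈ F ∧ u ∈ C.nbr v ∧ u ∉ F

/-- `u - v - v' - u'` is a path on a 2-face with `v` and `v'` simple: a facet through `v` and `v'`
that misses `u` also misses `u'`. -/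
def Linked (C : VertexConfig ι W) (v u v' u' : ι) : Prop :=
  C.Simple v ∧ C.Simple v' ∧ u ∈ C.nbr v ∧ v' ∈ C.nbr v ∧ u ≠ v' ∧ u' ∈ C.nbr v' ∧ u' ≠ v ∧
    ∃ R, IsFace C.pt R ∧ rk C.pt R = 3 ∧ v ∈ R ∧ u ∈ R ∧ v' ∈ R ∧ u' ∈ R

variable {C : VertexConfig ι W}

theorem mem_nonsimple {F : Finset ι} {i : ι} : i ∈ C.nonsimple F ↔ i ∈ F ∧ ¬ C.Simple i := by
  simp [nonsimple]

theorem Simple.inter_eq_erase {v u : ι} (hv : C.Simple v) {F : Finset ι} (hF : C.IsFacet F)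
    (h : C.Misses F v u) : C.nbr v ∩ F = (C.nbr v).erase u := by
  have h1 := hv.rk_eq hF.1 h.1
  have h2 := hF.2
  have h3 : (C.nbr v).card + 1 = C.rank := hv
  refine Finset.eq_of_subset_of_card_le (fun w hw => ?_) ?_
  · rw [Finset.mem_inter] at hw
    exact Finset.mem_erase.2 ⟨fun h' => h.2.2 (h' ▸ hw.2), hw.1⟩
  · rw [Finset.card_erase_of_mem h.2.1]
    omega

theorem Simple.exists_misses {v : ι} (hv : C.Simple v) {F : Finset ι} (hF : C.IsFacet F)
    (hvF : v ∈ F) : ∃ u, C.Misses F v u := by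
  have h1 := hv.rk_eq hF.1 hvF
  have h2 := hF.2
  have h3 : (C.nbr v).card + 1 = C.rank := hv
  obtain ⟨u, hu, hu'⟩ := Finset.exists_mem_notMem_of_card_lt_card
    (s := C.nbr v ∩ F) (t := C.nbr v) (by omega)
  exact ⟨u, hvF, hu, fun h => hu' (Finset.mem_inter.2 ⟨hu, h⟩)⟩

theorem Simple.exists_facet {v u : ι} (hv : C.Simple v) (hu : u ∈ C.nbr v) :
    ∃ F, C.IsFacet F ∧ C.Misses F v u := by
  obtain ⟨F, hF, hvF, hI⟩ := hv.exists_face (Finset.erase_subset u (C.nbr v))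
  refine ⟨F, ⟨hF, ?_⟩, hvF, hu, fun h => ?_⟩
  · rw [hv.rk_eq hF hvF, hI, Finset.card_erase_of_mem hu]
    have h3 : (C.nbr v).card + 1 = C.rank := hv
    have := Finset.card_pos.2 ⟨u, hu⟩
    omega
  · have := hI ▸ Finset.mem_inter.2 ⟨hu, h⟩
    simp at this

theorem Simple.facet_unique {v u : ι} (hv : C.Simple v) {F G : Finset ι} (hF : C.IsFacet F)
    (hG : C.IsFacet G) (h : C.Misses F v u) (h' : C.Misses G v u) : F = G :=
  C.face_ext hF.1 hG.1 h.1 h'.1 (by rw [hv.inter_eq_erase hF h, hv.inter_eq_erase hG h'])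

theorem Simple.mem_of_misses {v u w : ι} (hv : C.Simple v) {F : Finset ι} (hF : C.IsFacet F)
    (h : C.Misses F v u) (hw : w ∈ C.nbr v) (hwu : w ≠ u) : w ∈ F := by
  have : w ∈ C.nbr v ∩ F := by
    rw [hv.inter_eq_erase hF h]
    exact Finset.mem_erase.2 ⟨hwu, hw⟩
  exact (Finset.mem_inter.1 this).2

/-- If the facet contained `u'`, it would contain two edges of the 2-face at the simple vertex `v'`,
hence the whole 2-face. -/
theorem Linked.misses {v u v' u' : ι} (h : C.Linked v u v' u') {F : Finset ι} (hF : C.IsFacet F)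
    (hm : C.Misses F v u) : C.Misses F v' u' := by
  obtain ⟨hv, hv', -, hvv', huv', hu', huv, R, hR, hr, hvR, huR, hvR', huR'⟩ := h
  have hvF' := hv.mem_of_misses hF hm hvv' huv'.symm
  refine ⟨hvF', hu', fun huF' => hm.2.2 ?_⟩
  have h1 := hv'.rk_eq (hR.inter hF.1) (Finset.mem_inter.2 ⟨hvR', hvF'⟩)
  have h2 : ({v, u'} : Finset ι) ⊆ C.nbr v' ∩ (R ∩ F) := by
    intro w hw
    simp only [Finset.mem_insert, Finset.mem_singleton] at hw
    rcases hw with rfl | rfl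
    · simp [C.mem_nbr_comm.1 hvv', hvR, hm.1]
    · simp [hu', huR', huF']
  have h3 := Finset.card_le_card h2
  rw [Finset.card_pair huv.symm] at h3
  exact (Finset.mem_inter.1 ((hR.inter hF.1).subset_of_rk_le Finset.inter_subset_left
    (by omega) huR)).2

/-- The link carrying `u` from `v` to `v'` runs along the 2-face that `u` and `v'` span at `v`. -/
theorem exists_linked {v u v' : ι} (hv : C.Simple v) (hv' : C.Simple v') (hu : u ∈ C.nbr v)
    (hvv' : v' ∈ C.nbr v) (huv' : u ≠ v') : ∃ u', C.Linked v u v' u' := by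
  obtain ⟨R, hR, hvR, hI⟩ := hv.exists_face (I := {u, v'})
    (Finset.insert_subset hu (Finset.singleton_subset_iff.2 hvv'))
  have hr : rk C.pt R = 3 := by rw [hv.rk_eq hR hvR, hI, Finset.card_pair huv']
  have huR : u ∈ R := (Finset.mem_inter.1 (hI.symm ▸ (show u ∈ {u, v'} by simp))).2
  have hvR' : v' ∈ R := (Finset.mem_inter.1 (hI.symm ▸ (show v' ∈ {u, v'} by simp))).2
  have h1 := hv'.rk_eq hR hvR'
  obtain ⟨u', hu', hne⟩ := Finset.exists_mem_ne (s := C.nbr v' ∩ R) (by omega) v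
  rw [Finset.mem_inter] at hu'
  exact ⟨u', hv, hv', hu, hvv', huv', hu'.1, hne, R, hR, hr, hvR, huR, hvR', hu'.2⟩

theorem FewNonsimple.exists_simple_of_card (hC : C.FewNonsimple) {F S : Finset ι}
    (hF : C.IsFacet F) (hS : S ⊆ F) (h : C.rank ≤ S.card + 2) : ∃ v ∈ S, C.Simple v := by
  by_contra! hcon
  have h1 : S ⊆ C.nonsimple F := fun v hv => mem_nonsimple.2 ⟨hS hv, hcon v hv⟩
  have h2 := Finset.card_le_card h1
  have h3 := hC F hF
  have := hF.2
  omega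

theorem FewNonsimple.exists_simple (hC : C.FewNonsimple) {F : Finset ι} (hF : C.IsFacet F) :
    ∃ v ∈ F, C.Simple v := by
  refine hC.exists_simple_of_card hF subset_rfl ?_
  have h1 := rk_le_card (x := C.pt) F
  have := hF.2
  omega

/-- In a facet with few nonsimple vertices, every vertex has a simple neighbour. -/
theorem FewNonsimple.exists_simple_nbr (hC : C.FewNonsimple) {F : Finset ι} (hF : C.IsFacet F)
    {w : ι} (hw : w ∈ F) : ∃ v ∈ F, C.Simple v ∧ w ∈ C.nbr v := by
  have h1 := C.rk_le_card_nbr hF.1 hw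
  have := hF.2
  obtain ⟨v, hv, hs⟩ := hC.exists_simple_of_card (S := C.nbr w ∩ F) hF Finset.inter_subset_right
    (by omega)
  rw [Finset.mem_inter] at hv
  exact ⟨v, hv.2, hs, C.mem_nbr_comm.1 hv.1⟩

/-- Walking in a facet `F` along edges between its simple vertices, the neighbour missed by `F` is
carried along by the links, so that a set of pairs closed under links contains, together with one
pair `(v, u)` such that `F` misses the neighbour `u` of `v`, all such pairs. -/
theorem FewNonsimple.mem_of_linked (hC : C.FewNonsimple) {F : Finset ι} (hF : C.IsFacet F)
    {X : ι → ι → Prop} (hX : ∀ v u v' u', X v u → C.Linked v u v' u' → X v' u') {v u v' u' : ι}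
    (hv : C.Simple v) (hm : C.Misses F v u) (hx : X v u) (hv' : C.Simple v')
    (hm' : C.Misses F v' u') : X v' u' := by
  have hpath := C.balinski hF.1 (hC F hF) (i := v) (k := v')
    (Finset.mem_sdiff.2 ⟨hm.1, fun h => (mem_nonsimple.1 h).2 hv⟩)
    (Finset.mem_sdiff.2 ⟨hm'.1, fun h => (mem_nonsimple.1 h).2 hv'⟩)
  suffices h : ∃ w, C.Misses F v' w ∧ X v' w by
    obtain ⟨w, hw, hxw⟩ := h
    by_cases hwu : u' = w
    · exact hwu ▸ hxw
    · exact absurd (hv'.mem_of_misses hF hw hm'.2.1 hwu) hm'.2.2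
  clear hm' hv'
  induction hpath with
  | refl => exact ⟨u, hm, hx⟩
  | @tail b c _ hbc ih =>
    obtain ⟨w, hw, hxw⟩ := ih
    have hs : ∀ a, a ∈ F \ C.nonsimple F → C.Simple a := fun a ha => by
      rw [Finset.mem_sdiff, mem_nonsimple] at ha
      by_contra h
      exact ha.2 ⟨ha.1, h⟩
    obtain ⟨w', hl⟩ := exists_linked (hs b hbc.2.1) (hs c hbc.2.2) hw.2.1 hbc.1 (by
      rintro rfl
      exact hw.2.2 (Finset.mem_sdiff.1 hbc.2.2).1)
    exact ⟨w', hl.misses hF hw, hX _ _ _ _ hxw hl⟩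

/-- The vertices of a facet are its simple vertices and their neighbours except the missed ones. -/
theorem FewNonsimple.mem_facet_iff (hC : C.FewNonsimple) {F : Finset ι} (hF : C.IsFacet F) {w : ι} :
    w ∈ F ↔ ∃ v u, C.Simple v ∧ C.Misses F v u ∧ (w = v ∨ w ∈ C.nbr v ∧ w ≠ u) := by
  constructor
  · intro hw
    obtain ⟨v, hv, hs, hwv⟩ := hC.exists_simple_nbr hF hw
    obtain ⟨u, hu⟩ := hs.exists_misses hF hv
    exact ⟨v, u, hs, hu, .inr ⟨hwv, fun h => hu.2.2 (h ▸ hw)⟩⟩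
  · rintro ⟨v, u, hs, hm, rfl | ⟨hw, hwu⟩⟩
    · exact hm.1
    · exact hs.mem_of_misses hF hm hw hwu

end VertexConfig

end FewNonsimple

/-! ### Configurations with the same 2-skeleton -/

section SameSkeleton

namespace VertexConfig

variable {ι V W : Type*} [Fintype ι] [DecidableEq ι] [AddCommGroup V] [Module ℝ V]
  [FiniteDimensional ℝ V] [AddCommGroup W] [Module ℝ W] [FiniteDimensional ℝ W]

/-- The two configurations have the same rank and the same faces of ranks two and three. -/
structure SameSkeleton (A : VertexConfig ι V) (B : VertexConfig ι W) : Prop where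
  rank_eq : A.rank = B.rank
  edge : ∀ T, rk A.pt T = 2 → IsFace A.pt T → IsFace B.pt T ∧ rk B.pt T = 2
  edge' : ∀ T, rk B.pt T = 2 → IsFace B.pt T → IsFace A.pt T ∧ rk A.pt T = 2
  polygon : ∀ T, rk A.pt T = 3 → IsFace A.pt T → IsFace B.pt T ∧ rk B.pt T = 3
  polygon' : ∀ T, rk B.pt T = 3 → IsFace B.pt T → IsFace A.pt T ∧ rk A.pt T = 3

variable {A : VertexConfig ι V} {B : VertexConfig ι W}

theorem SameSkeleton.symm (h : SameSkeleton A B) : SameSkeleton B A :=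
  ⟨h.rank_eq.symm, h.edge', h.edge, h.polygon', h.polygon⟩

theorem SameSkeleton.nbr_subset (h : SameSkeleton A B) (i : ι) : A.nbr i ⊆ B.nbr i := fun j hj => by
  rw [mem_nbr] at hj ⊢
  exact ⟨hj.1, (h.edge _ (A.rk_pair hj.1) hj.2).1⟩

theorem SameSkeleton.nbr_eq (h : SameSkeleton A B) (i : ι) : A.nbr i = B.nbr i :=
  subset_antisymm (h.nbr_subset i) (h.symm.nbr_subset i)

theorem SameSkeleton.simple_iff (h : SameSkeleton A B) (i : ι) : A.Simple i ↔ B.Simple i := by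
  rw [Simple, Simple, h.nbr_eq, h.rank_eq]

theorem SameSkeleton.misses_iff (h : SameSkeleton A B) {F : Finset ι} {v u : ι} :
    A.Misses F v u ↔ B.Misses F v u := by
  rw [Misses, Misses, h.nbr_eq]

theorem SameSkeleton.linked (h : SameSkeleton A B) {v u v' u' : ι} (hl : A.Linked v u v' u') :
    B.Linked v u v' u' := by
  obtain ⟨h1, h2, h3, h4, h5, h6, h7, R, hR, hr, h8⟩ := hl
  rw [h.simple_iff] at h1 h2
  rw [h.nbr_eq] at h3 h4 h6
  exact ⟨h1, h2, h3, h4, h5, h6, h7, R, (h.polygon R hr hR).1, (h.polygon R hr hR).2, h8⟩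

/-- Facets of the two configurations that agree at one simple vertex are equal. The links show that
they agree at all simple vertices of `F`; as at most `d - 2` vertices of `F` remain, deleting these
leaves the graph of `G` connected, so that `G` has no further simple vertices. -/
theorem SameSkeleton.facet_eq (h : SameSkeleton A B) (hA : A.FewNonsimple) {F G : Finset ι}
    (hF : A.IsFacet F) (hG : B.IsFacet G) {v u : ι} (hv : A.Simple v) (hmF : A.Misses F v u)
    (hmG : B.Misses G v u) : F = G := by
  have hall : ∀ v' u', A.Simple v' → A.Misses F v' u' → B.Misses G v' u' := by
    intro v' u' hv' hm'
    exact hA.mem_of_linked hF (X := fun a b => B.Misses G a b)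
      (fun a b a' b' hab hl => (h.linked hl).misses hG hab) hv hmF hmG hv' hm'
  have hFG : F ⊆ G := fun w hw => by
    obtain ⟨a, b, ha, hab, hwa⟩ := (hA.mem_facet_iff hF).1 hw
    have := hall a b ha hab
    rcases hwa with rfl | ⟨hwa, hwb⟩
    · exact this.1
    · exact ((h.simple_iff a).1 ha).mem_of_misses hG this (h.nbr_eq a ▸ hwa) hwb
  refine subset_antisymm hFG fun w hw => ?_
  by_contra hwF
  have hpath := B.balinski hG.1 (T := A.nonsimple F) (by
      have h1 := hA F hF
      have h2 := hF.2
      have h3 := hG.2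
      have h4 := h.rank_eq
      omega) (i := v) (k := w)
    (Finset.mem_sdiff.2 ⟨hmG.1, fun h' => (mem_nonsimple.1 h').2 hv⟩)
    (Finset.mem_sdiff.2 ⟨hw, fun h' => hwF (mem_nonsimple.1 h').1⟩)
  have : w ∈ F ∧ A.Simple w := by
    clear hwF hw
    induction hpath with
    | refl => exact ⟨hmF.1, hv⟩
    | @tail b c _ hbc ih =>
      obtain ⟨hbF, hb⟩ := ih
      obtain ⟨b', hb'⟩ := hb.exists_misses hF hbF
      have hcF : c ∈ F := hb.mem_of_misses hF hb' ((h.nbr_eq b).symm ▸ hbc.1) (by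
        rintro rfl
        exact (hall b _ hb hb').2.2 (Finset.mem_sdiff.1 hbc.2.2).1)
      refine ⟨hcF, ?_⟩
      by_contra hc
      exact (Finset.mem_sdiff.1 hbc.2.2).2 (mem_nonsimple.2 ⟨hcF, hc⟩)
  exact hwF this.1

theorem SameSkeleton.isFacet_right (h : SameSkeleton A B) (hA : A.FewNonsimple) {F : Finset ι}
    (hF : A.IsFacet F) : B.IsFacet F := by
  obtain ⟨v, hvF, hv⟩ := hA.exists_simple hF
  obtain ⟨u, hu⟩ := hv.exists_misses hF hvF
  obtain ⟨G, hG, hmG⟩ := ((h.simple_iff v).1 hv).exists_facet (h.misses_iff.1 hu).2.1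
  rwa [h.facet_eq hA hF hG hv hu hmG]

/-- Facets of `B` adjacent to a facet of `A` share a ridge with it, which has at least `d - 1`
vertices and hence a simple one. So they are facets of `A` too, and `facet_connected` applies. -/
theorem SameSkeleton.isFacet_left (h : SameSkeleton A B) (hA : A.FewNonsimple) {G : Finset ι}
    (hG : B.IsFacet G) : A.IsFacet G := by
  have hsimple : ∀ G v, B.IsFacet G → v ∈ G → A.Simple v → A.IsFacet G := by
    intro G v hG hvG hv
    obtain ⟨u, hu⟩ := ((h.simple_iff v).1 hv).exists_misses hG hvG
    obtain ⟨F, hF, hmF⟩ := hv.exists_facet (h.misses_iff.2 hu).2.1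
    rwa [← h.facet_eq hA hF hG hv hmF hu]
  obtain ⟨F, hF⟩ : ∃ F, A.IsFacet F := by
    have hr : 0 < A.rank := by
      have := hG.2
      have := h.rank_eq
      omega
    have : ∃ v : ι, True := by
      by_contra! hcon
      have h1 := rk_le_card (x := A.pt) Finset.univ
      have h2 : (Finset.univ : Finset ι).card = 0 := Finset.card_eq_zero.2
        (Finset.eq_empty_of_forall_notMem fun v => (hcon v).elim)
      rw [rank] at hr
      omega
    obtain ⟨v, -⟩ := this
    obtain ⟨F, hF, -, -, -, hr⟩ := A.isFace_empty.exists_facet isFace_univ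
      (Finset.empty_subset _) (Finset.mem_univ v) (Finset.notMem_empty v)
    exact ⟨F, hF, hr⟩
  refine facet_connected (C := B) (𝒢 := A.IsFacet) ?_ B.isFace_empty (h.isFacet_right hA hF) hG
    (Finset.empty_subset _) (Finset.empty_subset _) hF
  intro F F' hF _ hF' hr
  have h1 := rk_le_card (x := B.pt) (F ∩ F')
  obtain ⟨v, hv, hs⟩ := hA.exists_simple_of_card hF (S := F ∩ F') Finset.inter_subset_left (by
    have := h.rank_eq
    omega)
  exact hsimple F' v hF' (Finset.mem_inter.1 hv).2 hs

/-- A face that avoids some vertex is the intersection of the facets containing it. -/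
theorem isFace_of_facets_subset (hAB : ∀ F, A.IsFacet F → B.IsFacet F) {T : Finset ι}
    (hT : IsFace A.pt T) : IsFace B.pt T := by
  have h1 : ∀ S : Finset ι, T ∩ S = ∅ → ∃ U, IsFace B.pt U ∧ T ⊆ U ∧ U ∩ S = ∅ := by
    intro S
    induction S using Finset.induction_on with
    | empty => exact fun _ => ⟨_, isFace_univ, Finset.subset_univ _, by simp⟩
    | insert v S hv ih =>
      intro hTS
      rw [← Finset.disjoint_iff_inter_eq_empty, Finset.disjoint_insert_right] at hTS
      obtain ⟨U, hU, hTU, hUS⟩ := ih (Finset.disjoint_iff_inter_eq_empty.1 hTS.2)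
      obtain ⟨F, hF, hTF, -, hvF, hr⟩ := hT.exists_facet isFace_univ (Finset.subset_univ _)
        (Finset.mem_univ v) hTS.1
      refine ⟨U ∩ F, hU.inter (hAB F ⟨hF, hr⟩).1, Finset.subset_inter hTU hTF, ?_⟩
      rw [← Finset.disjoint_iff_inter_eq_empty, Finset.disjoint_insert_right]
      exact ⟨fun h => hvF (Finset.mem_inter.1 h).2,
        (Finset.disjoint_iff_inter_eq_empty.2 hUS).mono_left Finset.inter_subset_left⟩
  obtain ⟨U, hU, hTU, hUT⟩ := h1 Tᶜ (by simp)
  have : T = U := subset_antisymm hTU fun w hw => by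
    by_contra h
    have : w ∈ U ∩ Tᶜ := by simp [hw, h]
    rw [hUT] at this
    simp at this
  rwa [this]

/-- The 2-skeleton determines all faces. -/
theorem SameSkeleton.isFace_iff (h : SameSkeleton A B) (hA : A.FewNonsimple) {T : Finset ι} :
    IsFace A.pt T ↔ IsFace B.pt T :=
  ⟨isFace_of_facets_subset fun _ => h.isFacet_right hA, isFace_of_facets_subset fun _ =>
    h.isFacet_left hA⟩

end VertexConfig

end SameSkeleton

/-! ### The size of the face lattice -/

section Counting

variable {ι W : Type*} [Fintype ι] [DecidableEq ι] [AddCommGroup W] [Module ℝ W]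
  [FiniteDimensional ℝ W]

namespace VertexConfig

open Classical in
/-- The proper faces. -/
noncomputable def properFaces (C : VertexConfig ι W) : Finset (Finset ι) :=
  Finset.univ.filter fun T => IsFace C.pt T ∧ T ≠ Finset.univ

variable {C : VertexConfig ι W}

theorem mem_properFaces {T : Finset ι} : T ∈ C.properFaces ↔ IsFace C.pt T ∧ T ≠ Finset.univ := by
  simp [properFaces]

/-- Faces through a simple vertex are given by their edges there. -/
theorem Simple.card_faces_le {v : ι} (hv : C.Simple v) :
    (C.properFaces.filter fun T => v ∈ T).card ≤ 2 ^ C.rank := by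
  have h1 : (C.properFaces.filter fun T => v ∈ T).card ≤ (C.nbr v).powerset.card := by
    refine Finset.card_le_card_of_injOn (fun T => C.nbr v ∩ T) (fun T _ => by simp) ?_
    intro S hS T hT hST
    simp only [Finset.coe_filter, Set.mem_ofPred_eq, mem_properFaces] at hS hT
    exact C.face_ext hS.1.1 hT.1.1 hS.2 hT.2 hST
  refine h1.trans ?_
  rw [Finset.card_powerset]
  have : (C.nbr v).card + 1 = C.rank := hv
  exact Nat.pow_le_pow_right (by norm_num) (by omega)

open Classical in
theorem card_faces_simple_le :
    (C.properFaces.filter fun T => ∃ v ∈ T, C.Simple v).card ≤ Fintype.card ι * 2 ^ C.rank := by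
  have h1 : (C.properFaces.filter fun T => ∃ v ∈ T, C.Simple v) ⊆
      (Finset.univ.filter fun v => C.Simple v).biUnion fun v =>
        C.properFaces.filter fun T => v ∈ T := by
    intro T hT
    simp only [Finset.mem_filter, Finset.mem_biUnion, Finset.mem_univ, true_and] at hT ⊢
    obtain ⟨hT, v, hvT, hv⟩ := hT
    exact ⟨v, hv, hT, hvT⟩
  refine (Finset.card_le_card h1).trans ((Finset.card_biUnion_le_card_mul _ _ (2 ^ C.rank) ?_).trans
    (Nat.mul_le_mul_right _ (Finset.card_filter_le _ _)))
  intro v hv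
  exact Simple.card_faces_le (by simpa using hv)

theorem exists_facet_of_mem_properFaces {T : Finset ι} (hT : T ∈ C.properFaces) :
    ∃ F, C.IsFacet F ∧ F ∈ C.properFaces ∧ T ⊆ F := by
  rw [mem_properFaces] at hT
  obtain ⟨v, hv⟩ : ∃ v, v ∉ T := by
    by_contra! hcon
    exact hT.2 (Finset.eq_univ_iff_forall.2 hcon)
  obtain ⟨F, hF, hTF, -, hvF, hr⟩ := hT.1.exists_facet isFace_univ (Finset.subset_univ _)
    (Finset.mem_univ v) hv
  exact ⟨F, ⟨hF, hr⟩, mem_properFaces.2 ⟨hF, fun h => hvF (h ▸ Finset.mem_univ v)⟩, hTF⟩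

/-- The number of proper faces is linear in the number of vertices: those without a simple vertex
are subsets of the few nonsimple vertices of some facet. -/
theorem FewNonsimple.card_properFaces_le (hC : C.FewNonsimple) :
    C.properFaces.card ≤ Fintype.card ι * 2 ^ C.rank * (1 + 2 ^ C.rank) := by
  classical
  have h1 : C.properFaces ⊆ (C.properFaces.filter fun T => ∃ v ∈ T, C.Simple v) ∪
      (C.properFaces.filter fun T => ∃ v ∈ T, C.Simple v).biUnion fun F =>
        (C.nonsimple F).powerset.filter fun T => (C.nonsimple F).card ≤ C.rank := by
    intro T hT
    by_cases h : ∃ v ∈ T, C.Simple v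
    · exact Finset.mem_union_left _ (Finset.mem_filter.2 ⟨hT, h⟩)
    push Not at h
    obtain ⟨F, hF, hFp, hTF⟩ := exists_facet_of_mem_properFaces (C := C) hT
    refine Finset.mem_union_right _ (Finset.mem_biUnion.2 ⟨F, Finset.mem_filter.2
      ⟨hFp, hC.exists_simple hF⟩, Finset.mem_filter.2 ⟨Finset.mem_powerset.2 fun v hv =>
        mem_nonsimple.2 ⟨hTF hv, h v hv⟩, ?_⟩⟩)
    have := hC F hF
    have := hF.2
    omega
  refine (Finset.card_le_card h1).trans ((Finset.card_union_le _ _).trans ?_)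
  rw [mul_add, mul_one]
  refine Nat.add_le_add card_faces_simple_le ((Finset.card_biUnion_le_card_mul _ _ (2 ^ C.rank)
    ?_).trans (Nat.mul_le_mul_right _ card_faces_simple_le))
  intro F _
  by_cases h : (C.nonsimple F).card ≤ C.rank
  · refine (Finset.card_filter_le _ _).trans ?_
    rw [Finset.card_powerset]
    exact Nat.pow_le_pow_right (by norm_num) h
  · simp [h]

/-- The total size of the vertex sets of all proper faces is linear in the number of vertices. -/
theorem FewNonsimple.sum_card_properFaces_le (hC : C.FewNonsimple) :
    ∑ T ∈ C.properFaces, (T.card + 1) ≤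
      (2 ^ C.rank + (C.rank + 1) * (2 ^ C.rank * (1 + 2 ^ C.rank))) * Fintype.card ι := by
  classical
  have h1 : ∀ T ∈ C.properFaces, T.card + 1 ≤
      (∑ v, if v ∈ T ∧ C.Simple v then 1 else 0) + (C.rank + 1) := by
    intro T hT
    obtain ⟨F, hF, hFp, hTF⟩ := exists_facet_of_mem_properFaces (C := C) hT
    have h2 := Finset.card_filter_add_card_filter_not (s := T) (fun v => C.Simple v)
    have h3 : (T.filter fun v => ¬ C.Simple v).card ≤ (C.nonsimple F).card :=
      Finset.card_le_card fun v hv => by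
        rw [Finset.mem_filter] at hv
        exact mem_nonsimple.2 ⟨hTF hv.1, hv.2⟩
    have h4 : (∑ v, if v ∈ T ∧ C.Simple v then 1 else 0) = (T.filter fun v => C.Simple v).card := by
      rw [Finset.sum_boole, Nat.cast_id]
      congr 1
      ext v
      simp
    have := hC F hF
    have := hF.2
    omega
  refine (Finset.sum_le_sum h1).trans ?_
  rw [Finset.sum_add_distrib, Finset.sum_comm, Finset.sum_const, smul_eq_mul]
  have h5 : ∀ v ∈ (Finset.univ : Finset ι),
      (∑ T ∈ C.properFaces, if v ∈ T ∧ C.Simple v then 1 else 0) ≤ 2 ^ C.rank := by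
    intro v _
    by_cases hv : C.Simple v
    · simp only [hv, and_true]
      rw [Finset.sum_boole, Nat.cast_id]
      exact hv.card_faces_le
    · simp [hv]
  have h6 := Finset.sum_le_sum h5
  rw [Finset.sum_const, smul_eq_mul, Finset.card_univ] at h6
  have h7 := Nat.mul_le_mul_right (C.rank + 1) hC.card_properFaces_le
  calc _ ≤ Fintype.card ι * 2 ^ C.rank +
      Fintype.card ι * 2 ^ C.rank * (1 + 2 ^ C.rank) * (C.rank + 1) := Nat.add_le_add h6 h7
    _ = _ := by ring

end VertexConfig

end Counting

/-! ### Polytopes as vertex configurations -/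

section Geometry

variable {E : Type*} [NormedAddCommGroup E] [NormedSpace ℝ E] [FiniteDimensional ℝ E]
  {ι : Type*} [Fintype ι] [DecidableEq ι] {P : Set E} {d : ℕ}

/-- The labels of the vertices in `F`. -/
noncomputable def idx (label : ι ≃ P.extremePoints ℝ) (F : Set E) : Finset ι :=
  open Classical in Finset.univ.filter fun i => (label i : E) ∈ F

/-- The convex hull of the vertices with labels in `T`. -/
def hull (label : ι ≃ P.extremePoints ℝ) (T : Finset ι) : Set E :=
  convexHull ℝ ((fun i => (label i : E)) '' T)

/-- The vertices lifted to height one. -/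
def lift (label : ι ≃ P.extremePoints ℝ) (i : ι) : E × ℝ := ((label i : E), 1)

variable {label : ι ≃ P.extremePoints ℝ}

theorem mem_idx {F : Set E} {i : ι} : i ∈ idx label F ↔ (label i : E) ∈ F := by
  simp [idx]

theorem label_mem (i : ι) : (label i : E) ∈ P := (label i).2.1

theorem label_injective : Function.Injective fun i => (label i : E) :=
  Subtype.val_injective.comp label.injective

theorem IsDPolytope.finite_extremePoints (hP : IsDPolytope d P) : (P.extremePoints ℝ).Finite := by
  obtain ⟨-, ⟨s, hs, rfl⟩, -⟩ := hP
  exact hs.subset extremePoints_convexHull_subset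

theorem IsDPolytope.isCompact (hP : IsDPolytope d P) : IsCompact P := by
  obtain ⟨-, ⟨s, hs, rfl⟩, -⟩ := hP
  exact hs.isCompact_convexHull ℝ

theorem IsDPolytope.convex (hP : IsDPolytope d P) : Convex ℝ P := by
  obtain ⟨-, ⟨s, hs, rfl⟩, -⟩ := hP
  exact convex_convexHull ℝ s

/-- By the Krein–Milman theorem, a face is the convex hull of the vertices in it. -/
theorem hull_idx (hP : IsDPolytope d P) {F : Set E} (hF : IsExposed ℝ P F) :
    hull label (idx label F) = F := by
  have hc := hF.isCompact hP.isCompact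
  have hconv := hF.convex hP.convex
  refine subset_antisymm (convexHull_min ?_ hconv) ?_
  · rintro _ ⟨i, hi, rfl⟩
    exact mem_idx.1 hi
  · have h1 := closure_convexHull_extremePoints hc hconv
    have h2 : F.extremePoints ℝ ⊆ (fun i => (label i : E)) '' (idx label F) := by
      intro y hy
      have hyP := hF.isExtreme.extremePoints_subset_extremePoints hy
      exact ⟨label.symm ⟨y, hyP⟩, by simpa [mem_idx] using hy.1, by simp⟩
    have h3 : IsClosed (hull label (idx label F)) :=
      ((Finset.finite_toSet _).image _).isClosed_convexHull ℝ
    calc F = closure (convexHull ℝ (F.extremePoints ℝ)) := h1.symm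
      _ ⊆ closure (hull label (idx label F)) := closure_mono (convexHull_mono h2)
      _ = _ := h3.closure_eq

theorem isExposed_self : IsExposed ℝ P P := IsExposed.refl P

theorem hull_univ (hP : IsDPolytope d P) : hull label Finset.univ = P := by
  have h := hull_idx (label := label) hP isExposed_self
  rwa [show idx label P = Finset.univ from
    Finset.eq_univ_iff_forall.2 fun i => mem_idx.2 (label_mem i)] at h

theorem isFace_idx {F : Set E} (hF : IsExposed ℝ P F) :
    IsFace (lift label) (idx label F) := by
  rcases F.eq_empty_or_nonempty with rfl | hne
  · refine ⟨-LinearMap.snd ℝ E ℝ, fun i hi => ?_, fun i _ => by simp [lift]⟩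
    simp [mem_idx] at hi
  obtain ⟨l, hl⟩ := hF hne
  obtain ⟨y, hy⟩ := hne
  have hy' := hy
  rw [hl] at hy'
  refine ⟨l.toLinearMap ∘ₗ LinearMap.fst ℝ E ℝ - l y • LinearMap.snd ℝ E ℝ, fun i hi => ?_,
    fun i hi => ?_⟩
  · rw [mem_idx, hl] at hi
    have h1 := hi.2 y hy'.1
    have h2 := hy'.2 _ (label_mem (label := label) i)
    simp [lift, le_antisymm h2 h1]
  · rw [mem_idx] at hi
    have h2 := hy'.2 _ (label_mem (label := label) i)
    simp only [lift, LinearMap.sub_apply, LinearMap.comp_apply, LinearMap.fst_apply,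
      LinearMap.smul_apply, LinearMap.snd_apply, smul_eq_mul, mul_one]
    refine sub_neg.2 (lt_of_le_of_ne h2 fun h => hi ?_)
    rw [hl]
    refine ⟨label_mem i, fun z hz => ?_⟩
    exact (hy'.2 z hz).trans_eq h.symm

/-- A combinatorial face is the index set of a geometric face. -/
theorem exists_exposed (hP : IsDPolytope d P) {T : Finset ι} (hT : IsFace (lift label) T) :
    ∃ F, IsExposed ℝ P F ∧ idx label F = T := by
  rcases T.eq_empty_or_nonempty with rfl | ⟨k, hk⟩
  · exact ⟨∅, fun h => (Set.not_nonempty_empty h).elim, by ext; simp [mem_idx]⟩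
  obtain ⟨l, l0, l1⟩ := hT
  set f : E →L[ℝ] ℝ := (l ∘ₗ LinearMap.inl ℝ E ℝ).toContinuousLinearMap with hf
  have hfl : ∀ i, l (lift label i) = f (label i) + l (0, 1) := fun i => by
    rw [hf, LinearMap.coe_toContinuousLinearMap', LinearMap.comp_apply, ← map_add]
    simp [lift]
  have hle : ∀ z ∈ P, f z ≤ f (label k) := by
    have h1 : P ⊆ {z | f z ≤ f (label k)} := by
      refine (hull_univ (label := label) hP).symm.subset.trans (convexHull_min ?_ ?_)
      swap
      · exact convex_halfSpace_le f.toLinearMap.isLinear _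
      rintro _ ⟨i, -, rfl⟩
      have hk0 := l0 k hk
      have hi0 : l (lift label i) ≤ 0 := by
        by_cases h : i ∈ T
        · exact (l0 i h).le
        · exact (l1 i h).le
      rw [hfl] at hk0 hi0
      change f (label i) ≤ f (label k)
      linarith
    exact h1
  refine ⟨{y ∈ P | ∀ z ∈ P, f z ≤ f y}, fun _ => ⟨f, rfl⟩, ?_⟩
  ext i
  rw [mem_idx]
  have hk0 := l0 k hk
  rw [hfl] at hk0
  constructor
  · intro h
    by_contra hi
    have h1 := l1 i hi
    have h2 := h.2 _ (label_mem (label := label) k)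
    rw [hfl] at h1
    linarith
  · intro hi
    have h1 := l0 i hi
    rw [hfl] at h1
    exact ⟨label_mem i, fun z hz => (hle z hz).trans (by linarith)⟩

theorem isExposed_hull (hP : IsDPolytope d P) {T : Finset ι} (hT : IsFace (lift label) T) :
    IsExposed ℝ P (hull label T) ∧ idx label (hull label T) = T := by
  obtain ⟨F, hF, rfl⟩ := exists_exposed hP hT
  rw [hull_idx hP hF]
  exact ⟨hF, rfl⟩

theorem vectorSpan_convexHull (s : Set E) : vectorSpan ℝ (convexHull ℝ s) = vectorSpan ℝ s := by
  rw [← direction_affineSpan, affineSpan_convexHull, direction_affineSpan]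

/-- The rank of a set of lifted points is the dimension of their affine hull plus one. -/
theorem rk_lift {T : Finset ι} (hT : T.Nonempty) :
    rk (lift label) T = Module.finrank ℝ (vectorSpan ℝ (hull label T)) + 1 := by
  obtain ⟨k, hk⟩ := hT
  set p : E := (label k : E) with hp
  have hinl : Function.Injective (LinearMap.inl ℝ E ℝ) := LinearMap.inl_injective
  set D := vectorSpan ℝ (hull label T) with hD
  have hDe : D = vectorSpan ℝ ((fun i => (label i : E)) '' T) := vectorSpan_convexHull _
  have hspan : spn (lift label) T =
      D.map (LinearMap.inl ℝ E ℝ) ⊔ Submodule.span ℝ {((p, 1) : E × ℝ)} := by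
    apply le_antisymm
    · refine spn_le fun i hi => ?_
      have h1 : lift label i = LinearMap.inl ℝ E ℝ ((label i : E) - p) + (p, 1) := by
        simp [lift]
      rw [h1]
      refine Submodule.add_mem_sup (Submodule.mem_map_of_mem ?_)
        (Submodule.mem_span_singleton_self _)
      rw [hDe]
      exact vsub_mem_vectorSpan ℝ ⟨i, hi, rfl⟩ ⟨k, hk, rfl⟩
    · refine sup_le ?_ ?_
      · rw [hDe, vectorSpan_eq_span_vsub_set_right ℝ (p := p)
          (s := (fun i => (label i : E)) '' T) ⟨k, hk, rfl⟩, Submodule.map_span,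
          Submodule.span_le]
        rintro _ ⟨_, ⟨_, ⟨i, hi, rfl⟩, rfl⟩, rfl⟩
        have h1 : LinearMap.inl ℝ E ℝ ((label i : E) -ᵥ p) = lift label i - lift label k := by
          simp [lift, hp]
        change LinearMap.inl ℝ E ℝ ((label i : E) -ᵥ p) ∈ _
        rw [h1]
        exact Submodule.sub_mem _ (mem_spn hi) (mem_spn hk)
      · rw [Submodule.span_singleton_le_iff_mem]
        exact mem_spn (x := lift label) hk
  have hinf : D.map (LinearMap.inl ℝ E ℝ) ⊓ Submodule.span ℝ {((p, 1) : E × ℝ)} = ⊥ := by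
    rw [Submodule.eq_bot_iff]
    rintro y ⟨⟨z, -, rfl⟩, hy⟩
    obtain ⟨c, hc⟩ := Submodule.mem_span_singleton.1 hy
    have h1 := congrArg Prod.snd hc
    simp only [Prod.smul_snd, smul_eq_mul, mul_one, LinearMap.inl_apply] at h1
    rw [← hc, h1, zero_smul]
  have h := Submodule.finrank_sup_add_finrank_inf_eq (D.map (LinearMap.inl ℝ E ℝ))
    (Submodule.span ℝ {((p, 1) : E × ℝ)})
  rw [hinf, finrank_bot, add_zero, ← hspan,
    ← (Submodule.equivMapOfInjective _ hinl D).finrank_eq,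
    finrank_span_singleton (by simp)] at h
  exact h

/-- The vertex configuration of a polytope: its vertices, lifted to height one. -/
noncomputable def config (hP : IsDPolytope d P) (label : ι ≃ P.extremePoints ℝ) :
    VertexConfig ι (E × ℝ) where
  pt := lift label
  height := LinearMap.snd ℝ E ℝ
  height_pt _ := rfl
  isFace_singleton i := by
    -- a vertex is strictly separated from the convex hull of the other vertices
    set s : Set E := convexHull ℝ ((fun j => (label j : E)) '' ((Finset.univ.erase i : Finset ι) : Set ι))
    have hs : IsClosed s := ((Finset.finite_toSet _).image _).isClosed_convexHull ℝ
    have hi : (label i : E) ∉ s := by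
      intro h
      have h1 := (hP.convex.mem_extremePoints_iff_mem_sdiff_convexHull_sdiff).1 (label i).2
      refine h1.2 (convexHull_mono ?_ h)
      rintro _ ⟨j, hj, rfl⟩
      refine ⟨label_mem j, fun h => ?_⟩
      exact (Finset.mem_erase.1 hj).1 (label_injective (label := label) h)
    obtain ⟨f, u, hfi, hfs⟩ := geometric_hahn_banach_point_closed (convex_convexHull ℝ _) hs hi
    refine ⟨f (label i) • LinearMap.snd ℝ E ℝ - f.toLinearMap ∘ₗ LinearMap.fst ℝ E ℝ,
      fun j hj => ?_, fun j hj => ?_⟩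
    · rw [Finset.mem_singleton.1 hj]
      simp [lift]
    · have h2 := hfs (label j) (subset_convexHull ℝ _ ⟨j, by simpa using hj, rfl⟩)
      simp only [lift, LinearMap.sub_apply, LinearMap.comp_apply, LinearMap.fst_apply,
        LinearMap.smul_apply, LinearMap.snd_apply, smul_eq_mul, mul_one]
      change f (label i) - f (label j) < 0
      linarith

@[simp]
theorem config_pt (hP : IsDPolytope d P) : (config hP label).pt = lift label := rfl

theorem rk_idx (hP : IsDPolytope d P) {F : Set E} (hF : IsExposed ℝ P F) (hne : F.Nonempty) :
    rk (lift label) (idx label F) = Module.finrank ℝ (vectorSpan ℝ F) + 1 := by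
  have h1 := hull_idx (label := label) hP hF
  rw [rk_lift, h1]
  by_contra hcon
  rw [Finset.not_nonempty_iff_eq_empty] at hcon
  rw [hcon] at h1
  simp only [hull, Finset.coe_empty, Set.image_empty, convexHull_empty] at h1
  exact hne.ne_empty h1.symm

theorem rank_config (hP : IsDPolytope d P) : (config hP label).rank = d + 1 := by
  have h := rk_idx (label := label) hP isExposed_self hP.1
  rw [show idx label P = Finset.univ from
    Finset.eq_univ_iff_forall.2 fun i => mem_idx.2 (label_mem i), hP.2.2] at h
  exact h

theorem isKFace_iff (hP : IsDPolytope d P) {k : ℕ} {F : Set E} :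
    IsKFace P k F ↔ IsExposed ℝ P F ∧ rk (lift label) (idx label F) = k + 1 := by
  constructor
  · rintro ⟨h1, h2, h3⟩
    exact ⟨h1, by rw [rk_idx hP h1 h2, h3]⟩
  · rintro ⟨h1, h2⟩
    have hne : F.Nonempty := by
      by_contra hcon
      rw [Set.not_nonempty_iff_eq_empty] at hcon
      have : idx label F = ∅ := by
        ext
        simp [mem_idx, hcon]
      rw [this, rk_empty] at h2
      omega
    rw [rk_idx hP h1 hne] at h2
    exact ⟨h1, hne, by omega⟩

theorem exists_isKFace_iff (hP : IsDPolytope d P) {k : ℕ} {S : Finset ι} :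
    (∃ F : Set E, IsKFace P k F ∧ ∀ i, i ∈ S ↔ (label i : E) ∈ F) ↔
      IsFace (lift label) S ∧ rk (lift label) S = k + 1 := by
  constructor
  · rintro ⟨F, hF, hS⟩
    obtain rfl : S = idx label F := by
      ext i
      rw [hS, mem_idx]
    rw [isKFace_iff (label := label) hP] at hF
    exact ⟨isFace_idx hF.1, hF.2⟩
  · rintro ⟨hS, hr⟩
    obtain ⟨h1, h2⟩ := isExposed_hull hP hS
    refine ⟨hull label S, (isKFace_iff (label := label) hP).2 ⟨h1, by rw [h2, hr]⟩, fun i => ?_⟩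
    rw [← mem_idx, h2]

theorem ncard_edges (hP : IsDPolytope d P) (i : ι) :
    {e : Set E | IsKFace P 1 e ∧ (label i : E) ∈ e}.ncard = ((config hP label).nbr i).card := by
  set C := config hP label with hC
  have h1 : {e : Set E | IsKFace P 1 e ∧ (label i : E) ∈ e} =
      (fun j => hull label {i, j}) '' (C.nbr i) := by
    ext e
    constructor
    · rintro ⟨he, hie⟩
      rw [isKFace_iff (label := label) hP] at he
      have hmem := mem_idx.2 hie
      obtain ⟨j, hj, hji⟩ : ∃ j ∈ idx label e, j ≠ i := by
        by_contra! hcon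
        have h2 := rk_mono (x := C.pt) (show idx label e ⊆ {i} from fun j hj =>
          Finset.mem_singleton.2 (hcon j hj))
        rw [C.rk_singleton] at h2
        have h3 : rk C.pt (idx label e) = 2 := he.2
        omega
      have h4 := C.eq_pair_of_rk_eq_two he.2 hmem hj hji.symm
      refine ⟨j, C.mem_nbr.2 ⟨hji, h4 ▸ isFace_idx he.1⟩, ?_⟩
      change hull label {i, j} = e
      rw [← h4, hull_idx hP he.1]
    · rintro ⟨j, hj, rfl⟩
      have hj' := C.mem_nbr.1 hj
      obtain ⟨h2, h3⟩ := isExposed_hull hP hj'.2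
      refine ⟨(isKFace_iff (label := label) hP).2 ⟨h2, ?_⟩, ?_⟩
      · rw [h3]
        exact C.rk_pair hj'.1
      · rw [← mem_idx, h3]
        simp
  rw [h1, Set.InjOn.ncard_image, Set.ncard_coe_finset]
  intro j hj k hk hjk
  have hj' := C.mem_nbr.1 hj
  have hk' := C.mem_nbr.1 hk
  have h2 := (isExposed_hull hP hj'.2).2
  have hjk' : hull label {i, j} = hull label {i, k} := hjk
  rw [hjk', (isExposed_hull hP hk'.2).2] at h2
  have : j ∈ ({i, k} : Finset ι) := by
    rw [h2]
    simp
  simpa [hj'.1] using this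

theorem isNonsimpleVertex_iff (hP : IsDPolytope d P) (i : ι) :
    IsNonsimpleVertex d P (label i : E) ↔ ¬ (config hP label).Simple i := by
  have h1 := (config hP label).rank_le_card_nbr i
  rw [IsNonsimpleVertex, ncard_edges (label := label) hP, VertexConfig.Simple]
  rw [rank_config] at h1 ⊢
  exact ⟨fun h => by omega, fun h => ⟨(label i).2, by omega⟩⟩

theorem fewNonsimple_config (hP : IsDPolytope d P) (hd : 3 ≤ d)
    (h : FacetNonsimpleAtMost d (d - 2) P) : (config hP label).FewNonsimple := by
  intro F hF
  set C := config hP label with hC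
  have hr : rk C.pt F = d := by
    have h1 := hF.2
    rw [rank_config] at h1
    omega
  obtain ⟨h1, h2⟩ := isExposed_hull hP hF.1
  have h3 := h (hull label F) ((isKFace_iff (label := label) hP).2 ⟨h1, by
    rw [h2]
    exact hr.trans (by omega)⟩)
  have h4 : {v : E | IsNonsimpleVertex d P v ∧ v ∈ hull label F} =
      (fun i => (label i : E)) '' (C.nonsimple F) := by
    ext v
    constructor
    · rintro ⟨hv, hvF⟩
      obtain ⟨i, hi⟩ := label.surjective ⟨v, hv.1⟩
      have hi' : (label i : E) = v := by rw [hi]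
      subst hi'
      refine ⟨i, ?_, rfl⟩
      rw [Finset.mem_coe, VertexConfig.mem_nonsimple, ← h2, mem_idx]
      exact ⟨hvF, (isNonsimpleVertex_iff hP i).1 hv⟩
    · rintro ⟨i, hi, rfl⟩
      rw [Finset.mem_coe, VertexConfig.mem_nonsimple, ← h2, mem_idx] at hi
      exact ⟨(isNonsimpleVertex_iff hP i).2 hi.2, hi.1⟩
  rw [h4, Set.ncard_image_of_injective _ label_injective, Set.ncard_coe_finset] at h3
  rw [hr]
  omega

/-- The face lattice of a polytope and that of its vertex configuration. -/
noncomputable def faceIso (hP : IsDPolytope d P) (label : ι ≃ P.extremePoints ℝ) :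
    Face P ≃o {T : Finset ι // IsFace (lift label) T} where
  toFun F := ⟨idx label F.1, isFace_idx F.2⟩
  invFun T := ⟨hull label T.1, (isExposed_hull hP T.2).1⟩
  left_inv F := Subtype.ext (hull_idx hP F.2)
  right_inv T := Subtype.ext (isExposed_hull hP T.2).2
  map_rel_iff' {F G} := by
    refine ⟨fun h => ?_, fun h i hi => mem_idx.2 (h (mem_idx.1 hi))⟩
    have h' : idx label F.1 ⊆ idx label G.1 := h
    change F.1 ⊆ G.1
    rw [← hull_idx (label := label) hP F.2, ← hull_idx (label := label) hP G.2]
    exact convexHull_mono (Set.image_mono (by exact_mod_cast h'))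

theorem rk_idx_le_iff (hP : IsDPolytope d P) {k : ℕ} {F : Set E} (hF : IsExposed ℝ P F) :
    rk (lift label) (idx label F) ≤ k + 1 ↔ Module.finrank ℝ (vectorSpan ℝ F) ≤ k := by
  rcases F.eq_empty_or_nonempty with rfl | hne
  · have : idx label (∅ : Set E) = ∅ := by
      ext
      simp [mem_idx]
    rw [this, rk_empty, vectorSpan_empty, finrank_bot]
    simp
  · rw [rk_idx hP hF hne]
    omega

/-- The `k`-skeleton of a polytope and that of its vertex configuration. -/
noncomputable def skeletonIso (hP : IsDPolytope d P) (label : ι ≃ P.extremePoints ℝ) (k : ℕ) :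
    Skeleton k P ≃o {T : Finset ι // IsFace (lift label) T ∧ rk (lift label) T ≤ k + 1} where
  toFun F := ⟨idx label F.1.1, isFace_idx F.1.2, (rk_idx_le_iff hP F.1.2).2 F.2⟩
  invFun T := ⟨⟨hull label T.1, (isExposed_hull hP T.2.1).1⟩, by
    have h := (rk_idx_le_iff (label := label) hP (k := k) (isExposed_hull hP T.2.1).1).1 (by
      rw [(isExposed_hull hP T.2.1).2]
      exact T.2.2)
    exact h⟩
  left_inv F := Subtype.ext (Subtype.ext (hull_idx hP F.1.2))
  right_inv T := Subtype.ext (isExposed_hull hP T.2.1).2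
  map_rel_iff' {F G} := (faceIso hP label).map_rel_iff' (a := F.1) (b := G.1)

end Geometry

/-! ### Reconstruction from the 2-skeleton -/

section Reconstruction

namespace VertexConfig

variable {ι κ V W : Type*} [Fintype ι] [DecidableEq ι] [Fintype κ] [DecidableEq κ]
  [AddCommGroup V] [Module ℝ V] [FiniteDimensional ℝ V] [AddCommGroup W] [Module ℝ W]
  [FiniteDimensional ℝ W]

/-- The faces of rank at most three. -/
abbrev LowFace (C : VertexConfig ι W) : Type _ :=
  {T : Finset ι // IsFace C.pt T ∧ rk C.pt T ≤ 2 + 1}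

theorem three_le_rk {C : VertexConfig ι W} {T : Finset ι} (h : 3 ≤ T.card) :
    3 ≤ rk C.pt T := by
  obtain ⟨i, hi, j, hj, hij⟩ := Finset.one_lt_card.1 (show 1 < T.card by omega)
  have h1 := rk_mono (x := C.pt) (show {i, j} ⊆ T from
    Finset.insert_subset hi (Finset.singleton_subset_iff.2 hj))
  rw [C.rk_pair hij.symm] at h1
  by_contra hcon
  have h2 := C.eq_pair_of_rk_eq_two (by omega) hi hj hij
  rw [h2, Finset.card_pair hij] at h
  omega

theorem rk_eq_two_iff {C : VertexConfig ι W} {T : Finset ι} :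
    rk C.pt T = 2 ↔ T.card = 2 := by
  constructor
  · intro h
    have h1 := rk_le_card (x := C.pt) T
    by_contra hcon
    have := three_le_rk (C := C) (T := T) (by omega)
    omega
  · intro h
    obtain ⟨i, j, hij, rfl⟩ := Finset.card_eq_two.1 h
    exact C.rk_pair hij.symm

theorem SameSkeleton.of_iff {A : VertexConfig ι V} {B : VertexConfig ι W} (hr : A.rank = B.rank)
    (h : ∀ T, (IsFace A.pt T ∧ rk A.pt T ≤ 2 + 1) ↔ (IsFace B.pt T ∧ rk B.pt T ≤ 2 + 1)) :
    SameSkeleton A B where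
  rank_eq := hr
  edge T hr hT := ⟨((h T).1 ⟨hT, by omega⟩).1, rk_eq_two_iff.2 (rk_eq_two_iff.1 hr)⟩
  edge' T hr hT := ⟨((h T).2 ⟨hT, by omega⟩).1, rk_eq_two_iff.2 (rk_eq_two_iff.1 hr)⟩
  polygon T hr hT := by
    obtain ⟨h1, h2⟩ := (h T).1 ⟨hT, by omega⟩
    have := three_le_rk (C := B) (hr ▸ rk_le_card (x := A.pt) T)
    exact ⟨h1, by omega⟩
  polygon' T hr hT := by
    obtain ⟨h1, h2⟩ := (h T).2 ⟨hT, by omega⟩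
    have := three_le_rk (C := A) (hr ▸ rk_le_card (x := B.pt) T)
    exact ⟨h1, by omega⟩

/-- A vertex as a face. -/
def vertexFace (C : VertexConfig ι W) (i : ι) : C.LowFace :=
  ⟨{i}, C.isFace_singleton i, by rw [C.rk_singleton]; norm_num⟩

/-- The empty face. -/
def emptyFace (C : VertexConfig ι W) : C.LowFace :=
  ⟨∅, C.isFace_empty, by rw [rk_empty]; norm_num⟩

theorem vertexFace_le {C : VertexConfig ι W} {i : ι} {T : C.LowFace} :
    C.vertexFace i ≤ T ↔ i ∈ T.1 :=
  Finset.singleton_subset_iff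

theorem vertexFace_injective (C : VertexConfig ι W) : Function.Injective C.vertexFace :=
  fun _ _ h => Finset.singleton_injective (congrArg Subtype.val h)

theorem not_vertexFace_le_emptyFace (C : VertexConfig ι W) (i : ι) :
    ¬ C.vertexFace i ≤ C.emptyFace := by
  rw [vertexFace_le]
  exact Finset.notMem_empty i

variable {A : VertexConfig ι V} {B : VertexConfig κ W}

/-- An isomorphism of skeleta maps vertices to vertices, as these are the atoms. -/
theorem exists_apply_vertexFace (ψ : A.LowFace ≃o B.LowFace) (i : ι) :
    ∃ j, ψ (A.vertexFace i) = B.vertexFace j := by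
  have hne : (ψ (A.vertexFace i)).1.Nonempty := by
    rw [Finset.nonempty_iff_ne_empty]
    intro h
    have h1 : ψ (A.vertexFace i) ≤ ψ A.emptyFace := by
      change (ψ (A.vertexFace i)).1 ⊆ _
      rw [h]
      exact Finset.empty_subset _
    exact A.not_vertexFace_le_emptyFace i (ψ.le_iff_le.1 h1)
  obtain ⟨j, hj⟩ := hne
  refine ⟨j, ?_⟩
  have h1 : ψ.symm (B.vertexFace j) ≤ A.vertexFace i := by
    rw [OrderIso.symm_apply_le]
    exact vertexFace_le.2 hj
  have h2 : (ψ.symm (B.vertexFace j)).1 = {i} := by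
    refine (Finset.subset_singleton_iff.1 h1).resolve_left fun h => ?_
    have h3 : ψ.symm (B.vertexFace j) ≤ ψ.symm B.emptyFace := by
      change (ψ.symm (B.vertexFace j)).1 ⊆ _
      rw [h]
      exact Finset.empty_subset _
    exact B.not_vertexFace_le_emptyFace j (ψ.symm.le_iff_le.1 h3)
  have h3 : ψ.symm (B.vertexFace j) = A.vertexFace i := Subtype.ext h2
  rw [← h3, OrderIso.apply_symm_apply]

/-- An isomorphism of skeleta is induced by a bijection of the vertices. -/
theorem exists_vertexEquiv (ψ : A.LowFace ≃o B.LowFace) :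
    ∃ β : ι ≃ κ, ∀ T, (ψ T).1 = T.1.map β.toEmbedding := by
  choose f hf using exists_apply_vertexFace ψ
  choose g hg using exists_apply_vertexFace ψ.symm
  refine ⟨⟨f, g, fun i => A.vertexFace_injective ?_, fun j => B.vertexFace_injective ?_⟩, fun T => ?_⟩
  · rw [← hg, ← hf, OrderIso.symm_apply_apply]
  · rw [← hf, ← hg, OrderIso.apply_symm_apply]
  · ext j
    have h1 : j = f (g j) := B.vertexFace_injective (by
      rw [← hf, ← hg, OrderIso.apply_symm_apply])
    rw [Finset.mem_map_equiv]
    change _ ↔ g j ∈ T.1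
    rw [← vertexFace_le, ← vertexFace_le, ← hg, OrderIso.symm_apply_le]

end VertexConfig

section Relabel

variable {ι κ W : Type*} [Fintype ι] [DecidableEq ι] [Fintype κ] [DecidableEq κ]
  [AddCommGroup W] [Module ℝ W] [FiniteDimensional ℝ W]

theorem isFace_comp {x : κ → W} (β : ι ≃ κ) {T : Finset ι} :
    IsFace (x ∘ β) T ↔ IsFace x (T.map β.toEmbedding) := by
  constructor
  · rintro ⟨l, l0, l1⟩
    refine ⟨l, fun j hj => ?_, fun j hj => ?_⟩
    · simpa using l0 (β.symm j) (by simpa [Finset.mem_map_equiv] using hj)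
    · simpa using l1 (β.symm j) (by simpa [Finset.mem_map_equiv] using hj)
  · rintro ⟨l, l0, l1⟩
    exact ⟨l, fun i hi => l0 (β i) (by simpa using hi), fun i hi => l1 (β i) (by simpa using hi)⟩

theorem rk_comp {x : κ → W} (β : ι ≃ κ) (T : Finset ι) :
    rk (x ∘ β) T = rk x (T.map β.toEmbedding) := by
  rw [rk, rk, spn, spn, Finset.coe_map, Set.image_comp]
  rfl

/-- A vertex configuration with relabelled vertices. -/
def VertexConfig.relabel (C : VertexConfig κ W) (β : ι ≃ κ) : VertexConfig ι W where
  pt := C.pt ∘ β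
  height := C.height
  height_pt i := C.height_pt (β i)
  isFace_singleton i := by
    rw [isFace_comp, Finset.map_singleton]
    exact C.isFace_singleton (β i)

end Relabel

/-- The skeleta of `P` and `Q` are transferred to vertex configurations and the isomorphism to a
bijection of the vertices; relabelling along it gives two configurations with the same skeleton, hence
with the same faces. -/
theorem reconstructible {E : Type*} [NormedAddCommGroup E] [NormedSpace ℝ E]
    [FiniteDimensional ℝ E] {P : Set E} {d : ℕ} (hd : 3 ≤ d) (hP : IsDPolytope d P)
    (h : FacetNonsimpleAtMost d (d - 2) P) : ReconstructibleFromSkeleton d 2 P := by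
  intro N Q hQ φ
  have := hP.finite_extremePoints.to_subtype
  have := hQ.finite_extremePoints.to_subtype
  set label := (Finite.equivFin (P.extremePoints ℝ)).symm
  set label' := (Finite.equivFin (Q.extremePoints ℝ)).symm
  set A := config hP label with hA
  set B := config hQ label' with hB
  obtain ⟨β, hβ⟩ := VertexConfig.exists_vertexEquiv (A := A) (B := B)
    ((skeletonIso hP label 2).symm.trans (φ.trans (skeletonIso hQ label' 2)))
  set ψ : A.LowFace ≃o B.LowFace :=
    (skeletonIso hP label 2).symm.trans (φ.trans (skeletonIso hQ label' 2)) with hψ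
  have hsame : VertexConfig.SameSkeleton A (B.relabel β) := by
    refine .of_iff ?_ fun T => ?_
    · rw [rank_config]
      change _ = rk (B.pt ∘ β) Finset.univ
      rw [rk_comp, Finset.map_univ_equiv]
      exact (rank_config hQ).symm
    · change _ ↔ IsFace (B.pt ∘ β) T ∧ rk (B.pt ∘ β) T ≤ 2 + 1
      rw [isFace_comp, rk_comp]
      constructor
      · intro hT
        have h1 := (ψ ⟨T, hT⟩).2
        rwa [hβ] at h1
      · intro hT
        have h1 := hβ (ψ.symm ⟨_, hT⟩)
        rw [OrderIso.apply_symm_apply] at h1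
        have h2 : T = (ψ.symm ⟨_, hT⟩).1 := Finset.map_injective _ h1
        rw [h2]
        exact (ψ.symm ⟨_, hT⟩).2
  have hface : ∀ T, IsFace (lift label) T ↔ IsFace (lift label') (β.finsetCongr T) := fun T =>
    (hsame.isFace_iff (T := T) (fewNonsimple_config hP hd h)).trans
      (isFace_comp (x := lift label') (T := T) β)
  refine ⟨((faceIso hP label).trans ⟨β.finsetCongr.subtypeEquiv hface, ?_⟩).trans
    (faceIso hQ label').symm, fun F => ?_⟩
  · intro S T
    exact Finset.map_subset_map
  · have h1 := hβ (skeletonIso hP label 2 F)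
    have h2 : ψ (skeletonIso hP label 2 F) = skeletonIso hQ label' 2 (φ F) :=
      congrArg (fun G => skeletonIso hQ label' 2 (φ G)) ((skeletonIso hP label 2).symm_apply_apply F)
    rw [h2] at h1
    refine ((OrderIso.symm_apply_eq (faceIso hQ label')).2 ?_ :
      (faceIso hQ label').symm _ = (φ F).1)
    exact Subtype.ext h1.symm

end Reconstruction

/-! ### Program logic with running times -/

section Logic

/-- Started in `σ`, the program `p` halts, and the number of steps and the final memory satisfy
`Q`. -/
def WP (p : Prog) (Q : ℕ → Mem → Prop) (σ : Mem) : Prop :=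
  ∃ t τ, Exec p σ t τ ∧ Q t τ

variable {p q : Prog} {Q R : ℕ → Mem → Prop} {σ : Mem} {x y a c : ℕ} {b : Test}

theorem WP.mono (h : WP p Q σ) (hQ : ∀ t τ, Q t τ → R t τ) : WP p R σ := by
  obtain ⟨t, τ, h1, h2⟩ := h
  exact ⟨t, τ, h1, hQ t τ h2⟩

theorem wp_skip : WP .skip Q σ ↔ Q 1 σ :=
  ⟨fun ⟨_, _, h, hQ⟩ => by cases h; exact hQ, fun h => ⟨_, _, .skip σ, h⟩⟩

theorem wp_const : WP (.const x c) Q σ ↔ Q 1 (σ.setReg x c) :=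
  ⟨fun ⟨_, _, h, hQ⟩ => by cases h; exact hQ, fun h => ⟨_, _, .const σ x c, h⟩⟩

theorem wp_copy : WP (.copy x y) Q σ ↔ Q 1 (σ.setReg x (σ.reg y)) :=
  ⟨fun ⟨_, _, h, hQ⟩ => by cases h; exact hQ, fun h => ⟨_, _, .copy σ x y, h⟩⟩

theorem wp_succ : WP (.succ x y) Q σ ↔ Q 1 (σ.setReg x (σ.reg y + 1)) :=
  ⟨fun ⟨_, _, h, hQ⟩ => by cases h; exact hQ, fun h => ⟨_, _, .succ σ x y, h⟩⟩

theorem wp_load : WP (.load x a y) Q σ ↔ Q 1 (σ.setReg x (σ.arr a (σ.reg y))) :=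
  ⟨fun ⟨_, _, h, hQ⟩ => by cases h; exact hQ, fun h => ⟨_, _, .load σ x a y, h⟩⟩

theorem wp_store : WP (.store a x y) Q σ ↔ Q 1 (σ.setArr a (σ.reg x) (σ.reg y)) :=
  ⟨fun ⟨_, _, h, hQ⟩ => by cases h; exact hQ, fun h => ⟨_, _, .store σ a x y, h⟩⟩

theorem wp_seq : WP (.seq p q) Q σ ↔
    WP p (fun s τ => WP q (fun t ρ => Q (s + t) ρ) τ) σ := by
  constructor
  · rintro ⟨_, _, h, hQ⟩
    cases h with
    | seq h1 h2 => exact ⟨_, _, h1, _, _, h2, hQ⟩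
  · rintro ⟨_, _, h1, _, _, h2, hQ⟩
    exact ⟨_, _, .seq h1 h2, hQ⟩

theorem wp_ite : WP (.ite b p q) Q σ ↔
    (b.Holds σ → WP p (fun t τ => Q (t + 1) τ) σ) ∧
      (¬ b.Holds σ → WP q (fun t τ => Q (t + 1) τ) σ) := by
  constructor
  · rintro ⟨_, _, h, hQ⟩
    cases h with
    | ite_true hb h => exact ⟨fun _ => ⟨_, _, h, hQ⟩, fun h' => (h' hb).elim⟩
    | ite_false hb h => exact ⟨fun h' => (hb h').elim, fun _ => ⟨_, _, h, hQ⟩⟩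
  · rintro ⟨h1, h2⟩
    by_cases hb : b.Holds σ
    · obtain ⟨_, _, h, hQ⟩ := h1 hb
      exact ⟨_, _, .ite_true hb h, hQ⟩
    · obtain ⟨_, _, h, hQ⟩ := h2 hb
      exact ⟨_, _, .ite_false hb h, hQ⟩

/-- Loops: `I g` is an invariant that depends on a ghost state `g`, and the potential `Φ g` pays for
the steps. -/
theorem wp_loop {G : Type*} (I : G → Mem → Prop) (Φ : G → ℕ)
    (hstep : ∀ g σ, I g σ → b.Holds σ →
      WP p (fun t τ => ∃ g', I g' τ ∧ Φ g' + t + 1 ≤ Φ g) σ) {g : G} (h : I g σ) :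
    WP (.loop b p) (fun t τ => ∃ g', I g' τ ∧ ¬ b.Holds τ ∧ Φ g' + t ≤ Φ g + 1) σ := by
  induction hn : Φ g using Nat.strong_induction_on generalizing g σ with
  | _ n ih =>
    subst hn
    by_cases hb : b.Holds σ
    · obtain ⟨s, τ, h1, g', hI, hle⟩ := hstep g σ h hb
      obtain ⟨t, ρ, h2, g'', hI', hb', hle'⟩ := ih (Φ g') (by omega) hI rfl
      exact ⟨_, _, .loop_step hb h1 h2, g'', hI', hb', by omega⟩
    · exact ⟨_, _, (Exec.loop_stop hb), g, h, hb, le_rfl⟩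

/-! ### Memory access -/

@[simp]
theorem setReg_reg (σ : Mem) (x v y : ℕ) :
    (σ.setReg x v).reg y = if y = x then v else σ.reg y := by
  simp [Mem.setReg, Function.update_apply]

@[simp]
theorem setReg_arr (σ : Mem) (x v : ℕ) : (σ.setReg x v).arr = σ.arr := rfl

@[simp]
theorem setArr_reg (σ : Mem) (a i v : ℕ) : (σ.setArr a i v).reg = σ.reg := rfl

@[simp]
theorem setArr_arr (σ : Mem) (a i v b : ℕ) :
    (σ.setArr a i v).arr b = if b = a then Function.update (σ.arr a) i v else σ.arr b := by
  simp only [Mem.setArr, Function.update_apply]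

/-- The registers that a program may write. -/
def Prog.regs : Prog → List ℕ
  | .skip => []
  | .const x _ => [x]
  | .copy x _ => [x]
  | .succ x _ => [x]
  | .pred x _ => [x]
  | .load x _ _ => [x]
  | .store _ _ _ => []
  | .seq p q => p.regs ++ q.regs
  | .ite _ p q => p.regs ++ q.regs
  | .loop _ p => p.regs

/-- The arrays that a program may write. -/
def Prog.arrs : Prog → List ℕ
  | .skip => []
  | .const _ _ => []
  | .copy _ _ => []
  | .succ _ _ => []
  | .pred _ _ => []
  | .load _ _ _ => []
  | .store a _ _ => [a]
  | .seq p q => p.arrs ++ q.arrs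
  | .ite _ p q => p.arrs ++ q.arrs
  | .loop _ p => p.arrs

theorem Exec.frame {t : ℕ} {τ : Mem} (h : Exec p σ t τ) :
    (∀ x, x ∉ p.regs → τ.reg x = σ.reg x) ∧ ∀ a, a ∉ p.arrs → τ.arr a = σ.arr a := by
  induction h with
  | skip => exact ⟨fun _ _ => rfl, fun _ _ => rfl⟩
  | const σ x c | copy σ x c | succ σ x c | pred σ x c | load σ x a y =>
    refine ⟨fun y hy => ?_, fun _ _ => rfl⟩
    simp only [Prog.regs, List.mem_singleton] at hy
    simp [hy]
  | store σ a x y =>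
    refine ⟨fun _ _ => rfl, fun b hb => ?_⟩
    simp only [Prog.arrs, List.mem_singleton] at hb
    simp [hb]
  | seq _ _ ih1 ih2 =>
    simp only [Prog.regs, Prog.arrs, List.mem_append, not_or]
    exact ⟨fun x hx => (ih2.1 x hx.2).trans (ih1.1 x hx.1),
      fun x hx => (ih2.2 x hx.2).trans (ih1.2 x hx.1)⟩
  | ite_true _ _ ih =>
    simp only [Prog.regs, Prog.arrs, List.mem_append, not_or]
    exact ⟨fun x hx => ih.1 x hx.1, fun x hx => ih.2 x hx.1⟩
  | ite_false _ _ ih =>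
    simp only [Prog.regs, Prog.arrs, List.mem_append, not_or]
    exact ⟨fun x hx => ih.1 x hx.2, fun x hx => ih.2 x hx.2⟩
  | loop_stop => exact ⟨fun _ _ => rfl, fun _ _ => rfl⟩
  | loop_step _ _ _ ih1 ih2 =>
    exact ⟨fun x hx => (ih2.1 x hx).trans (ih1.1 x hx), fun x hx => (ih2.2 x hx).trans (ih1.2 x hx)⟩

/-- The registers and arrays that a program does not mention as targets keep their contents. -/
theorem WP.frame (h : WP p Q σ) : WP p (fun t τ => Q t τ ∧
    (∀ x, x ∉ p.regs → τ.reg x = σ.reg x) ∧ ∀ a, a ∉ p.arrs → τ.arr a = σ.arr a) σ := by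
  obtain ⟨t, τ, h1, h2⟩ := h
  exact ⟨t, τ, h1, h2, h1.frame⟩

/-- From position `j` on, the array `f` starts with the word `l`. -/
def Holds (f : ℕ → ℕ) (j : ℕ) (l : List ℕ) : Prop :=
  ∀ i (hi : i < l.length), f (j + i) = l[i]

theorem holds_nil (f : ℕ → ℕ) (j : ℕ) : Holds f j [] := fun i hi => by simp at hi

theorem holds_cons {f : ℕ → ℕ} {j v : ℕ} {l : List ℕ} :
    Holds f j (v :: l) ↔ f j = v ∧ Holds f (j + 1) l := by
  constructor
  · intro h
    refine ⟨h 0 (Nat.succ_pos _), fun i hi => ?_⟩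
    have := h (i + 1) (by simpa using hi)
    rw [show j + 1 + i = j + (i + 1) by ring]
    simpa using this
  · rintro ⟨h1, h2⟩ i hi
    cases i with
    | zero => simpa using h1
    | succ i =>
      have := h2 i (by simpa using hi)
      rw [show j + (i + 1) = j + 1 + i by ring]
      simpa using this

theorem holds_append {f : ℕ → ℕ} {j : ℕ} {l m : List ℕ} :
    Holds f j (l ++ m) ↔ Holds f j l ∧ Holds f (j + l.length) m := by
  induction l generalizing j with
  | nil => simp [holds_nil]
  | cons v l ih =>
    rw [List.cons_append, holds_cons, holds_cons, ih, List.length_cons, and_assoc,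
      show j + 1 + l.length = j + (l.length + 1) by ring]

theorem Holds.congr {f g : ℕ → ℕ} {j : ℕ} {l : List ℕ} (h : Holds f j l)
    (hfg : ∀ i, j ≤ i → i < j + l.length → g i = f i) : Holds g j l := fun i hi => by
  rw [hfg (j + i) (by omega) (by omega)]
  exact h i hi

/-- Following `nxt` from `i` until `0` yields the list `l`. -/
def Chain (nxt : ℕ → ℕ) : ℕ → List ℕ → Prop
  | i, [] => i = 0
  | i, v :: l => i = v ∧ v ≠ 0 ∧ Chain nxt (nxt v) l

theorem Chain.congr {f g : ℕ → ℕ} {i : ℕ} {l : List ℕ} (h : Chain f i l)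
    (hfg : ∀ v ∈ l, g v = f v) : Chain g i l := by
  induction l generalizing i with
  | nil => exact h
  | cons v l ih =>
    obtain ⟨h1, h2, h3⟩ := h
    refine ⟨h1, h2, ?_⟩
    rw [hfg v (by simp)]
    exact ih h3 fun w hw => hfg w (by simp [hw])

/-- Traversal of a linked list: register `i` runs through the list stored in array `a`; register `0`
holds `0`. -/
def forList (i a : ℕ) (p : Prog) : Prog :=
  .loop (.ne i 0) (.seq p (.load i a i))

theorem wp_forList {i a : ℕ} (hi : i ≠ 0) (l : List ℕ) (I : List ℕ → Mem → Prop) (c : ℕ → ℕ)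
    (hI : ∀ L σ v, I L σ → I L (σ.setReg i v))
    (hbody : ∀ L v M σ, l = L ++ v :: M → I L σ → σ.reg i = v →
      WP p (fun t τ => t ≤ c v ∧ I (L ++ [v]) τ) σ)
    (hir : i ∉ p.regs) (h0r : 0 ∉ p.regs) (har : a ∉ p.arrs)
    (hc : Chain (σ.arr a) (σ.reg i) l) (h0 : σ.reg 0 = 0) (h : I [] σ) :
    WP (forList i a p) (fun t τ => t ≤ (l.map fun v => c v + 2).sum + 1 ∧ I l τ) σ := by
  have := wp_loop (b := .ne i 0) (p := .seq p (.load i a i)) (G := List ℕ × List ℕ) (σ := σ)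
    (fun g σ => l = g.1 ++ g.2 ∧ I g.1 σ ∧ Chain (σ.arr a) (σ.reg i) g.2 ∧ σ.reg 0 = 0)
    (fun g => (g.2.map fun v => c v + 2).sum) ?_ (g := ([], l)) ⟨rfl, h, hc, h0⟩
  · refine this.mono fun t τ => ?_
    rintro ⟨⟨L, M⟩, ⟨h1, h2, h3, h4⟩, h5, h6⟩
    simp only [Test.Holds, ne_eq, not_not, h4] at h5
    cases M with
    | nil =>
      simp only [List.append_nil] at h1
      subst h1
      exact ⟨by simpa using h6, h2⟩
    | cons v M => exact absurd (h3.1.symm.trans h5) h3.2.1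
  · rintro ⟨L, M⟩ σ ⟨h1, h2, h3, h4⟩ hb
    simp only [Test.Holds, h4] at hb
    cases M with
    | nil => exact absurd h3 hb
    | cons v M =>
      rw [wp_seq]
      refine (hbody L v M σ h1 h2 h3.1).frame.mono fun t τ => ?_
      rintro ⟨⟨ht, hI'⟩, hr, ha⟩
      rw [wp_load]
      refine ⟨(L ++ [v], M), ⟨by simp [h1], hI _ _ _ hI', ?_, ?_⟩, ?_⟩
      · simp only [setReg_arr, setReg_reg, if_pos, ha a har, hr i hir, h3.1]
        exact h3.2.2
      · simp [hi.symm, hr 0 h0r, h4]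
      · simp only [List.map_cons, List.sum_cons]
        omega

/-! ### Tables of pairs, indexed by their first components -/

/-- The table of pairs `D`, numbered from `1` on: arrays `aS` and `aD` hold the components, and for
each `v` the numbers of the pairs with first component `v` form a linked list with successors in
`aN` and first element in `aH`. Register `k` holds the next free number. -/
structure Table (aS aD aN aH k : ℕ) (D : List (ℕ × ℕ)) (σ : Mem) : Prop where
  reg_eq : σ.reg k = D.length + 1
  pair : ∀ i (hi : i < D.length), σ.arr aS (i + 1) = D[i].1 ∧ σ.arr aD (i + 1) = D[i].2
  chain : ∀ v, ∃ l, Chain (σ.arr aN) (σ.arr aH v) l ∧ l.Nodup ∧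
    ∀ p, p ∈ l ↔ 1 ≤ p ∧ p ≤ D.length ∧ σ.arr aS p = v

/-- Insertion of the pair of the contents of the registers `x` and `y` into a table. -/
def insertPair (aS aD aN aH k x y t : ℕ) : Prog :=
  .seq (.store aS k x) <| .seq (.store aD k y) <| .seq (.load t aH x) <| .seq (.store aN k t) <|
    .seq (.store aH x k) (.succ k k)

theorem Table.congr {aS aD aN aH k : ℕ} {D : List (ℕ × ℕ)} {σ τ : Mem}
    (h : Table aS aD aN aH k D σ) (hk : τ.reg k = σ.reg k) (h1 : τ.arr aS = σ.arr aS)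
    (h2 : τ.arr aD = σ.arr aD) (h3 : τ.arr aN = σ.arr aN) (h4 : τ.arr aH = σ.arr aH) :
    Table aS aD aN aH k D τ := by
  obtain ⟨g1, g2, g3⟩ := h
  exact ⟨by rw [hk, g1], by rwa [h1, h2], by rwa [h1, h3, h4]⟩

theorem wp_insertPair {aS aD aN aH k x y t : ℕ} {D : List (ℕ × ℕ)}
    (hT : Table aS aD aN aH k D σ)
    (h : [aS, aD, aN, aH].Nodup := by decide) (hx : x ≠ t := by decide) (hk : k ≠ t := by decide) :
    WP (insertPair aS aD aN aH k x y t)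
      (fun s τ => s ≤ 6 ∧ Table aS aD aN aH k (D ++ [(σ.reg x, σ.reg y)]) τ) σ := by
  simp only [List.nodup_cons, List.mem_cons, List.not_mem_nil, or_false, not_or, List.nodup_nil,
    not_false_eq_true, and_true] at h
  obtain ⟨⟨h1, h2, h3⟩, ⟨h4, h5⟩, h6⟩ := h
  obtain ⟨g1, g2, g3⟩ := hT
  simp only [insertPair, wp_seq, wp_store, wp_load, wp_succ]
  refine ⟨by norm_num, ?_, ?_, ?_⟩
  · simp [hk, g1]
  · intro i hi
    simp only [setReg_reg, setReg_arr, setArr_reg, setArr_arr, h1, h2, h3, h4, h5, Ne.symm h1, if_true, if_false,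
      hk]
    simp only [List.length_append, List.length_singleton] at hi
    rcases Nat.lt_succ_iff_lt_or_eq.1 hi with hi | rfl
    · rw [g1, Function.update_of_ne (by omega), Function.update_of_ne (by omega),
        List.getElem_append_left hi]
      exact g2 i hi
    · simp [g1]
  · intro v
    obtain ⟨l, hl, hn, hm⟩ := g3 v
    have hkl : σ.reg k ∉ l := fun hk => by
      have := ((hm _).1 hk).2.1
      omega
    simp only [setReg_reg, setReg_arr, setArr_reg, setArr_arr, h1, h2, h3, h6, ne_comm.1 h3,
      if_true, if_false, hk, hx, Ne.symm h1, Ne.symm h2, Ne.symm h4, Ne.symm h5,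
      Ne.symm h6]
    have hc : ∀ w, Chain (Function.update (σ.arr aN) (σ.reg k) w) (σ.arr aH v) l := fun w =>
      hl.congr fun u hu => Function.update_of_ne (by rintro rfl; exact hkl hu) _ _
    by_cases hv : v = σ.reg x
    · subst hv
      refine ⟨σ.reg k :: l, ⟨by simp, by omega, by simpa using hc _⟩,
        List.nodup_cons.2 ⟨hkl, hn⟩, fun p => ?_⟩
      rw [List.mem_cons, hm, List.length_append, List.length_singleton]
      by_cases hp : p = σ.reg k
      · subst hp
        simp [g1]
      · rw [Function.update_of_ne hp]
        have : p ≤ D.length + 1 ↔ p ≤ D.length := by omega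
        simp [hp, this]
    · refine ⟨l, by rw [Function.update_of_ne hv]; exact hc _, hn, fun p => ?_⟩
      rw [hm, List.length_append, List.length_singleton]
      by_cases hp : p = σ.reg k
      · subst hp
        simp [g1, Ne.symm hv]
      · rw [Function.update_of_ne hp]
        have : p ≤ D.length + 1 ↔ p ≤ D.length := by omega
        simp [this]

end Logic

/-! ### Reading the edges -/

section Edges

/-- The darts, that is, directed edges, are stored as a table in the arrays `2, 3, 4, 5` with
register `7`; array `6` holds the numbers of darts leaving each vertex. -/
structure Darts (D : List (ℕ × ℕ)) (σ : Mem) : Prop where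
  table : Table 2 3 4 5 7 D σ
  deg : ∀ v, σ.arr 6 v = (D.map Prod.fst).count v

theorem Darts.congr {D : List (ℕ × ℕ)} {σ τ : Mem} (h : Darts D σ) (hk : τ.reg 7 = σ.reg 7)
    (h2 : τ.arr 2 = σ.arr 2) (h3 : τ.arr 3 = σ.arr 3) (h4 : τ.arr 4 = σ.arr 4)
    (h5 : τ.arr 5 = σ.arr 5) (h6 : τ.arr 6 = σ.arr 6) : Darts D τ :=
  ⟨h.table.congr hk h2 h3 h4 h5, by rw [h6]; exact h.deg⟩

/-- Insertion of the dart from the vertex in register `x` to the vertex in register `y`. -/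
def addDart (x y : ℕ) : Prog :=
  .seq (insertPair 2 3 4 5 7 x y 8) <| .seq (.load 8 6 x) <| .seq (.succ 8 8) (.store 6 x 8)

theorem wp_addDart {x y : ℕ} {D : List (ℕ × ℕ)} {σ : Mem} (h : Darts D σ)
    (hx : x ≠ 8) (hx7 : x ≠ 7) :
    WP (addDart x y) (fun t τ => t ≤ 9 ∧ Darts (D ++ [(σ.reg x, σ.reg y)]) τ) σ := by
  rw [addDart, wp_seq]
  refine (wp_insertPair h.table (by decide) hx (by decide)).frame.mono fun s τ => ?_
  rintro ⟨⟨hs, hT⟩, hr, ha⟩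
  have hxr := hr x (by simp [insertPair, Prog.regs, hx, hx7])
  have h6 := ha 6 (by simp [insertPair, Prog.arrs])
  simp only [wp_seq, wp_load, wp_succ, wp_store]
  refine ⟨by omega, hT.congr (by simp) (by simp) (by simp) (by simp) (by simp), fun v => ?_⟩
  simp only [setReg_reg, setReg_arr, setArr_arr, hxr, h6, h.deg, if_true, if_neg hx]
  by_cases hv : v = σ.reg x
  · subst hv
    simp
  · simp [Function.update_of_ne hv, h.deg, Ne.symm hv]

/-- Both darts of every edge. -/
def dartsOf (es : List (ℕ × ℕ)) : List (ℕ × ℕ) := es.flatMap fun e => [(e.1, e.2), (e.2, e.1)]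

/-- Reads the list of the edges; register `1` is the reading position. -/
def readEdges (d : ℕ) : Prog :=
  .seq (.const 2 d) <| .seq (.const 7 1) <| .seq (.const 1 1) <| .seq (.load 3 0 1) <|
  .seq (.succ 1 1) <| .loop (.lt 4 3) <|
    .seq (.succ 1 1) <| .seq (.load 5 0 1) <| .seq (.succ 1 1) <| .seq (.load 6 0 1) <|
    .seq (.succ 1 1) <| .seq (addDart 5 6) <| .seq (addDart 6 5) (.succ 4 4)

theorem wp_readEdges (d n : ℕ) (es : List (ℕ × ℕ)) (tail w : List ℕ)
    (hw : w = n :: es.length :: (es.flatMap (fun e => [2, e.1, e.2]) ++ tail)) :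
    WP (readEdges d) (fun t τ => t ≤ 25 * es.length + 6 ∧ Darts (dartsOf es) τ ∧ τ.reg 2 = d ∧
      Holds (τ.arr 0) (τ.reg 1) tail) (initMem w) := by
  have hin : Holds ((initMem w).arr 0) 0 w := fun i hi => by
    simp [initMem, hi]
  subst hw
  rw [holds_cons, holds_cons] at hin
  simp only [readEdges, wp_seq, wp_const, wp_load, wp_succ]
  refine (wp_loop (G := List (ℕ × ℕ) × List (ℕ × ℕ)) (fun g σ => es = g.1 ++ g.2 ∧
    σ.reg 4 = g.1.length ∧ σ.reg 3 = es.length ∧ σ.reg 2 = d ∧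
    Holds (σ.arr 0) (σ.reg 1) (g.2.flatMap (fun e => [2, e.1, e.2]) ++ tail) ∧
    Darts (dartsOf g.1) σ) (fun g => 25 * g.2.length) ?_ (g := ([], es)) ?_).mono ?_
  · rintro ⟨L, M⟩ σ ⟨h1, h2, h3, h4, h5, h6⟩ hb
    dsimp only [Test.Holds] at *
    cases M with
    | nil =>
      simp only [List.append_nil] at h1
      subst h1
      omega
    | cons e M =>
      simp only [List.flatMap_cons, List.cons_append, List.nil_append, holds_cons] at h5
      obtain ⟨-, h5, h7, h8⟩ := h5
      simp only [wp_seq, wp_load, wp_succ]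
      refine (wp_addDart (D := dartsOf L) ?_ (by decide) (by decide)).frame.mono ?_
      · exact h6.congr (by simp) (by simp) (by simp) (by simp) (by simp) (by simp)
      rintro s τ ⟨⟨hs, hD⟩, hr, ha⟩
      simp only [setReg_reg, setReg_arr] at hr ha
      refine (wp_addDart hD (by decide) (by decide)).frame.mono ?_
      rintro s' τ' ⟨⟨hs', hD'⟩, hr', ha'⟩
      refine ⟨(L ++ [e], M), ⟨by simp [h1], ?_, ?_, ?_, ?_, ?_⟩, ?_⟩
      · have e1 := hr' 4 (by decide)
        have e2 := hr 4 (by decide)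
        simp at e2
        simp [e1, e2, h2]
      · have e1 := hr' 3 (by decide)
        have e2 := hr 3 (by decide)
        simp at e2
        simp [e1, e2, h3]
      · have e1 := hr' 2 (by decide)
        have e2 := hr 2 (by decide)
        simp at e2
        simp [e1, e2, h4]
      · have e1 := hr' 1 (by decide)
        have e2 := hr 1 (by decide)
        simp at e2
        simp only [setReg_arr, setReg_reg, ha' 0 (by decide), ha 0 (by decide)]
        simpa [e1, e2] using h8
      · have e5 := hr 5 (by decide)
        have e6 := hr 6 (by decide)
        simp only [if_true, if_false, Nat.reduceEqDiff, h5, h7,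
          setReg_reg, setReg_arr] at e5 e6 hD'
        refine Darts.congr (σ := τ') ?_ (by simp) (by simp) (by simp) (by simp) (by simp) (by simp)
        rw [e5, e6] at hD'
        simpa [dartsOf] using hD'
      · simp only [List.length_cons]
        omega
  · refine ⟨rfl, by simp [initMem], ?_, by simp, ?_, ⟨⟨by simp [dartsOf], by simp [dartsOf], ?_⟩, ?_⟩⟩
    · simpa using hin.2.1
    · simpa using hin.2.2
    · intro v
      refine ⟨[], ?_, List.nodup_nil, fun p => ?_⟩
      · simp [Chain, initMem]
      · simp [dartsOf]
        omega
    · simp [dartsOf, initMem]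
  · rintro t τ ⟨⟨L, M⟩, ⟨h1, h2, h3, h4, h5, h6⟩, hb, ht⟩
    dsimp only [Test.Holds] at *
    have hM : M = [] := by
      rw [h2, h3, h1, List.length_append] at hb
      exact List.length_eq_zero_iff.1 (by omega)
    subst hM
    simp only [List.append_nil] at h1
    subst h1
    refine ⟨?_, h6, h4, by simpa using h5⟩
    simp only [List.length_nil] at ht
    omega

end Edges

/-! ### Linking the darts along the 2-faces -/

section Links

/-- A digraph stored as a table of darts, numbered from `1` to `num`: sources `s`, targets `t`,
out-degrees `dg`, and for each vertex `v` the linked list `L v` of the darts leaving it, with first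
element `hd v`, successors given by `nx`, and `0` as end mark. -/
structure DartData where
  s : ℕ → ℕ
  t : ℕ → ℕ
  nx : ℕ → ℕ
  hd : ℕ → ℕ
  dg : ℕ → ℕ
  num : ℕ
  L : ℕ → List ℕ
  chain : ∀ v, Chain nx (hd v) (L v)
  nodup : ∀ v, (L v).Nodup
  mem_L : ∀ v p, p ∈ L v ↔ 1 ≤ p ∧ p ≤ num ∧ s p = v
  length_L : ∀ v, (L v).length = dg v

/-- The arrays `2, …, 6` hold the digraph `G`. -/
structure DartData.InMem (G : DartData) (σ : Mem) : Prop where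
  s_eq : σ.arr 2 = G.s
  t_eq : σ.arr 3 = G.t
  nx_eq : σ.arr 4 = G.nx
  hd_eq : σ.arr 5 = G.hd
  dg_eq : σ.arr 6 = G.dg

theorem DartData.InMem.congr {G : DartData} {σ τ : Mem} (h : G.InMem σ)
    (h2 : τ.arr 2 = σ.arr 2) (h3 : τ.arr 3 = σ.arr 3) (h4 : τ.arr 4 = σ.arr 4)
    (h5 : τ.arr 5 = σ.arr 5) (h6 : τ.arr 6 = σ.arr 6) : G.InMem τ :=
  ⟨h2.trans h.s_eq, h3.trans h.t_eq, h4.trans h.nx_eq, h5.trans h.hd_eq, h6.trans h.dg_eq⟩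

theorem count_fst_eq_card (D : List (ℕ × ℕ)) (s : ℕ → ℕ)
    (hs : ∀ i (hi : i < D.length), s (i + 1) = D[i].1) (v : ℕ) :
    (D.map Prod.fst).count v = ((Finset.Icc 1 D.length).filter fun p => s p = v).card := by
  induction D using List.reverseRecOn with
  | nil => simp
  | append_singleton D e ih =>
    have h1 := ih fun i hi => by
      rw [hs i (by simp; omega), List.getElem_append_left hi]
    have h2 := hs D.length (by simp)
    simp only [List.getElem_concat_length] at h2
    rw [List.map_append, List.count_append, h1, List.length_append, List.length_singleton,
      ← Finset.insert_Icc_right_eq_Icc_add_one (by omega : 1 ≤ D.length + 1), Finset.filter_insert]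
    by_cases hv : s (D.length + 1) = v
    · rw [if_pos hv, Finset.card_insert_of_notMem (by simp), ← hv, h2]
      simp
    · rw [if_neg hv]
      rw [h2] at hv
      simp [hv]

theorem Darts.exists_dartData {D : List (ℕ × ℕ)} {σ : Mem} (h : Darts D σ) :
    ∃ G : DartData, G.InMem σ ∧ G.num = D.length ∧
      ∀ i (hi : i < D.length), G.s (i + 1) = D[i].1 ∧ G.t (i + 1) = D[i].2 := by
  choose L hL hn hm using h.table.chain
  refine ⟨⟨σ.arr 2, σ.arr 3, σ.arr 4, σ.arr 5, σ.arr 6, D.length, L, hL, hn, fun v p => hm v p,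
    fun v => ?_⟩, ⟨rfl, rfl, rfl, rfl, rfl⟩, rfl, h.table.pair⟩
  rw [h.deg, count_fst_eq_card D (σ.arr 2) (fun i hi => (h.table.pair i hi).1),
    ← List.toFinset_card_of_nodup (hn v)]
  congr 1
  ext p
  simp [hm, and_assoc]

/-- The table of links between darts, in the arrays `8, …, 11` with register `18`. -/
abbrev Links (D : List (ℕ × ℕ)) (σ : Mem) : Prop := Table 8 9 10 11 18 D σ

/-- Within `c` steps the program `p` adds at most `c` links to the table, namely the pairs that
satisfy `Q`. -/
def Adds (p : Prog) (c : ℕ) (Q : ℕ × ℕ → Prop) (σ : Mem) : Prop :=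
  ∀ D, Links D σ → WP p (fun t τ => t ≤ c ∧ ∃ D', Links D' τ ∧
    (∀ e, e ∈ D' ↔ e ∈ D ∨ Q e) ∧ D'.length ≤ D.length + c) σ

variable {p : Prog} {c : ℕ} {Q : ℕ × ℕ → Prop} {σ : Mem}

theorem Adds.congr {R : ℕ × ℕ → Prop} (h : Adds p c Q σ) (hQ : ∀ e, Q e ↔ R e) :
    Adds p c R σ := by
  obtain rfl : Q = R := funext fun e => propext (hQ e)
  exact h

theorem adds_insertPair {x y t : ℕ} (hx : x ≠ t) (ht : 18 ≠ t) :
    Adds (insertPair 8 9 10 11 18 x y t) 6 (fun e => e = (σ.reg x, σ.reg y)) σ := fun D hD =>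
  (wp_insertPair hD (by decide) hx ht).mono fun s τ h =>
    ⟨h.1, _, h.2, fun e => by simp, by simp⟩

theorem adds_ite {b : Test} (h : b.Holds σ → Adds p c Q σ) :
    Adds (.ite b p .skip) (c + 2) (fun e => b.Holds σ ∧ Q e) σ := by
  intro D hD
  rw [wp_ite, wp_skip]
  refine ⟨fun hb => (h hb D hD).mono ?_, fun hb => ⟨by omega, D, hD, fun e => by simp [hb], by omega⟩⟩
  rintro s τ ⟨hs, D', h1, h2, h3⟩
  exact ⟨by omega, D', h1, fun e => by rw [h2]; simp [hb], by omega⟩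

theorem adds_load {x a y : ℕ} (hx : x ≠ 18) (h : Adds p c Q (σ.setReg x (σ.arr a (σ.reg y)))) :
    Adds (.seq (.load x a y) p) (c + 1) Q σ := by
  intro D hD
  rw [wp_seq, wp_load]
  refine (h D (Table.congr hD (by simp [hx.symm]) rfl rfl rfl rfl)).mono ?_
  rintro s τ ⟨hs, D', h1, h2, h3⟩
  exact ⟨by omega, D', h1, h2, by omega⟩

theorem adds_forList {i a : ℕ} {Q : ℕ → ℕ × ℕ → Prop} (l : List ℕ) (hi : i ≠ 0) (hi18 : i ≠ 18)
    (hir : i ∉ p.regs) (h0r : 0 ∉ p.regs) (har : a ∉ p.arrs) (hc : Chain (σ.arr a) (σ.reg i) l)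
    (h0 : σ.reg 0 = 0)
    (h : ∀ v ∈ l, ∀ τ : Mem, τ.reg i = v → (∀ x, x ≠ i → x ∉ p.regs → τ.reg x = σ.reg x) →
      (∀ b, b ∉ p.arrs → τ.arr b = σ.arr b) → Adds p c (Q v) τ) :
    Adds (forList i a p) ((c + 2) * l.length + 1) (fun e => ∃ v ∈ l, Q v e) σ := by
  intro D hD
  refine (wp_forList hi l (fun L τ => (∀ x, x ≠ i → x ∉ p.regs → τ.reg x = σ.reg x) ∧
    (∀ b, b ∉ p.arrs → τ.arr b = σ.arr b) ∧ ∃ D', Links D' τ ∧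
      (∀ e, e ∈ D' ↔ e ∈ D ∨ ∃ v ∈ L, Q v e) ∧ D'.length ≤ D.length + c * L.length) (fun _ => c)
    ?_ ?_ hir h0r har hc h0 ⟨fun _ _ _ => rfl, fun _ _ => rfl, D, hD, by simp, by simp⟩).mono ?_
  · rintro L τ v ⟨h1, h2, D', h3, h4⟩
    exact ⟨fun x hx hx' => by simp [hx, h1 x hx hx'], h2, D',
      Table.congr h3 (by simp [hi18.symm]) rfl rfl rfl rfl, h4⟩
  · rintro L v M τ hl ⟨h1, h2, D', h3, h4, h5⟩ hv
    refine (h v (by simp [hl]) τ hv h1 h2 D' h3).frame.mono ?_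
    rintro s ρ ⟨⟨hs, D'', h6, h7, h8⟩, hr, ha⟩
    refine ⟨hs, fun x hx hx' => (hr x hx').trans (h1 x hx hx'),
      fun b hb => (ha b hb).trans (h2 b hb), D'', h6, fun e => ?_, ?_⟩
    · rw [h7, h4, or_assoc]
      simp [or_and_right, exists_or]
    · rw [List.length_append, List.length_singleton, mul_add]
      omega
  · rintro s τ ⟨hs, -, -, D', h3, h4, h5⟩
    simp only [List.map_const', List.sum_replicate, smul_eq_mul] at hs
    refine ⟨by linarith, D', h3, h4, h5.trans ?_⟩
    nlinarith [Nat.zero_le l.length]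

theorem Adds.mono {c' : ℕ} (h : Adds p c Q σ) (hc : c ≤ c') : Adds p c' Q σ := fun D hD =>
  (h D hD).mono fun _ _ ⟨h1, D', h2, h3, h4⟩ => ⟨h1.trans hc, D', h2, h3, by omega⟩

/-- With the vertices of a 2-face marked by the content of register `10`: links the dart in register
`15`, from the vertex in register `14`, to the dart in register `17` if that ends on the 2-face and
is not the reverse of the dart walked along. -/
def linkDart : Prog :=
  .seq (.load 20 3 17) <| .ite (.ne 20 14)
    (.seq (.load 19 7 20) (.ite (.eq 19 10) (insertPair 8 9 10 11 18 15 17 21) .skip)) .skip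

/-- Walks along the dart in register `16` if it lies on the marked 2-face and has a simple end. -/
def walkDart : Prog :=
  .ite (.ne 16 15) (.seq (.load 20 3 16) <| .seq (.load 19 7 20) <| .ite (.eq 19 10)
    (.seq (.load 19 6 20) <| .ite (.eq 19 2) (.seq (.load 17 5 20) (forList 17 4 linkDart)) .skip)
    .skip) .skip

/-- Treats the dart in register `15` as the missed one if it lies on the marked 2-face. -/
def missDart : Prog :=
  .seq (.load 20 3 15) <| .seq (.load 19 7 20) <| .ite (.eq 19 10)
    (.seq (.load 16 5 14) (forList 16 4 walkDart)) .skip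

/-- Produces the links of the marked 2-face at the vertex in register `14`, if that is simple. -/
def linkVertex : Prog :=
  .seq (.load 19 6 14) <| .ite (.eq 19 2) (.seq (.load 15 5 14) (forList 15 4 missDart)) .skip

/-- The links on a 2-face with vertex set `S` at its vertex `v`: from a dart `p` at `v` to a dart
`r` at another vertex of the 2-face. -/
def LinkAt (G : DartData) (d : ℕ) (S : ℕ → Prop) (v : ℕ) (e : ℕ × ℕ) : Prop :=
  G.dg v = d ∧ ∃ p ∈ G.L v, S (G.t p) ∧ ∃ q ∈ G.L v, q ≠ p ∧ S (G.t q) ∧ G.dg (G.t q) = d ∧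
    ∃ r ∈ G.L (G.t q), G.t r ≠ v ∧ S (G.t r) ∧ e = (p, r)

/-- A bound for the running time of `linkVertex`: three nested loops over the `d` darts leaving a
simple vertex. -/
def linkCost (d : ℕ) : ℕ := ((14 * d + 13) * d + 8) * d + 5

theorem adds_linkDart {t : ℕ → ℕ} (ht : σ.arr 3 = t) :
    Adds linkDart 12 (fun e => t (σ.reg 17) ≠ σ.reg 14 ∧ σ.arr 7 (t (σ.reg 17)) = σ.reg 10 ∧
      e = (σ.reg 15, σ.reg 17)) σ :=
  (adds_load (by decide) (adds_ite fun _ => adds_load (by decide) (adds_ite fun _ =>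
    adds_insertPair (by decide) (by decide)))).congr fun e => by simp [Test.Holds, ht]

theorem adds_walkDart {G : DartData} (hG : G.InMem σ) (h0 : σ.reg 0 = 0) :
    Adds walkDart (14 * σ.reg 2 + 11) (fun e => σ.reg 16 ≠ σ.reg 15 ∧
      σ.arr 7 (G.t (σ.reg 16)) = σ.reg 10 ∧ G.dg (G.t (σ.reg 16)) = σ.reg 2 ∧
      ∃ r ∈ G.L (G.t (σ.reg 16)), G.t r ≠ σ.reg 14 ∧ σ.arr 7 (G.t r) = σ.reg 10 ∧
        e = (σ.reg 15, r)) σ := by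
  obtain ⟨hs, ht, hnx, hhd, hdg⟩ := hG
  refine (adds_ite (c := 14 * σ.reg 2 + 9) fun _ => adds_load (c := 14 * σ.reg 2 + 8) (by decide)
    (adds_load (c := 14 * σ.reg 2 + 7) (by decide) (adds_ite (c := 14 * σ.reg 2 + 5) fun _ =>
    adds_load (c := 14 * σ.reg 2 + 4) (by decide) (adds_ite (c := 14 * σ.reg 2 + 2) fun hd =>
    adds_load (c := 14 * σ.reg 2 + 1) (by decide) ((adds_forList (c := 12) (G.L (G.t (σ.reg 16)))
      (Q := fun r e => G.t r ≠ σ.reg 14 ∧ σ.arr 7 (G.t r) = σ.reg 10 ∧ e = (σ.reg 15, r))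
      (by decide) (by decide) (by decide) (by decide) (by decide) ?_ ?_ ?_).mono ?_))))).congr ?_
  · simpa [hnx, hhd, ht] using G.chain _
  · simpa using h0
  · rintro v - τ hv hr ha
    have h15 := hr 15 (by decide) (by decide)
    have h14 := hr 14 (by decide) (by decide)
    have h10 := hr 10 (by decide) (by decide)
    have h3 := ha 3 (by decide)
    have h7 := ha 7 (by decide)
    simp at h15 h14 h10 h3 h7
    refine (adds_linkDart (h3.trans ht)).congr fun e => ?_
    rw [h15, h14, h10, h7, hv]
  · simp only [Test.Holds, setReg_reg, setReg_arr, if_true, if_false, Nat.reduceEqDiff, ht, hdg]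
      at hd
    rw [G.length_L, hd]
  · intro e
    simp [Test.Holds, ht, hdg]

theorem adds_missDart {G : DartData} (hG : G.InMem σ) (h0 : σ.reg 0 = 0)
    (hd : G.dg (σ.reg 14) = σ.reg 2) :
    Adds missDart ((14 * σ.reg 2 + 13) * σ.reg 2 + 6) (fun e =>
      σ.arr 7 (G.t (σ.reg 15)) = σ.reg 10 ∧ ∃ q ∈ G.L (σ.reg 14), q ≠ σ.reg 15 ∧
        σ.arr 7 (G.t q) = σ.reg 10 ∧ G.dg (G.t q) = σ.reg 2 ∧ ∃ r ∈ G.L (G.t q),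
          G.t r ≠ σ.reg 14 ∧ σ.arr 7 (G.t r) = σ.reg 10 ∧ e = (σ.reg 15, r)) σ := by
  have hG' := hG
  obtain ⟨hs, ht, hnx, hhd, hdg⟩ := hG
  refine (adds_load (c := (14 * σ.reg 2 + 13) * σ.reg 2 + 5) (by decide)
    (adds_load (c := (14 * σ.reg 2 + 13) * σ.reg 2 + 4) (by decide)
    (adds_ite (c := (14 * σ.reg 2 + 13) * σ.reg 2 + 2) fun _ =>
    adds_load (c := (14 * σ.reg 2 + 13) * σ.reg 2 + 1) (by decide)
    ((adds_forList (c := 14 * σ.reg 2 + 11) (G.L (σ.reg 14))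
      (Q := fun q e => q ≠ σ.reg 15 ∧ σ.arr 7 (G.t q) = σ.reg 10 ∧ G.dg (G.t q) = σ.reg 2 ∧
        ∃ r ∈ G.L (G.t q), G.t r ≠ σ.reg 14 ∧ σ.arr 7 (G.t r) = σ.reg 10 ∧ e = (σ.reg 15, r))
      (by decide) (by decide) (by decide) (by decide) (by decide) ?_ ?_ ?_).mono ?_)))).congr ?_
  · simpa [hnx, hhd] using G.chain _
  · simpa using h0
  · rintro v - τ hv hr ha
    have h15 := hr 15 (by decide) (by decide)
    have h14 := hr 14 (by decide) (by decide)
    have h10 := hr 10 (by decide) (by decide)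
    have h2 := hr 2 (by decide) (by decide)
    have h00 := hr 0 (by decide) (by decide)
    have h7 := ha 7 (by decide)
    simp at h15 h14 h10 h2 h00 h7
    have := adds_walkDart (σ := τ) (G := G) (hG'.congr (ha 2 (by decide)) (ha 3 (by decide))
      (ha 4 (by decide)) (ha 5 (by decide)) (ha 6 (by decide))) (h00.trans h0)
    rwa [h15, h14, h10, h7, hv, h2] at this
  · rw [G.length_L, hd]
  · intro e
    simp [Test.Holds, ht]

theorem adds_linkVertex {G : DartData} (hG : G.InMem σ) (h0 : σ.reg 0 = 0) :
    Adds linkVertex (linkCost (σ.reg 2))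
      (LinkAt G (σ.reg 2) (fun x => σ.arr 7 x = σ.reg 10) (σ.reg 14)) σ := by
  have hG' := hG
  obtain ⟨hs, ht, hnx, hhd, hdg⟩ := hG
  refine (adds_load (c := ((14 * σ.reg 2 + 13) * σ.reg 2 + 8) * σ.reg 2 + 4) (by decide)
    (adds_ite (c := ((14 * σ.reg 2 + 13) * σ.reg 2 + 8) * σ.reg 2 + 2) fun hd =>
    adds_load (c := ((14 * σ.reg 2 + 13) * σ.reg 2 + 8) * σ.reg 2 + 1) (by decide)
    ((adds_forList (c := (14 * σ.reg 2 + 13) * σ.reg 2 + 6) (G.L (σ.reg 14))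
      (Q := fun p e => σ.arr 7 (G.t p) = σ.reg 10 ∧ ∃ q ∈ G.L (σ.reg 14), q ≠ p ∧
        σ.arr 7 (G.t q) = σ.reg 10 ∧ G.dg (G.t q) = σ.reg 2 ∧ ∃ r ∈ G.L (G.t q),
          G.t r ≠ σ.reg 14 ∧ σ.arr 7 (G.t r) = σ.reg 10 ∧ e = (p, r))
      (by decide) (by decide) (by decide) (by decide) (by decide) ?_ ?_ ?_).mono ?_))).congr ?_
  · simpa [hnx, hhd] using G.chain _
  · simpa using h0
  · rintro v - τ hv hr ha
    simp only [Test.Holds, setReg_reg, if_true, if_false, Nat.reduceEqDiff, hdg] at hd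
    have h14 := hr 14 (by decide) (by decide)
    have h10 := hr 10 (by decide) (by decide)
    have h2 := hr 2 (by decide) (by decide)
    have h00 := hr 0 (by decide) (by decide)
    have h7 := ha 7 (by decide)
    simp at h14 h10 h2 h00 h7
    have := adds_missDart (σ := τ) (G := G) (hG'.congr (ha 2 (by decide)) (ha 3 (by decide))
      (ha 4 (by decide)) (ha 5 (by decide)) (ha 6 (by decide))) (h00.trans h0) (by rw [h14, h2, hd])
    rwa [h14, h10, h7, hv, h2] at this
  · simp only [Test.Holds, setReg_reg, if_true, if_false, Nat.reduceEqDiff, hdg] at hd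
    rw [G.length_L, hd]
  · intro e
    simp [Test.Holds, hdg, LinkAt]

end Links

/-! ### Reading the 2-faces -/

section TwoFaces

/-- Marks the vertices of the next 2-face by the content of register `10`. -/
def markFace : Prog :=
  .seq (.copy 12 1) <| .seq (.const 13 0) <| .loop (.lt 13 11) <|
    .seq (.load 14 0 12) <| .seq (.store 7 14 10) <| .seq (.succ 12 12) (.succ 13 13)

/-- Produces the links at all vertices of the next 2-face. -/
def linkFace : Prog :=
  .seq (.const 13 0) <| .loop (.lt 13 11) <|
    .seq (.load 14 0 1) <| .seq (.succ 1 1) <| .seq linkVertex (.succ 13 13)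

/-- Reads the list of the 2-faces and produces the table of links. -/
def readFaces : Prog :=
  .seq (.load 9 0 1) <| .seq (.succ 1 1) <| .seq (.const 18 1) <| .loop (.lt 10 9) <|
    .seq (.succ 10 10) <| .seq (.load 11 0 1) <| .seq (.succ 1 1) <| .seq markFace linkFace

variable {σ : Mem}

theorem wp_markFace {S : List ℕ} (hS : Holds (σ.arr 0) (σ.reg 1) S) (hl : σ.reg 11 = S.length) :
    WP markFace (fun t τ => t ≤ 5 * S.length + 3 ∧
      ∀ x, τ.arr 7 x = if x ∈ S then σ.reg 10 else σ.arr 7 x) σ := by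
  simp only [markFace, wp_seq, wp_const, wp_copy]
  refine WP.mono (wp_loop (G := List ℕ × List ℕ) (fun g τ => S = g.1 ++ g.2 ∧ τ.reg 13 = g.1.length ∧
    τ.reg 11 = S.length ∧ τ.reg 10 = σ.reg 10 ∧ Holds (τ.arr 0) (τ.reg 12) g.2 ∧
    ∀ x, τ.arr 7 x = if x ∈ g.1 then σ.reg 10 else σ.arr 7 x) (fun g => 5 * g.2.length) ?_
    (g := ([], S)) ⟨rfl, by simp, by simpa using hl, by simp, by simpa using hS, by simp⟩) ?_
  · rintro ⟨L, M⟩ τ ⟨h1, h2, h3, h4, h5, h6⟩ hb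
    dsimp only [Test.Holds] at *
    cases M with
    | nil =>
      simp only [List.append_nil] at h1
      subst h1
      omega
    | cons v M =>
      rw [holds_cons] at h5
      simp only [wp_seq, wp_load, wp_store, wp_succ]
      refine ⟨(L ++ [v], M), ⟨by simp [h1], by simp [h2], by simp [h3], by simp [h4],
        by simpa using h5.2, fun x => ?_⟩, ?_⟩
      · simp only [setReg_arr, setArr_arr, setReg_reg, if_true, h5.1, Function.update_apply, h4, h6,
          List.mem_append, List.mem_singleton, Nat.reduceEqDiff, if_false]
        by_cases h7 : x = v <;> simp [h7]
      · simp only [List.length_cons]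
        omega
  · rintro t τ ⟨⟨L, M⟩, ⟨h1, h2, h3, h4, h5, h6⟩, hb, ht⟩
    dsimp only [Test.Holds] at *
    have hM : M = [] := by
      rw [h2, h3, h1, List.length_append] at hb
      exact List.length_eq_zero_iff.1 (by omega)
    subst hM
    simp only [List.append_nil] at h1
    subst h1
    exact ⟨by omega, h6⟩

theorem wp_linkFace {S tail : List ℕ} {G : DartData} {D : List (ℕ × ℕ)} {d : ℕ}
    (hS : Holds (σ.arr 0) (σ.reg 1) (S ++ tail)) (hl : σ.reg 11 = S.length) (hG : G.InMem σ)
    (h0 : σ.reg 0 = 0) (hd : σ.reg 2 = d) (hD : Links D σ) :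
    WP linkFace (fun t τ => t ≤ (linkCost d + 4) * S.length + 2 ∧
      Holds (τ.arr 0) (τ.reg 1) tail ∧ ∃ D', Links D' τ ∧
        (∀ e, e ∈ D' ↔ e ∈ D ∨ ∃ v ∈ S, LinkAt G d (fun x => σ.arr 7 x = σ.reg 10) v e) ∧
        D'.length ≤ D.length + linkCost d * S.length) σ := by
  simp only [linkFace, wp_seq, wp_const]
  refine WP.mono (wp_loop (G := List ℕ × List ℕ) (fun g τ => S = g.1 ++ g.2 ∧ τ.reg 13 = g.1.length ∧
    τ.reg 11 = S.length ∧ (τ.reg 10 = σ.reg 10 ∧ τ.reg 2 = d ∧ τ.reg 0 = 0) ∧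
    Holds (τ.arr 0) (τ.reg 1) (g.2 ++ tail) ∧ (τ.arr 7 = σ.arr 7 ∧ G.InMem τ) ∧ ∃ D', Links D' τ ∧
      (∀ e, e ∈ D' ↔ e ∈ D ∨ ∃ v ∈ g.1, LinkAt G d (fun x => σ.arr 7 x = σ.reg 10) v e) ∧
      D'.length ≤ D.length + linkCost d * g.1.length)
    (fun g => (linkCost d + 4) * g.2.length) ?_ (g := ([], S))
    ⟨rfl, by simp, by simpa using hl, ⟨by simp, by simpa using hd, by simpa using h0⟩,
      by simpa using hS, ⟨rfl, hG.congr rfl rfl rfl rfl rfl⟩,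
      D, Table.congr hD (by simp) rfl rfl rfl rfl, by simp, by simp⟩) ?_
  · rintro ⟨L, M⟩ τ ⟨h1, h2, h3, ⟨h4, h4', h4''⟩, h5, ⟨h6, h7⟩, D', h8, h9, h10⟩ hb
    dsimp only [Test.Holds] at *
    cases M with
    | nil =>
      simp only [List.append_nil] at h1
      subst h1
      omega
    | cons v M =>
      rw [List.cons_append, holds_cons] at h5
      simp only [wp_seq, wp_load, wp_succ]
      refine (adds_linkVertex (G := G) (hG := ?_) ?_ D' ?_).frame.mono ?_
      · exact h7.congr rfl rfl rfl rfl rfl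
      · simpa using h4''
      · exact Table.congr h8 (by simp) rfl rfl rfl rfl
      rintro s ρ ⟨⟨hs, D'', h11, h12, h13⟩, hr, ha⟩
      simp only [setReg_reg, setReg_arr, Nat.reduceEqDiff, if_true, if_false, h4, h4', h5.1, h6]
        at hs h12 h13
      simp only [setReg_reg, setReg_arr] at hr ha
      refine ⟨(L ++ [v], M), ⟨by simp [h1], ?_, ?_, ⟨?_, ?_, ?_⟩, ?_, ⟨?_, ?_⟩, D'', ?_, ?_, ?_⟩, ?_⟩
      · have := hr 13 (by decide)
        simp at this
        simp [this, h2]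
      · have := hr 11 (by decide)
        simp at this
        simp [this, h3]
      · have := hr 10 (by decide)
        simp at this
        simp [this, h4]
      · have := hr 2 (by decide)
        simp at this
        simp [this, h4']
      · have := hr 0 (by decide)
        simp at this
        simp [this, h4'']
      · have := hr 1 (by decide)
        simp at this
        simp only [setReg_arr, setReg_reg, ha 0 (by decide)]
        simpa [this] using h5.2
      · simp only [setReg_arr, ha 7 (by decide), h6]
      · exact h7.congr (ha 2 (by decide)) (ha 3 (by decide)) (ha 4 (by decide)) (ha 5 (by decide))
          (ha 6 (by decide))
      · exact Table.congr h11 (by simp) rfl rfl rfl rfl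
      · intro e
        rw [h12, h9, or_assoc]
        simp [or_and_right, exists_or]
      · simp only [List.length_append, List.length_singleton, mul_add]
        omega
      · simp only [List.length_cons, mul_add]
        omega
  · rintro t τ ⟨⟨L, M⟩, ⟨h1, h2, h3, h4, h5, h6, D', h8, h9, h10⟩, hb, ht⟩
    dsimp only [Test.Holds] at *
    have hM : M = [] := by
      rw [h2, h3, h1, List.length_append] at hb
      exact List.length_eq_zero_iff.1 (by omega)
    subst hM
    simp only [List.append_nil] at h1
    subst h1
    exact ⟨by omega, by simpa using h5, D', h8, h9, h10⟩

/-- The total size of a list of 2-faces. -/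
def size (fs : List (List ℕ)) : ℕ := (fs.map fun S => S.length + 1).sum

theorem wp_readFaces {fs : List (List ℕ)} {G : DartData} {d : ℕ}
    (hS : Holds (σ.arr 0) (σ.reg 1) (fs.length :: fs.flatMap fun S => S.length :: S))
    (hG : G.InMem σ) (h0 : σ.reg 0 = 0) (hd : σ.reg 2 = d) (h10 : σ.reg 10 = 0)
    (h7 : ∀ x, σ.arr 7 x = 0) (h11 : ∀ x, σ.arr 11 x = 0) :
    WP readFaces (fun t τ => t ≤ (linkCost d + 9) * size fs + 4 ∧ ∃ D, Links D τ ∧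
      (∀ e, e ∈ D ↔ ∃ S ∈ fs, ∃ v ∈ S, LinkAt G d (fun x => x ∈ S) v e) ∧
      D.length ≤ (linkCost d + 9) * size fs) σ := by
  rw [holds_cons] at hS
  simp only [readFaces, wp_seq, wp_const, wp_load, wp_succ]
  refine WP.mono (wp_loop (G := List (List ℕ) × List (List ℕ)) (fun g τ => fs = g.1 ++ g.2 ∧
    τ.reg 10 = g.1.length ∧ τ.reg 9 = fs.length ∧ (τ.reg 2 = d ∧ τ.reg 0 = 0) ∧
    Holds (τ.arr 0) (τ.reg 1) (g.2.flatMap fun S => S.length :: S) ∧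
    ((∀ x, τ.arr 7 x ≤ g.1.length) ∧ G.InMem τ) ∧ ∃ D, Links D τ ∧
      (∀ e, e ∈ D ↔ ∃ S ∈ g.1, ∃ v ∈ S, LinkAt G d (fun x => x ∈ S) v e) ∧
      D.length ≤ (linkCost d + 9) * size g.1)
    (fun g => (linkCost d + 9) * size g.2) ?_ (g := ([], fs))
    ⟨rfl, by simpa using h10, by simpa using hS.1, ⟨by simpa using hd, by simpa using h0⟩,
      by simpa using hS.2, ⟨by simp [h7], hG.congr rfl rfl rfl rfl rfl⟩, [], ?_, by simp,
      by simp⟩) ?_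
  · rintro ⟨L, M⟩ τ ⟨h1, h2, h3, ⟨h4, h4'⟩, h5, ⟨h6, h7⟩, D, h8, h9, h10⟩ hb
    dsimp only [Test.Holds] at *
    cases M with
    | nil =>
      simp only [List.append_nil] at h1
      subst h1
      omega
    | cons S M =>
      rw [List.flatMap_cons, List.cons_append, holds_cons] at h5
      simp only [wp_seq, wp_load, wp_succ]
      refine (wp_markFace (S := S) ?_ ?_).frame.mono ?_
      · simpa using (holds_append.1 h5.2).1
      · simpa using h5.1
      rintro s ρ ⟨⟨hs, hmark⟩, hr, ha⟩
      simp only [setReg_reg, setReg_arr, Nat.reduceEqDiff, if_true, if_false] at hr ha hmark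
      have r0 := hr 0 (by decide)
      have r1 := hr 1 (by decide)
      have r2 := hr 2 (by decide)
      have r9 := hr 9 (by decide)
      have r10 := hr 10 (by decide)
      have r11 := hr 11 (by decide)
      have r18 := hr 18 (by decide)
      simp only [Nat.reduceEqDiff, if_true, if_false, OfNat.zero_ne_ofNat, zero_ne_one] at r0 r1 r2 r9 r10 r11 r18
      refine (wp_linkFace (S := S) (tail := M.flatMap fun S => S.length :: S) (G := G) (D := D)
        (d := d) ?_ ?_ ?_ ?_ ?_ ?_).frame.mono ?_
      · rw [r1, ha 0 (by decide)]
        exact h5.2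
      · rw [r11, h5.1]
      · exact h7.congr (ha 2 (by decide)) (ha 3 (by decide)) (ha 4 (by decide)) (ha 5 (by decide))
          (ha 6 (by decide))
      · rw [r0, h4']
      · rw [r2, h4]
      · exact h8.congr r18 (ha 8 (by decide)) (ha 9 (by decide)) (ha 10 (by decide))
          (ha 11 (by decide))
      -- marks left by earlier 2-faces are smaller numbers and need not be erased
      have hmark' : ∀ x, ρ.arr 7 x = ρ.reg 10 ↔ x ∈ S := fun x => by
        rw [hmark, r10, h2]
        by_cases hx : x ∈ S
        · simp [hx]
        · have := h6 x
          simp only [hx, if_false, iff_false]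
          omega
      rintro s' ρ' ⟨⟨hs', hin, D', h11, h12, h13⟩, hr', ha'⟩
      simp only [hmark'] at h12
      have hsize : size (L ++ [S]) = size L + (S.length + 1) := by simp [size]
      refine ⟨(L ++ [S], M), ⟨by simp [h1], ?_, ?_, ⟨?_, ?_⟩, hin, ⟨fun x => ?_, ?_⟩, D', h11, ?_, ?_⟩,
        ?_⟩
      · rw [hr' 10 (by decide), r10, h2]
        simp
      · rw [hr' 9 (by decide), r9, h3]
      · rw [hr' 2 (by decide), r2, h4]
      · rw [hr' 0 (by decide), r0, h4']
      · rw [ha' 7 (by decide), hmark, h2]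
        have := h6 x
        simp only [List.length_append, List.length_singleton]
        split_ifs <;> omega
      · exact (h7.congr (ha 2 (by decide)) (ha 3 (by decide)) (ha 4 (by decide)) (ha 5 (by decide))
          (ha 6 (by decide))).congr (ha' 2 (by decide)) (ha' 3 (by decide)) (ha' 4 (by decide))
          (ha' 5 (by decide)) (ha' 6 (by decide))
      · intro e
        rw [h12, h9]
        simp [or_and_right, exists_or]
      · have : linkCost d * S.length ≤ (linkCost d + 9) * (S.length + 1) :=
          Nat.mul_le_mul (by omega) (by omega)
        rw [hsize, mul_add]
        omega
      · have : size (S :: M) = S.length + 1 + size M := by simp [size]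
        have h14 : (linkCost d + 9) * (S.length + 1) =
          (linkCost d + 4) * S.length + 5 * S.length + (linkCost d + 9) := by ring
        rw [this, mul_add, h14]
        dsimp only
        omega
  · refine ⟨by simp, by simp, fun v => ⟨[], ?_, List.nodup_nil, fun p => ?_⟩⟩
    · simp [Chain, h11]
    · simp
      omega
  · rintro t τ ⟨⟨L, M⟩, ⟨h1, h2, h3, h4, h5, h6, D, h8, h9, h10⟩, hb, ht⟩
    dsimp only [Test.Holds] at *
    have hM : M = [] := by
      rw [h2, h3, h1, List.length_append] at hb
      exact List.length_eq_zero_iff.1 (by omega)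
    subst hM
    simp only [List.append_nil] at h1
    subst h1
    refine ⟨?_, D, h8, h9, h10⟩
    omega

end TwoFaces

/-! ### Searching the components of the link graph -/

section Search

/-- The arrays `8, …, 11` hold the digraph `H`, whose vertices are darts and whose darts are links. -/
structure DartData.InLinks (H : DartData) (σ : Mem) : Prop where
  s_eq : σ.arr 8 = H.s
  t_eq : σ.arr 9 = H.t
  nx_eq : σ.arr 10 = H.nx
  hd_eq : σ.arr 11 = H.hd

theorem DartData.InLinks.congr {H : DartData} {σ τ : Mem} (h : H.InLinks σ)
    (h8 : τ.arr 8 = σ.arr 8) (h9 : τ.arr 9 = σ.arr 9) (h10 : τ.arr 10 = σ.arr 10)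
    (h11 : τ.arr 11 = σ.arr 11) : H.InLinks τ :=
  ⟨h8.trans h.s_eq, h9.trans h.t_eq, h10.trans h.nx_eq, h11.trans h.hd_eq⟩

/-- Appends the vertex in register `29` to the output unless it is stamped with the number of the
current facet. -/
def emit : Prog :=
  .seq (.load 30 14 29) <| .ite (.ne 30 22)
    (.seq (.store 14 29 22) <| .seq (.store 1 23 29) <| .seq (.succ 23 23) (.succ 28 28)) .skip

/-- Emits the source of the dart in register `31` and the targets of the other darts there. -/
def emitDart : Prog :=
  .seq (.load 32 2 31) <| .seq (.copy 29 32) <| .seq emit <| .seq (.load 33 5 32) <|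
    forList 33 4 (.ite (.ne 33 31) (.seq (.load 29 3 33) emit) .skip)

/-- Appends the dart in register `35` to the queue unless it has been seen. -/
def push : Prog :=
  .seq (.load 30 13 35) <| .ite (.eq 30 0)
    (.seq (.store 13 35 36) <| .seq (.store 12 25 35) (.succ 25 25)) .skip

/-- Appends the darts linked with the dart in register `31` to the queue. -/
def pushLinks : Prog :=
  .seq (.load 34 11 31) <| forList 34 10 (.seq (.load 35 9 34) push)

/-- Processes the next dart of the queue. -/
def pop : Prog :=
  .seq (.load 31 12 24) <| .seq (.succ 24 24) <| .seq emitDart pushLinks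

/-- Outputs a new facet, that of the dart in register `26`: the place for the number of its vertices,
kept in register `27`, is reserved first and filled in when the search of the class is over. -/
def newFacet : Prog :=
  .seq (.succ 22 22) <| .seq (.copy 27 23) <| .seq (.succ 23 23) <| .seq (.const 28 0) <|
  .seq (.copy 35 26) <| .seq push <| .seq (.loop (.lt 24 25) pop) (.store 1 27 28)

/-- Outputs the facets: runs through all darts and starts a search at each unseen one with a simple
source. The place `0` for the number of the facets is filled in at the end. -/
def writeFacets : Prog :=
  .seq (.const 36 1) <| .seq (.const 23 1) <| .seq (.const 26 1) <|
  .seq (.loop (.lt 26 7) <| .seq (.load 32 2 26) <| .seq (.load 30 6 32) <|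
    .seq (.ite (.eq 30 2) (.seq (.load 30 13 26) (.ite (.eq 30 0) newFacet .skip)) .skip)
      (.succ 26 26))
  (.store 1 0 22)

variable {σ : Mem}

/-- The list `l` of vertices of the current facet has been output after position `base`, and exactly
these vertices are stamped; up to `base`, the output array is `f`. -/
structure Emitted (f : ℕ → ℕ) (base : ℕ) (l : List ℕ) (σ : Mem) : Prop where
  pos : σ.reg 23 = base + 1 + l.length
  count : σ.reg 28 = l.length
  out : Holds (σ.arr 1) (base + 1) l
  out_le : ∀ i ≤ base, σ.arr 1 i = f i
  nodup : l.Nodup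
  stamp : ∀ x, σ.arr 14 x = σ.reg 22 ↔ x ∈ l
  stamp_le : ∀ x, σ.arr 14 x ≤ σ.reg 22

theorem Emitted.congr {f : ℕ → ℕ} {base : ℕ} {l : List ℕ} {τ : Mem} (h : Emitted f base l σ)
    (h22 : τ.reg 22 = σ.reg 22) (h23 : τ.reg 23 = σ.reg 23) (h28 : τ.reg 28 = σ.reg 28)
    (h1 : τ.arr 1 = σ.arr 1) (h14 : τ.arr 14 = σ.arr 14) : Emitted f base l τ := by
  obtain ⟨g1, g2, g3, g4, g5, g6, g7⟩ := h
  exact ⟨by rw [h23, g1], by rw [h28, g2], by rwa [h1], by rwa [h1], g5, by rwa [h14, h22],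
    by rwa [h14, h22]⟩

theorem wp_emit {f : ℕ → ℕ} {base : ℕ} {l : List ℕ} (h : Emitted f base l σ) :
    WP emit (fun t τ => t ≤ 6 ∧ ∃ l', Emitted f base l' τ ∧ ∀ y, y ∈ l' ↔ y ∈ l ∨ y = σ.reg 29)
      σ := by
  obtain ⟨g1, g2, g3, g4, g5, g6, g7⟩ := h
  simp only [emit, wp_seq, wp_load, wp_ite, wp_store, wp_succ, wp_skip, Test.Holds]
  refine ⟨fun hne => ⟨by norm_num, l ++ [σ.reg 29], ?_, by simp⟩, fun hne => ⟨by norm_num, l, ?_, ?_⟩⟩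
  · have hx : σ.reg 29 ∉ l := fun hx => hne (by simpa using (g6 _).2 hx)
    refine ⟨by simp [g1]; ring, by simp [g2], ?_, ?_, ?_, fun x => ?_, fun x => ?_⟩
    · simp only [setReg_arr, setArr_arr, setReg_reg, setArr_reg, Nat.reduceEqDiff, if_true, if_false,
        OfNat.one_ne_ofNat]
      rw [holds_append, holds_cons, g1]
      refine ⟨g3.congr fun i _ hi => Function.update_of_ne (by omega) _ _, by simp, holds_nil _ _⟩
    · intro i hi
      simp only [setReg_arr, setArr_arr, setReg_reg, setArr_reg, Nat.reduceEqDiff, if_true, if_false,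
        OfNat.one_ne_ofNat]
      rw [Function.update_of_ne (by omega), g4 i hi]
    · exact List.nodup_append.2 ⟨g5, by simp, fun a ha b hb => by
        rintro rfl
        exact hx (by simpa using (List.mem_singleton.1 hb) ▸ ha)⟩
    · simp only [setReg_arr, setArr_arr, setReg_reg, setArr_reg, Nat.reduceEqDiff, if_true, if_false,
        OfNat.ofNat_ne_one, List.mem_append, List.mem_singleton, Function.update_apply]
      by_cases hxx : x = σ.reg 29
      · simp [hxx]
      · simp [hxx, g6]
    · simp only [setReg_arr, setArr_arr, setReg_reg, setArr_reg, Nat.reduceEqDiff, if_true, if_false,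
        OfNat.ofNat_ne_one, Function.update_apply]
      split_ifs
      · exact le_rfl
      · exact g7 x
  · exact Emitted.congr ⟨g1, g2, g3, g4, g5, g6, g7⟩ (by simp) (by simp) (by simp) (by simp) (by simp)
  · have hx : σ.reg 29 ∈ l := by
      rw [not_not] at hne
      exact (g6 _).1 (by simpa using hne)
    intro y
    refine ⟨.inl, fun hy => hy.elim id fun hy => hy ▸ hx⟩

/-- The vertices contributed to its facet by the dart `p`. -/
def Seen (G : DartData) (p x : ℕ) : Prop :=
  x = G.s p ∨ ∃ q ∈ G.L (G.s p), q ≠ p ∧ x = G.t q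

theorem wp_emitDart {f : ℕ → ℕ} {base : ℕ} {l : List ℕ} {G : DartData} (hG : G.InMem σ)
    (h0 : σ.reg 0 = 0) (h : Emitted f base l σ) :
    WP emitDart (fun t τ => t ≤ 11 * G.dg (G.s (σ.reg 31)) + 10 ∧ ∃ l', Emitted f base l' τ ∧
      ∀ y, y ∈ l' ↔ y ∈ l ∨ Seen G (σ.reg 31) y) σ := by
  have hG' := hG
  obtain ⟨hs, ht, hnx, hhd, hdg⟩ := hG
  rw [emitDart]
  simp only [wp_seq, wp_load, wp_copy]
  refine (wp_emit (f := f) (base := base) (l := l) ?_).frame.mono ?_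
  · exact h.congr (by simp) (by simp) (by simp) (by simp) (by simp)
  rintro s τ ⟨⟨hs1, l₁, h1, h2⟩, hr, ha⟩
  have a2 := ha 2 (by decide)
  have a3 := ha 3 (by decide)
  have a4 := ha 4 (by decide)
  have a5 := ha 5 (by decide)
  have r0 := hr 0 (by decide)
  have r31 := hr 31 (by decide)
  have r32 := hr 32 (by decide)
  simp only [setReg_arr, setReg_reg, Nat.reduceEqDiff, if_true, if_false, OfNat.zero_ne_ofNat, hs, ht,
    hnx, hhd] at a2 a3 a4 a5 r0 r31 r32 h2
  refine WP.mono (wp_forList (by decide) (G.L (G.s (σ.reg 31))) (fun L ρ => ρ.arr 3 = G.t ∧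
    ρ.reg 31 = σ.reg 31 ∧ ∃ l', Emitted f base l' ρ ∧ ∀ y, y ∈ l' ↔ y ∈ l ∨ y = G.s (σ.reg 31) ∨
      ∃ q ∈ L, q ≠ σ.reg 31 ∧ y = G.t q) (fun _ => 9) ?_ ?_ (by decide) (by decide) (by decide) ?_ ?_
    ?_) ?_
  · rintro L ρ v ⟨e1, e2, l', e3, e4⟩
    exact ⟨e1, by simpa using e2, l',
      e3.congr (by simp) (by simp) (by simp) (by simp) (by simp), e4⟩
  · rintro L v M ρ hl ⟨e1, e2, l', e3, e4⟩ hv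
    simp only [wp_ite, wp_seq, wp_load, wp_skip, Test.Holds]
    refine ⟨fun hne => ?_, fun hne => ⟨by norm_num, e1, e2, l', e3, fun y => ?_⟩⟩
    · refine (wp_emit (f := f) (base := base) (l := l')
        (e3.congr (by simp) (by simp) (by simp) (by simp) (by simp))).frame.mono ?_
      rintro s ρ' ⟨⟨hs', l'', e5, e6⟩, hr', ha'⟩
      refine ⟨by omega, (ha' 3 (by decide)).trans e1, ?_, l'', e5, fun y => ?_⟩
      · have := hr' 31 (by decide)
        simp at this
        rw [this, e2]
      · rw [hv, e2] at hne
        simp only [setReg_reg, if_true, e1, hv] at e6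
        rw [e6, e4]
        simp [or_and_right, exists_or, hne, or_assoc]
    · rw [hv, e2, not_not] at hne
      rw [e4]
      simp [or_and_right, exists_or, hne]
  · simp only [setReg_arr, setReg_reg, if_true, a4, a5, r32]
    exact G.chain _
  · simp [r0, h0]
  · exact ⟨a3, by simpa using r31, l₁, h1.congr (by simp) (by simp) (by simp) (by simp) (by simp),
      fun y => by simp [h2]⟩
  · rintro s' ρ ⟨hs', -, -, l', e3, e4⟩
    simp only [List.map_const', List.sum_replicate, smul_eq_mul, G.length_L] at hs'
    exact ⟨by omega, l', e3, e4⟩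

/-- The queue contains `qu`, and exactly its elements have been seen. -/
structure Queue (qu : List ℕ) (σ : Mem) : Prop where
  tail : σ.reg 25 = qu.length
  queue : Holds (σ.arr 12) 0 qu
  seen : ∀ x, σ.arr 13 x ≠ 0 ↔ x ∈ qu
  nodup : qu.Nodup

theorem Queue.congr {qu : List ℕ} {τ : Mem} (h : Queue qu σ) (h25 : τ.reg 25 = σ.reg 25)
    (h12 : τ.arr 12 = σ.arr 12) (h13 : τ.arr 13 = σ.arr 13) : Queue qu τ := by
  obtain ⟨g1, g2, g3, g4⟩ := h
  exact ⟨by rw [h25, g1], by rwa [h12], by rwa [h13], g4⟩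

theorem wp_push {qu : List ℕ} (h : Queue qu σ) (h0 : σ.reg 0 = 0) (h1 : σ.reg 36 = 1) :
    WP push (fun t τ => t ≤ 5 ∧ ∃ ext, Queue (qu ++ ext) τ ∧ (∀ y ∈ ext, y = σ.reg 35) ∧
      σ.reg 35 ∈ qu ++ ext) σ := by
  obtain ⟨g1, g2, g3, g4⟩ := h
  simp only [push, wp_seq, wp_load, wp_ite, wp_store, wp_succ, wp_skip, Test.Holds]
  refine ⟨fun he => ⟨by norm_num, [σ.reg 35], ?_, by simp, by simp⟩,
    fun he => ⟨by norm_num, [], ?_, by simp, ?_⟩⟩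
  · have hx : σ.reg 35 ∉ qu := fun hx => (g3 _).2 hx (by simpa [h0] using he)
    refine ⟨by simp [g1], ?_, fun x => ?_, ?_⟩
    · simp only [setReg_arr, setArr_arr, setReg_reg, setArr_reg, Nat.reduceEqDiff, if_true, if_false]
      rw [holds_append, holds_cons, g1]
      refine ⟨g2.congr fun i _ hi => Function.update_of_ne (by omega) _ _, by simp, holds_nil _ _⟩
    · simp only [setReg_arr, setArr_arr, setReg_reg, setArr_reg, Nat.reduceEqDiff, if_true, if_false,
        List.mem_append, List.mem_singleton, Function.update_apply]
      by_cases hxx : x = σ.reg 35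
      · simp [hxx, h1]
      · simp [hxx, ← g3]
    · exact List.nodup_append.2 ⟨g4, by simp, fun a ha b hb => by
        rintro rfl
        exact hx (by simpa using (List.mem_singleton.1 hb) ▸ ha)⟩
  · rw [List.append_nil]
    exact Queue.congr ⟨g1, g2, g3, g4⟩ (by simp) rfl rfl
  · rw [List.append_nil]
    exact (g3 _).1 (by simpa [h0] using he)

theorem wp_pushLinks {qu : List ℕ} {H : DartData} (hH : H.InLinks σ) (h : Queue qu σ)
    (h0 : σ.reg 0 = 0) (h1 : σ.reg 36 = 1) :
    WP pushLinks (fun t τ => t ≤ 8 * H.dg (σ.reg 31) + 2 ∧ ∃ ext, Queue (qu ++ ext) τ ∧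
      (∀ y ∈ ext, ∃ k ∈ H.L (σ.reg 31), y = H.t k) ∧ ∀ k ∈ H.L (σ.reg 31), H.t k ∈ qu ++ ext) σ := by
  obtain ⟨hs, ht, hnx, hhd⟩ := hH
  rw [pushLinks]
  simp only [wp_seq, wp_load]
  refine WP.mono (wp_forList (by decide) (H.L (σ.reg 31)) (fun L ρ => ρ.arr 9 = H.t ∧
    ρ.reg 0 = 0 ∧ ρ.reg 36 = 1 ∧ ∃ ext, Queue (qu ++ ext) ρ ∧ (∀ y ∈ ext, ∃ k ∈ L, y = H.t k) ∧
      ∀ k ∈ L, H.t k ∈ qu ++ ext) (fun _ => 6) ?_ ?_ (by decide) (by decide) (by decide) ?_ ?_ ?_) ?_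
  · rintro L ρ v ⟨e1, e2, e3, ext, e4, e5, e6⟩
    exact ⟨e1, by simpa using e2, by simpa using e3, ext, e4.congr (by simp) (by simp) (by simp), e5,
      e6⟩
  · rintro L v M ρ hl ⟨e1, e2, e3, ext, e4, e5, e6⟩ hv
    simp only [wp_seq, wp_load]
    refine (wp_push (qu := qu ++ ext) (e4.congr (by simp) (by simp) (by simp)) (by simpa using e2)
      (by simpa using e3)).frame.mono ?_
    rintro s ρ' ⟨⟨hs', ext', e7, e8, e9⟩, hr, ha⟩
    simp only [setReg_reg, if_true, e1, hv] at e8 e9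
    have r0 := hr 0 (by decide)
    have r36 := hr 36 (by decide)
    simp only [setReg_reg, Nat.reduceEqDiff, if_false, OfNat.zero_ne_ofNat] at r0 r36
    refine ⟨by omega, (ha 9 (by decide)).trans e1, r0.trans e2, r36.trans e3, ext ++ ext',
      by simpa using e7, fun y hy => ?_, fun k hk => ?_⟩
    · rcases List.mem_append.1 hy with hy | hy
      · obtain ⟨k, hk, rfl⟩ := e5 y hy
        exact ⟨k, by simp [hk], rfl⟩
      · exact ⟨v, by simp, e8 y hy⟩
    · rw [← List.append_assoc]
      rcases List.mem_append.1 hk with hk | hk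
      · exact List.mem_append_left _ (e6 k hk)
      · rw [List.mem_singleton.1 hk]
        exact e9
  · simp only [setReg_arr, setReg_reg, if_true, hnx, hhd]
    exact H.chain _
  · simpa using h0
  · exact ⟨ht, by simpa using h0, by simpa using h1, [],
      by simpa using h.congr (by simp) (by simp) (by simp), by simp, by simp⟩
  · rintro s' ρ ⟨hs', -, -, -, ext, e4, e5, e6⟩
    simp only [List.map_const', List.sum_replicate, smul_eq_mul, H.length_L] at hs'
    exact ⟨by omega, ext, e4, e5, e6⟩

end Search

/-! ### Correctness of the search -/

section Correctness

/-- A dart leaving a simple vertex. -/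
def GoodDart (G : DartData) (d p : ℕ) : Prop := 1 ≤ p ∧ p ≤ G.num ∧ G.dg (G.s p) = d

/-- The classes of darts with equal `fac` are the components of the link graph `H`. -/
structure Classes {α : Type*} (G H : DartData) (d : ℕ) (fac : ℕ → α) : Prop where
  step : ∀ p, GoodDart G d p → ∀ k ∈ H.L p, GoodDart G d (H.t k) ∧ fac (H.t k) = fac p
  closed : ∀ X : ℕ → Prop, (∀ p, X p → ∀ k ∈ H.L p, X (H.t k)) → ∀ p q, GoodDart G d p →
    GoodDart G d q → fac p = fac q → X p → X q

/-- The memory holds the darts `G`, the links `H` and the constants used in the search. -/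
structure SearchEnv (G H : DartData) (d : ℕ) (σ : Mem) : Prop where
  darts : G.InMem σ
  links : H.InLinks σ
  zero : σ.reg 0 = 0
  one : σ.reg 36 = 1
  dim : σ.reg 2 = d
  num : σ.reg 7 = G.num + 1

/-- The time set aside for processing the darts that are not in `qu`. -/
def potential (G H : DartData) (d : ℕ) (qu : List ℕ) : ℕ :=
  ∑ p ∈ Finset.Icc 1 G.num \ qu.toFinset, (11 * d + 8 * H.dg p + 15)

theorem potential_append {G H : DartData} {d : ℕ} {qu : List ℕ} {p : ℕ} (hp : GoodDart G d p)
    (hq : p ∉ qu) :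
    potential G H d (qu ++ [p]) + (11 * d + 8 * H.dg p + 15) = potential G H d qu := by
  have h1 : p ∈ Finset.Icc 1 G.num \ qu.toFinset := by
    simp [hp.1, hp.2.1, hq]
  rw [potential, potential, ← Finset.sum_erase_add _ _ h1]
  congr 2
  ext x
  simp only [List.toFinset_append, Finset.mem_sdiff, Finset.mem_union, List.mem_toFinset,
    List.mem_singleton, Finset.mem_erase, not_or]
  tauto

variable {α : Type*} {G H : DartData} {d : ℕ} {fac : ℕ → α} {σ : Mem}

theorem SearchEnv.congr {τ : Mem} (h : SearchEnv G H d σ) {R A : List ℕ}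
    (hr : ∀ x, x ∉ R → τ.reg x = σ.reg x) (ha : ∀ a, a ∉ A → τ.arr a = σ.arr a)
    (hR : ∀ x ∈ [0, 2, 7, 36], x ∉ R)
    (hA : ∀ a ∈ [2, 3, 4, 5, 6, 8, 9, 10, 11], a ∉ A) : SearchEnv G H d τ :=
  ⟨h.darts.congr (ha _ (hA _ (by decide))) (ha _ (hA _ (by decide))) (ha _ (hA _ (by decide)))
      (ha _ (hA _ (by decide))) (ha _ (hA _ (by decide))),
    h.links.congr (ha _ (hA _ (by decide))) (ha _ (hA _ (by decide))) (ha _ (hA _ (by decide)))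
      (ha _ (hA _ (by decide))),
    (hr _ (hR _ (by decide))).trans h.zero, (hr _ (hR _ (by decide))).trans h.one,
    (hr _ (hR _ (by decide))).trans h.dim, (hr _ (hR _ (by decide))).trans h.num⟩

/-- Starting from a queue whose only unprocessed element is `s`, the search processes exactly the
class of `s` and outputs the vertices contributed by its darts. -/
theorem wp_search (hC : Classes G H d fac) (hE : SearchEnv G H d σ) {quo : List ℕ} {s : ℕ}
    {f : ℕ → ℕ} {base : ℕ} (hs : GoodDart G d s) (hquo : ∀ p ∈ quo, fac p ≠ fac s)
    (hQ : Queue (quo ++ [s]) σ) (h24 : σ.reg 24 = quo.length) (hEm : Emitted f base [] σ) :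
    WP (.loop (.lt 24 25) pop) (fun t τ => ∃ qu l, Queue (quo ++ qu) τ ∧
      τ.reg 24 = (quo ++ qu).length ∧ t + potential G H d (quo ++ qu) ≤ potential G H d quo + 1 ∧
      Emitted f base l τ ∧ (∀ x, x ∈ l ↔ ∃ p ∈ qu, Seen G p x) ∧
      ∀ p, p ∈ qu ↔ GoodDart G d p ∧ fac p = fac s) σ := by
  -- the ghost state consists of the processed part of the class, the waiting part of the queue, and
  -- the vertices output so far
  refine WP.mono (wp_loop (G := List ℕ × List ℕ × List ℕ) (fun g τ => SearchEnv G H d τ ∧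
    τ.reg 24 = (quo ++ g.1).length ∧ Queue (quo ++ g.1 ++ g.2.1) τ ∧ Emitted f base g.2.2 τ ∧
    s ∈ g.1 ++ g.2.1 ∧
    (∀ p ∈ g.1 ++ g.2.1, GoodDart G d p ∧ fac p = fac s) ∧
    (∀ p ∈ g.1, ∀ k ∈ H.L p, H.t k ∈ quo ++ g.1 ++ g.2.1) ∧
    ∀ x, x ∈ g.2.2 ↔ ∃ p ∈ g.1, Seen G p x) (fun g => potential G H d (quo ++ g.1)) ?_
    (g := ([], [s], [])) ⟨hE, by simpa using h24, by simpa using hQ, hEm, by simp, by simpa using hs,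
      by simp, by simp⟩) ?_
  · rintro ⟨L, M, l⟩ τ ⟨h1, h2, h3, h4, h5, h6, h7, h8⟩ hb
    dsimp only [Test.Holds] at *
    cases M with
    | nil =>
      have := h3.tail
      rw [List.append_nil] at this
      omega
    | cons p M =>
      have hp : τ.arr 12 (τ.reg 24) = p := by
        have := (holds_append.1 h3.queue).2
        rw [holds_cons, zero_add, ← h2] at this
        exact this.1
      have hgood := h6 p (by simp)
      simp only [pop, wp_seq, wp_load, wp_succ]
      refine WP.mono (WP.frame (wp_emitDart (f := f) (base := base) (l := l) (G := G)
        (h1.darts.congr rfl rfl rfl rfl rfl) (by simpa using h1.zero)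
        (h4.congr (by simp) (by simp) (by simp) (by simp) (by simp)))) ?_
      rintro t1 ρ ⟨⟨ht1, l', e1, e2⟩, hr, ha⟩
      have r31 := hr 31 (by decide)
      have r24 := hr 24 (by decide)
      have r25 := hr 25 (by decide)
      simp only [setReg_reg, Nat.reduceEqDiff, if_true, if_false, hp] at r31 r24 r25 e2 ht1
      have hE1 : SearchEnv G H d ρ := by
        refine SearchEnv.congr (σ := (τ.setReg 31 (τ.arr 12 (τ.reg 24))).setReg 24
          ((τ.setReg 31 (τ.arr 12 (τ.reg 24))).reg 24 + 1)) ?_ hr ha (by decide) (by decide)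
        exact ⟨h1.darts.congr rfl rfl rfl rfl rfl, h1.links.congr rfl rfl rfl rfl,
          by simpa using h1.zero, by simpa using h1.one, by simpa using h1.dim, by simpa using h1.num⟩
      refine (wp_pushLinks (qu := quo ++ L ++ p :: M) hE1.links ?_ hE1.zero hE1.one).frame.mono ?_
      · exact h3.congr r25 (ha 12 (by decide)) (ha 13 (by decide))
      rintro t2 ρ' ⟨⟨ht2, ext, e3, e4, e5⟩, hr', ha'⟩
      rw [r31] at e4 e5 ht2
      have hassoc : quo ++ L ++ p :: M ++ ext = quo ++ (L ++ [p]) ++ (M ++ ext) := by simp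
      have hpn : p ∉ quo ++ L := fun h => by
        have := h3.nodup
        rw [List.nodup_append] at this
        exact this.2.2 p h p (by simp) rfl
      refine ⟨(L ++ [p], M ++ ext, l'), ⟨hE1.congr hr' ha' (by decide) (by decide), ?_, ?_, ?_, ?_, ?_,
        ?_, ?_⟩, ?_⟩
      · dsimp only
        rw [hr' 24 (by decide), r24, h2]
        simp [add_assoc]
      · rw [hassoc] at e3
        exact e3
      · exact e1.congr (hr' _ (by decide)) (hr' _ (by decide)) (hr' _ (by decide)) (ha' _ (by decide))
          (ha' _ (by decide))
      · simp only [List.mem_append, List.mem_cons] at h5 ⊢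
        tauto
      · intro q hq
        have : q ∈ L ++ p :: M ∨ q ∈ ext := by
          simp only [List.mem_append, List.mem_cons] at hq ⊢
          tauto
        rcases this with hq | hq
        · exact h6 q hq
        · obtain ⟨k, hk, rfl⟩ := e4 q hq
          have := hC.step p hgood.1 k hk
          exact ⟨this.1, this.2.trans hgood.2⟩
      · intro q hq k hk
        dsimp only at hq ⊢
        rw [← hassoc]
        rcases List.mem_append.1 hq with hq | hq
        · exact List.mem_append_left _ (h7 q hq k hk)
        · rw [List.mem_singleton.1 hq] at hk
          exact e5 k hk
      · intro x
        rw [e2, h8]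
        simp [or_and_right, exists_or]
      · dsimp only
        rw [← List.append_assoc, ← potential_append hgood.1 hpn]
        rw [hgood.1.2.2] at ht1
        omega
  · rintro t τ ⟨⟨L, M, l⟩, ⟨h1, h2, h3, h4, h5, h6, h7, h8⟩, hb, ht⟩
    dsimp only [Test.Holds] at *
    have hM : M = [] := by
      rw [h2, h3.tail, List.length_append (bs := M)] at hb
      exact List.length_eq_zero_iff.1 (by omega)
    subst hM
    simp only [List.append_nil] at h3 h5 h6 h7 ht
    refine ⟨L, l, h3, h2, by omega, h4, h8, fun p => ⟨h6 p, fun hp => ?_⟩⟩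
    refine hC.closed (fun p => p ∈ L) (fun q hq k hk => ?_) s p hs hp.1 hp.2.symm h5
    have h9 := h7 q hq k hk
    have h10 := hC.step q (h6 q hq).1 k hk
    exact (List.mem_append.1 h9).resolve_left fun h =>
      hquo _ h (h10.2.trans (h6 q hq).2)

/-- The vertices of the facet `F` have been listed without repetition in `l`. -/
def Lists (G : DartData) (d : ℕ) (fac : ℕ → α) (F : α) (l : List ℕ) : Prop :=
  l.Nodup ∧ (∀ x, x ∈ l ↔ ∃ p, GoodDart G d p ∧ fac p = F ∧ Seen G p x) ∧
    ∃ p, GoodDart G d p ∧ fac p = F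

/-- The facets `labs` have been processed, their vertices have been written as the lists `outs`, and
`qu` consists of their darts. -/
structure Written (G H : DartData) (d : ℕ) (fac : ℕ → α) (labs : List α) (outs : List (List ℕ))
    (qu : List ℕ) (σ : Mem) : Prop where
  env : SearchEnv G H d σ
  head : σ.reg 24 = qu.length
  queue : Queue qu σ
  good : ∀ p ∈ qu, GoodDart G d p
  mem_queue : ∀ p, GoodDart G d p → (p ∈ qu ↔ fac p ∈ labs)
  nodup : labs.Nodup
  lists : List.Forall₂ (Lists G d fac) labs outs
  count : σ.reg 22 = outs.length
  out : Holds (σ.arr 1) 1 (outs.flatMap fun l => l.length :: l)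
  pos : σ.reg 23 = 1 + (outs.flatMap fun l => l.length :: l).length
  stamp_le : ∀ x, σ.arr 14 x ≤ σ.reg 22

theorem Written.congr {labs : List α} {outs : List (List ℕ)} {qu : List ℕ} {τ : Mem}
    (h : Written G H d fac labs outs qu σ) {R : List ℕ}
    (hr : ∀ x, x ∉ R → τ.reg x = σ.reg x) (ha : τ.arr = σ.arr)
    (hR : ∀ x ∈ [0, 2, 7, 22, 23, 24, 25, 36], x ∉ R) :
    Written G H d fac labs outs qu τ := by
  obtain ⟨g1, g2, g3, g4, g5, g6, g7, g8, g9, g10, g11⟩ := h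
  refine ⟨g1.congr hr (A := []) (fun a _ => by rw [ha]) ?_ (by decide), ?_, ?_, g4, g5, g6, g7, ?_,
    ?_, ?_, ?_⟩
  · intro x hx
    exact hR x (by revert x; decide)
  · rw [hr _ (hR _ (by decide)), g2]
  · exact g3.congr (hr _ (hR _ (by decide))) (by rw [ha]) (by rw [ha])
  · rw [hr _ (hR _ (by decide)), g8]
  · rwa [ha]
  · rw [hr _ (hR _ (by decide)), g10]
  · rwa [ha, hr _ (hR _ (by decide))]

/-- An unseen dart `s` with a simple source starts a new facet, since all darts of the facets written
before have been seen. -/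
theorem wp_newFacet (hC : Classes G H d fac) {labs : List α} {outs : List (List ℕ)} {qu : List ℕ}
    (hW : Written G H d fac labs outs qu σ) {s : ℕ} (h26 : σ.reg 26 = s) (hs : GoodDart G d s)
    (hsq : s ∉ qu) :
    WP newFacet (fun t τ => ∃ l qu', Written G H d fac (labs ++ [fac s]) (outs ++ [l]) qu' τ ∧
      t + potential G H d qu' ≤ potential G H d qu + 12) σ := by
  obtain ⟨g1, g2, g3, g4, g5, g6, g7, g8, g9, g10, g11⟩ := hW
  have hF : fac s ∉ labs := fun h => hsq ((g5 s hs).2 h)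
  simp only [newFacet, wp_seq, wp_succ, wp_copy, wp_const]
  refine WP.mono (WP.frame (wp_push (qu := qu) (g3.congr (by simp) rfl rfl)
    (by simpa using g1.zero) (by simpa using g1.one))) ?_
  rintro t1 τ ⟨⟨ht1, ext, e1, e2, e3⟩, hr, ha⟩
  simp only [setReg_reg, Nat.reduceEqDiff, if_true, if_false, h26] at e2 e3
  have hext : ext = [s] := by
    have hmem : s ∈ ext := (List.mem_append.1 e3).resolve_left hsq
    have hn := (List.nodup_append.1 e1.nodup).2.1
    cases ext with
    | nil => simp at hmem
    | cons a ext =>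
      have ha := e2 a (by simp)
      cases ext with
      | nil => rw [ha]
      | cons b ext =>
        have hb := e2 b (by simp)
        subst ha
        simp [hb] at hn
  subst hext
  have r22 := hr 22 (by decide)
  have r23 := hr 23 (by decide)
  have r24 := hr 24 (by decide)
  have r27 := hr 27 (by decide)
  have r28 := hr 28 (by decide)
  simp only [setReg_reg, Nat.reduceEqDiff, if_true, if_false] at r22 r23 r24 r27 r28
  simp only [setReg_arr] at ha
  have hE1 : SearchEnv G H d τ := by
    refine SearchEnv.congr ?_ hr ha (by decide) (by decide)
    exact ⟨g1.darts.congr rfl rfl rfl rfl rfl, g1.links.congr rfl rfl rfl rfl,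
      by simpa using g1.zero, by simpa using g1.one, by simpa using g1.dim, by simpa using g1.num⟩
  refine (wp_search (f := σ.arr 1) (base := σ.reg 23) hC hE1 (quo := qu) hs (fun p hp h => hF ?_) e1
    (r24.trans g2) ⟨by rw [r23]; rfl, r28, holds_nil _ _, fun i _ => by rw [ha 1 (by decide)],
      List.nodup_nil, fun x => ?_, fun x => ?_⟩).frame.mono ?_
  · rw [← h]
    exact (g5 p (g4 p hp)).1 hp
  · rw [ha 14 (by decide), r22]
    have := g11 x
    simp only [List.not_mem_nil, iff_false]
    omega
  · rw [ha 14 (by decide), r22]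
    have := g11 x
    omega
  rintro t2 ρ ⟨⟨qu', l, e4, e5, e6, e7, e8, e9⟩, hr', ha'⟩
  have r22' := (hr' 22 (by decide)).trans r22
  have r27' := (hr' 27 (by decide)).trans r27
  have hlists : Lists G d fac (fac s) l := by
    refine ⟨e7.nodup, fun x => ?_, s, hs, rfl⟩
    rw [e8]
    simp only [e9, and_assoc]
  rw [wp_store]
  refine ⟨l, qu ++ qu', ⟨?_, ?_, ?_, ?_, ?_, ?_, ?_, ?_, ?_, ?_, ?_⟩, by omega⟩
  · exact (hE1.congr hr' ha' (by decide) (by decide)).congr (R := []) (A := [1]) (fun _ _ => rfl)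
      (fun a ha => by simp at ha; simp [ha]) (by decide) (by decide)
  · exact e5
  · exact e4.congr rfl (by simp) (by simp)
  · intro p hp
    exact (List.mem_append.1 hp).elim (g4 p) fun h => ((e9 p).1 h).1
  · intro p hp
    rw [List.mem_append, List.mem_append, g5 p hp, e9, List.mem_singleton]
    simp [hp]
  · exact List.nodup_append.2 ⟨g6, by simp, fun a ha b hb => by
      rintro rfl
      exact hF ((List.mem_singleton.1 hb) ▸ ha)⟩
  · exact List.rel_append g7 (.cons hlists .nil)
  · simp only [setArr_reg, r22', g8, List.length_append, List.length_singleton]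
  · simp only [setArr_arr, if_true, r27', List.flatMap_append, List.flatMap_cons, List.flatMap_nil,
      List.append_nil, e7.count]
    rw [holds_append, ← g10, holds_cons]
    refine ⟨g9.congr fun i _ hi => ?_, by simp, e7.out.congr fun i hi _ =>
      Function.update_of_ne (by omega) _ _⟩
    rw [Function.update_of_ne (by omega), e7.out_le i (by omega)]
  · simp only [setArr_reg, e7.pos, List.flatMap_append, List.flatMap_cons, List.flatMap_nil,
      List.append_nil, List.length_append, List.length_cons]
    omega
  · intro x
    simpa using e7.stamp_le x

theorem wp_writeFacets (hC : Classes G H d fac) (hG : G.InMem σ) (hH : H.InLinks σ)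
    (h0 : σ.reg 0 = 0) (h2 : σ.reg 2 = d) (h7 : σ.reg 7 = G.num + 1) (h22 : σ.reg 22 = 0)
    (h24 : σ.reg 24 = 0) (h25 : σ.reg 25 = 0) (h13 : ∀ x, σ.arr 13 x = 0)
    (h14 : ∀ x, σ.arr 14 x = 0) :
    WP writeFacets (fun t τ => t ≤ 20 * G.num + potential G H d [] + 5 ∧ ∃ labs outs,
      labs.Nodup ∧ List.Forall₂ (Lists G d fac) labs outs ∧
      (∀ p, GoodDart G d p → fac p ∈ labs) ∧
      Holds (τ.arr 1) 0 (outs.length :: outs.flatMap fun l => l.length :: l)) σ := by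
  simp only [writeFacets, wp_seq, wp_const]
  -- the ghost state consists of the current dart, the facets written, their lists, and the queue; the
  -- potential pays a constant for each dart still to be visited, and for its processing if it is unseen
  refine WP.mono (wp_loop (G := ℕ × List α × List (List ℕ) × List ℕ) (fun g τ =>
    Written G H d fac g.2.1 g.2.2.1 g.2.2.2 τ ∧ τ.reg 26 = g.1 ∧ 1 ≤ g.1 ∧ g.1 ≤ G.num + 1 ∧
    ∀ p, GoodDart G d p → p < g.1 → fac p ∈ g.2.1)
    (fun g => 20 * (G.num + 1 - g.1) + potential G H d g.2.2.2) ?_ (g := (1, [], [], []))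
    ⟨⟨?_, ?_, ?_, by simp, by simp, by simp, by simp, ?_, by simp [holds_nil], by simp, ?_⟩, by simp,
      le_rfl, by simp, fun p hp h => by have := hp.1; omega⟩) ?_
  · rintro ⟨s, labs, outs, qu⟩ τ ⟨hW, hs26, hs1, hsn, hall⟩ hb
    dsimp only [Test.Holds] at *
    rw [hs26, hW.env.num] at hb
    simp only [wp_load, wp_seq, wp_ite, wp_skip, wp_succ, Test.Holds]
    have hW' : ∀ a b c : ℕ, Written G H d fac labs outs qu
        (((τ.setReg 32 a).setReg 30 b).setReg 30 c) := fun a b c =>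
      hW.congr (R := [30, 32]) (fun x hx => by
        simp only [List.mem_cons, List.not_mem_nil, or_false, not_or] at hx
        simp [hx.1, hx.2]) rfl (by decide)
    have hW'' : ∀ a b : ℕ, Written G H d fac labs outs qu ((τ.setReg 32 a).setReg 30 b) := fun a b =>
      hW.congr (R := [30, 32]) (fun x hx => by
        simp only [List.mem_cons, List.not_mem_nil, or_false, not_or] at hx
        simp [hx.1, hx.2]) rfl (by decide)
    have h26 : ∀ (ρ : Mem) (l : List α) (o : List (List ℕ)) (q : List ℕ) (v : ℕ),
        Written G H d fac l o q ρ → Written G H d fac l o q (ρ.setReg 26 v) := fun ρ l o q v h =>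
      h.congr (R := [26]) (fun x hx => by
        simp only [List.mem_cons, List.not_mem_nil, or_false] at hx
        simp [hx]) rfl (by decide)
    have hstep : ∀ p, GoodDart G d p → p < s + 1 → (GoodDart G d s → fac s ∈ labs) →
        fac p ∈ labs := fun p hp hlt h => by
      rcases Nat.lt_succ_iff_lt_or_eq.1 hlt with h' | rfl
      · exact hall p hp h'
      · exact h hp
    refine ⟨fun hd => ⟨fun hsee => ?_, fun hsee => ?_⟩, fun hd => ?_⟩
    · simp only [setReg_reg, setReg_arr, Nat.reduceEqDiff, if_true, if_false, hs26, hW.env.darts.s_eq,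
        hW.env.darts.dg_eq, hW.env.dim, hW.env.zero, OfNat.zero_ne_ofNat] at hd hsee
      have hsg : GoodDart G d s := ⟨hs1, by omega, hd⟩
      have hsq : s ∉ qu := fun h => (hW.queue.seen s).2 h hsee
      refine (wp_newFacet hC (hW' _ _ _) (s := s) (by simpa using hs26) hsg hsq).frame.mono ?_
      rintro t ρ ⟨⟨l, qu', hW₁, ht⟩, hr, -⟩
      have r26 := hr 26 (by decide)
      simp only [setReg_reg, Nat.reduceEqDiff, if_false] at r26
      refine ⟨(s + 1, labs ++ [fac s], outs ++ [l], qu'), ⟨h26 _ _ _ _ _ hW₁, ?_, by omega, by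
        simp only; omega, fun p hp hlt => ?_⟩, ?_⟩
      · simp [r26, hs26]
      · rw [List.mem_append, List.mem_singleton]
        rcases Nat.lt_succ_iff_lt_or_eq.1 hlt with h' | rfl
        · exact .inl (hall p hp h')
        · exact .inr rfl
      · dsimp only
        omega
    · simp only [setReg_reg, setReg_arr, Nat.reduceEqDiff, if_true, if_false, hs26, hW.env.darts.s_eq,
        hW.env.darts.dg_eq, hW.env.dim, hW.env.zero, OfNat.zero_ne_ofNat] at hd hsee
      refine ⟨(s + 1, labs, outs, qu), ⟨h26 _ _ _ _ _ (hW' _ _ _), by simp [hs26], by omega, by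
        simp only; omega, fun p hp hlt => hstep p hp hlt fun hg => ?_⟩, ?_⟩
      · exact (hW.mem_queue s hg).1 ((hW.queue.seen s).1 hsee)
      · dsimp only
        omega
    · simp only [setReg_reg, setReg_arr, Nat.reduceEqDiff, if_true, if_false, hs26, hW.env.darts.s_eq,
        hW.env.darts.dg_eq, hW.env.dim] at hd
      refine ⟨(s + 1, labs, outs, qu), ⟨h26 _ _ _ _ _ (hW'' _ _), by simp [hs26], by omega, by
        simp only; omega, fun p hp hlt => hstep p hp hlt fun hg => absurd hg.2.2 hd⟩, ?_⟩
      dsimp only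
      omega
  · exact ⟨hG.congr rfl rfl rfl rfl rfl, hH.congr rfl rfl rfl rfl, by simpa using h0, by simp,
      by simpa using h2, by simpa using h7⟩
  · simpa using h24
  · exact ⟨by simpa using h25, holds_nil _ _, fun x => by simp [h13], List.nodup_nil⟩
  · simpa using h22
  · intro x
    simp [h14]
  · rintro t τ ⟨⟨s, labs, outs, qu⟩, ⟨hW, hs26, hs1, hsn, hall⟩, hb, ht⟩
    dsimp only [Test.Holds] at *
    rw [hs26, hW.env.num] at hb
    rw [wp_store]
    refine ⟨by omega, labs, outs, hW.nodup, hW.lists, fun p hp => hall p hp ?_, ?_⟩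
    · have := hp.2.1
      omega
    · simp only [setArr_arr, if_true, hW.env.zero]
      rw [holds_cons]
      refine ⟨by simp [hW.count], hW.out.congr fun i hi _ => Function.update_of_ne (by omega) _ _⟩

end Correctness

/-! ### The whole program -/

section Whole

/-- The darts of `G` are the pairs in `D`, numbered from `1` on. -/
def DartData.Lists (G : DartData) (D : List (ℕ × ℕ)) : Prop :=
  G.num = D.length ∧ ∀ i (hi : i < D.length), G.s (i + 1) = D[i].1 ∧ G.t (i + 1) = D[i].2

/-- The darts of `H` are the links between the darts of `G` along the 2-faces in `fs`. -/
def IsLinkGraph (G H : DartData) (d : ℕ) (fs : List (List ℕ)) : Prop :=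
  ∀ p r, (∃ k ∈ H.L p, H.t k = r) ↔ ∃ S ∈ fs, ∃ v ∈ S, LinkAt G d (fun x => x ∈ S) v (p, r)

theorem DartData.sum_dg_le (G : DartData) (A : Finset ℕ) : ∑ v ∈ A, G.dg v ≤ G.num := by
  have h : ∀ v, G.dg v = (G.L v).toFinset.card := fun v => by
    rw [List.toFinset_card_of_nodup (G.nodup v), G.length_L]
  simp only [h]
  rw [← Finset.card_biUnion]
  · refine (Finset.card_le_card (t := Finset.Icc 1 G.num) fun p hp => ?_).trans (by simp)
    simp only [Finset.mem_biUnion, List.mem_toFinset, G.mem_L] at hp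
    obtain ⟨v, -, h1, h2, -⟩ := hp
    exact Finset.mem_Icc.2 ⟨h1, h2⟩
  · intro v _ w _ hvw
    refine Finset.disjoint_left.2 fun p hp hq => hvw ?_
    rw [List.mem_toFinset, G.mem_L] at hp hq
    exact hp.2.2.symm.trans hq.2.2

theorem potential_nil_le (G H : DartData) (d : ℕ) :
    potential G H d [] ≤ (11 * d + 15) * G.num + 8 * H.num := by
  have h1 := H.sum_dg_le (Finset.Icc 1 G.num)
  simp only [potential, List.toFinset_nil, Finset.sdiff_empty, Finset.sum_add_distrib,
    Finset.sum_const, Nat.card_Icc, smul_eq_mul, Nat.add_sub_cancel, ← Finset.mul_sum]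
  linarith [mul_comm G.num (11 * d), mul_comm G.num 15, add_mul (11 * d) 15 G.num]

theorem Table.exists_dartData {D : List (ℕ × ℕ)} {σ : Mem} (h : Links D σ) :
    ∃ H : DartData, H.InLinks σ ∧ H.num = D.length ∧
      ∀ p r, (∃ k ∈ H.L p, H.t k = r) ↔ (p, r) ∈ D := by
  choose L hL hn hm using h.chain
  refine ⟨⟨σ.arr 8, σ.arr 9, σ.arr 10, σ.arr 11, fun v => (L v).length, D.length, L, hL, hn,
    fun v p => hm v p, fun v => rfl⟩, ⟨rfl, rfl, rfl, rfl⟩, rfl, fun p r => ?_⟩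
  simp only [hm, List.mem_iff_getElem]
  constructor
  · rintro ⟨k, ⟨h1, h2, h3⟩, h4⟩
    obtain ⟨i, rfl⟩ : ∃ i, k = i + 1 := ⟨k - 1, by omega⟩
    have := h.pair i (by omega)
    exact ⟨i, by omega, Prod.ext (this.1.symm.trans h3) (this.2.symm.trans h4)⟩
  · rintro ⟨i, hi, h1⟩
    have := h.pair i hi
    rw [h1] at this
    exact ⟨i + 1, ⟨by omega, by omega, this.1⟩, this.2⟩

/-- The program that finds the facets from the 2-skeleton. -/
def findFacets (d : ℕ) : Prog := .seq (readEdges d) <| .seq readFaces writeFacets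

theorem wp_findFacets {α : Type*} (d n : ℕ) (es : List (ℕ × ℕ)) (fs : List (List ℕ)) (w : List ℕ)
    (hw : w = n :: es.length :: (es.flatMap (fun e => [2, e.1, e.2]) ++
      (fs.length :: fs.flatMap fun S => S.length :: S)))
    (fac : DartData → ℕ → α) (hfac : ∀ G H : DartData, G.Lists (dartsOf es) →
      IsLinkGraph G H d fs → Classes G H d (fac G)) :
    WP (findFacets d) (fun t τ =>
      t ≤ (22 * d + 95) * es.length + 9 * (linkCost d + 9) * size fs + 15 ∧
      ∃ G labs outs, G.Lists (dartsOf es) ∧ labs.Nodup ∧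
        List.Forall₂ (Lists G d (fac G)) labs outs ∧
        (∀ p, GoodDart G d p → fac G p ∈ labs) ∧
        Holds (τ.arr 1) 0 (outs.length :: outs.flatMap fun l => l.length :: l)) (initMem w) := by
  simp only [findFacets, wp_seq]
  refine WP.mono (WP.frame (wp_readEdges d n es _ w hw)) ?_
  rintro t1 σ ⟨⟨ht1, hD, h2, hS⟩, hr, ha⟩
  obtain ⟨G, hG, hnum, hst⟩ := hD.exists_dartData
  -- `readEdges d` writes the same registers and arrays for all `d`
  have hreg : ∀ x, x ∉ (readEdges 0).regs → σ.reg x = 0 := fun x hx => hr x hx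
  have harr : ∀ a, a ≠ 0 → a ∉ (readEdges 0).arrs → ∀ x, σ.arr a x = 0 := fun a ha0 hx x => by
    rw [ha a hx]
    simp [initMem, ha0]
  refine WP.mono (WP.frame (wp_readFaces hS hG (hreg 0 (by decide)) h2 (hreg 10 (by decide))
    (harr 7 (by decide) (by decide)) (harr 11 (by decide) (by decide)))) ?_
  rintro t2 τ ⟨⟨ht2, D, hL, hmem, hlen⟩, hr', ha'⟩
  obtain ⟨H, hH, hHn, hHL⟩ := hL.exists_dartData
  have hG' : G.InMem τ := hG.congr (ha' _ (by decide)) (ha' _ (by decide)) (ha' _ (by decide))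
    (ha' _ (by decide)) (ha' _ (by decide))
  have hC : Classes G H d (fac G) :=
    hfac G H ⟨hnum, hst⟩ fun p r => (hHL p r).trans (hmem (p, r))
  have hreg' : ∀ x, x ∉ readFaces.regs → x ∉ (readEdges 0).regs → τ.reg x = 0 := fun x h1 h2 =>
    (hr' x h1).trans (hreg x h2)
  have harr' : ∀ a, a ≠ 0 → a ∉ (readEdges 0).arrs → a ∉ readFaces.arrs → ∀ x, τ.arr a x = 0 :=
    fun a h1 h2 h3 x => by rw [ha' a h3, harr a h1 h2]
  have h7 : τ.reg 7 = G.num + 1 := by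
    rw [hr' 7 (by decide), hnum, hD.table.reg_eq]
  refine WP.mono (wp_writeFacets hC hG' hH (hreg' 0 (by decide) (by decide))
    ((hr' 2 (by decide)).trans h2) h7 (hreg' 22 (by decide) (by decide))
    (hreg' 24 (by decide) (by decide)) (hreg' 25 (by decide) (by decide))
    (harr' 13 (by decide) (by decide) (by decide)) (harr' 14 (by decide) (by decide) (by decide))) ?_
  rintro t3 ρ ⟨ht3, labs, outs, h1, h3, h4, h5⟩
  refine ⟨?_, G, labs, outs, ⟨hnum, hst⟩, h1, h3, h4, h5⟩
  have hm : G.num = 2 * es.length := by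
    rw [hnum]
    clear hw hfac ht1 hD hnum hst
    induction es with
    | nil => rfl
    | cons e es ih =>
      simp only [dartsOf, List.flatMap_cons, List.length_append, List.length_cons,
        List.length_nil] at ih ⊢
      omega
  have hpot := potential_nil_le G H d
  rw [hHn, hm] at hpot
  rw [hm] at ht3
  have e1 : (11 * d + 15) * (2 * es.length) = (22 * d + 30) * es.length := by ring
  have e2 : (22 * d + 95) * es.length = (22 * d + 30) * es.length + 65 * es.length := by ring
  have e3 : 9 * (linkCost d + 9) * size fs = 9 * ((linkCost d + 9) * size fs) := by ring
  omega

end Whole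

/-! ### The darts of a polytope -/

section Representation

open VertexConfig

/-- The dart `p` of `G` leads from `a` to `b`. -/
def DartData.IsDart (G : DartData) (p a b : ℕ) : Prop := 1 ≤ p ∧ p ≤ G.num ∧ G.s p = a ∧ G.t p = b

variable {n d : ℕ} {W : Type*} [AddCommGroup W] [Module ℝ W] [FiniteDimensional ℝ W]

/-- The digraph `G` has, for every ordered pair of adjacent vertices, exactly one dart. -/
structure Represents (G : DartData) (C : VertexConfig (Fin n) W) : Prop where
  exists_nbr : ∀ p, 1 ≤ p → p ≤ G.num → ∃ a b : Fin n, G.IsDart p a b ∧ b ∈ C.nbr a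
  exists_dart : ∀ a b : Fin n, b ∈ C.nbr a → ∃ p, G.IsDart p a b
  unique : ∀ p q a b, G.IsDart p a b → G.IsDart q a b → p = q

variable {G H : DartData} {C : VertexConfig (Fin n) W}

theorem represents_of_nodup {D : List (ℕ × ℕ)} (hG : G.Lists D) (hD : D.Nodup)
    (hmem : ∀ e, e ∈ D ↔ ∃ a b : Fin n, b ∈ C.nbr a ∧ e = (a.val, b.val)) : Represents G C := by
  obtain ⟨hnum, hst⟩ := hG
  refine ⟨fun p h1 h2 => ?_, fun a b hab => ?_, ?_⟩
  · obtain ⟨i, rfl⟩ : ∃ i, p = i + 1 := ⟨p - 1, by omega⟩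
    have hi : i < D.length := by omega
    obtain ⟨a, b, hab, he⟩ := (hmem _).1 (D.getElem_mem hi)
    have := hst i hi
    rw [he] at this
    exact ⟨a, b, ⟨h1, h2, this.1, this.2⟩, hab⟩
  · obtain ⟨i, hi, he⟩ := List.mem_iff_getElem.1 ((hmem (a.val, b.val)).2 ⟨a, b, hab, rfl⟩)
    have := hst i hi
    rw [he] at this
    exact ⟨i + 1, by omega, by omega, this.1, this.2⟩
  · rintro p q a b ⟨h1, h2, h3, h4⟩ ⟨g1, g2, g3, g4⟩
    obtain ⟨i, rfl⟩ : ∃ i, p = i + 1 := ⟨p - 1, by omega⟩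
    obtain ⟨j, rfl⟩ : ∃ j, q = j + 1 := ⟨q - 1, by omega⟩
    have hi := hst i (by omega)
    have hj := hst j (by omega)
    have he : D[i] = D[j] := Prod.ext (by rw [← hi.1, ← hj.1, h3, g3])
      (by rw [← hi.2, ← hj.2, h4, g4])
    rw [hD.getElem_inj_iff.1 he]

theorem DartData.isDart_iff_mem_L {p a b : ℕ} : G.IsDart p a b ↔ p ∈ G.L a ∧ G.t p = b := by
  rw [G.mem_L, IsDart]
  tauto

namespace Represents

theorem mem_nbr (h : Represents G C) {p : ℕ} {a b : Fin n} (hp : G.IsDart p a b) : b ∈ C.nbr a := by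
  obtain ⟨a', b', hp', hab⟩ := h.exists_nbr p hp.1 hp.2.1
  rwa [Fin.ext (hp.2.2.1.symm.trans hp'.2.2.1), Fin.ext (hp.2.2.2.symm.trans hp'.2.2.2)]

theorem exists_isDart (h : Represents G C) {p : ℕ} {a : Fin n} (hp : p ∈ G.L a) :
    ∃ b : Fin n, G.IsDart p a b := by
  rw [G.mem_L] at hp
  obtain ⟨a', b, hp', -⟩ := h.exists_nbr p hp.1 hp.2.1
  exact ⟨b, hp.1, hp.2.1, hp.2.2, hp'.2.2.2⟩

/-- The degree of a vertex is the number of its neighbours. -/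
theorem dg_eq (h : Represents G C) (a : Fin n) : G.dg a = (C.nbr a).card := by
  have : Nonempty (Fin n) := ⟨a⟩
  rw [← G.length_L, ← List.toFinset_card_of_nodup (G.nodup _)]
  choose! f hf using fun p (hp : p ∈ G.L a) => h.exists_isDart hp
  refine Finset.card_bij (fun p _ => f p) (fun p hp => ?_) (fun p hp q hq hpq => ?_)
    fun b hb => ?_
  · exact h.mem_nbr (hf p (List.mem_toFinset.1 hp))
  · have h1 := hf p (List.mem_toFinset.1 hp)
    have h2 := hf q (List.mem_toFinset.1 hq)
    exact h.unique p q _ _ h1 ((congrArg Fin.val hpq) ▸ h2)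
  · obtain ⟨p, hp⟩ := h.exists_dart a b hb
    have hpL := (DartData.isDart_iff_mem_L.1 hp).1
    refine ⟨p, List.mem_toFinset.2 hpL, Fin.ext ?_⟩
    exact (hf p hpL).2.2.2.symm.trans hp.2.2.2

theorem simple_iff (h : Represents G C) (hr : C.rank = d + 1) (a : Fin n) :
    G.dg a = d ↔ C.Simple a := by
  rw [h.dg_eq, Simple, hr, Nat.add_right_cancel_iff]

theorem goodDart_iff (h : Represents G C) (hr : C.rank = d + 1) {p : ℕ} :
    GoodDart G d p ↔ ∃ a b : Fin n, G.IsDart p a b ∧ C.Simple a := by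
  constructor
  · rintro ⟨h1, h2, h3⟩
    obtain ⟨a, b, hp, -⟩ := h.exists_nbr p h1 h2
    rw [hp.2.2.1, h.simple_iff hr] at h3
    exact ⟨a, b, hp, h3⟩
  · rintro ⟨a, b, hp, ha⟩
    refine ⟨hp.1, hp.2.1, ?_⟩
    rwa [hp.2.2.1, h.simple_iff hr]

/-- The links produced by the program are those of the polytope. -/
theorem exists_link_iff (h : Represents G C) (hr : C.rank = d + 1) {faces : List (List (Fin n))}
    (hf : ∀ S : Finset (Fin n), S ∈ faces.map List.toFinset ↔ IsFace C.pt S ∧ rk C.pt S = 3)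
    (hH : IsLinkGraph G H d (faces.map (List.map Fin.val))) {p r : ℕ} :
    (∃ k ∈ H.L p, H.t k = r) ↔
      ∃ v u v' u' : Fin n, G.IsDart p v u ∧ G.IsDart r v' u' ∧ C.Linked v u v' u' := by
  rw [hH]
  constructor
  · rintro ⟨S, hS, v, hv, hdv, p', hp, hpS, q, hq, hqp, hqS, hdq, r', hrr, hrv, hrS, he⟩
    obtain ⟨rfl, rfl⟩ := Prod.ext_iff.1 he
    obtain ⟨R, hR, rfl⟩ := List.mem_map.1 hS
    obtain ⟨v, hvR, rfl⟩ := List.mem_map.1 hv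
    obtain ⟨hRf, hR3⟩ := (hf R.toFinset).1 (List.mem_map_of_mem hR)
    have hmemR : ∀ x : Fin n, x.val ∈ R.map Fin.val → x ∈ R.toFinset := fun x hx => by
      obtain ⟨y, hy, hyx⟩ := List.mem_map.1 hx
      rw [← Fin.ext hyx]
      exact List.mem_toFinset.2 hy
    obtain ⟨u, hpu⟩ := h.exists_isDart hp
    obtain ⟨v', hqv⟩ := h.exists_isDart hq
    rw [hqv.2.2.2] at hqS hdq hrr
    rw [hpu.2.2.2] at hpS
    obtain ⟨u', hru⟩ := h.exists_isDart hrr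
    rw [hru.2.2.2] at hrv hrS
    refine ⟨v, u, v', u', hpu, hru, (h.simple_iff hr v).1 hdv, (h.simple_iff hr v').1 hdq,
      h.mem_nbr hpu, h.mem_nbr hqv, ?_, h.mem_nbr hru, fun huv => hrv (congrArg Fin.val huv),
      R.toFinset, hRf, hR3, List.mem_toFinset.2 hvR, hmemR _ hpS, hmemR _ hqS, hmemR _ hrS⟩
    rintro rfl
    exact hqp (h.unique q p _ _ hqv hpu)
  · rintro ⟨v, u, v', u', hp, hr', hv, hv', hu, hvv', huv', hu', huv, R, hR, hR3, hvR, huR, hvR',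
      huR'⟩
    obtain ⟨S, hS, rfl⟩ := List.mem_map.1 ((hf R).2 ⟨hR, hR3⟩)
    obtain ⟨q, hq⟩ := h.exists_dart v v' hvv'
    have hmemS : ∀ x : Fin n, x ∈ S.toFinset → x.val ∈ S.map Fin.val := fun x hx =>
      List.mem_map_of_mem (List.mem_toFinset.1 hx)
    refine ⟨S.map Fin.val, List.mem_map_of_mem hS, v, hmemS v hvR, (h.simple_iff hr v).2 hv, p,
      (DartData.isDart_iff_mem_L.1 hp).1, ?_, q, (DartData.isDart_iff_mem_L.1 hq).1, ?_, ?_, ?_, r,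
      ?_, ?_, ?_, rfl⟩
    · rw [hp.2.2.2]
      exact hmemS u huR
    · rintro rfl
      exact huv' (Fin.ext (hp.2.2.2.symm.trans hq.2.2.2))
    · rw [hq.2.2.2]
      exact hmemS v' hvR'
    · rw [hq.2.2.2]
      exact (h.simple_iff hr v').2 hv'
    · rw [hq.2.2.2]
      exact (DartData.isDart_iff_mem_L.1 hr').1
    · rw [hr'.2.2.2]
      exact fun he => huv (Fin.ext he)
    · rw [hr'.2.2.2]
      exact hmemS u' huR'

end Represents

open Classical in
/-- The facet that contains the source of the dart `p`, but not its target. -/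
noncomputable def dartFacet (C : VertexConfig (Fin n) W) (G : DartData) (p : ℕ) : Finset (Fin n) :=
  if h : ∃ F, C.IsFacet F ∧ ∃ a b : Fin n, G.IsDart p a b ∧ C.Misses F a b then h.choose else ∅

theorem dartFacet_eq {p : ℕ} {a b : Fin n} {F : Finset (Fin n)} (ha : C.Simple a)
    (hp : G.IsDart p a b) (hF : C.IsFacet F) (hm : C.Misses F a b) : dartFacet C G p = F := by
  have h : ∃ F, C.IsFacet F ∧ ∃ a b : Fin n, G.IsDart p a b ∧ C.Misses F a b :=
    ⟨F, hF, a, b, hp, hm⟩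
  rw [dartFacet, dif_pos h]
  obtain ⟨h1, a', b', hp', hm'⟩ := h.choose_spec
  obtain rfl : a = a' := Fin.ext (hp.2.2.1.symm.trans hp'.2.2.1)
  obtain rfl : b = b' := Fin.ext (hp.2.2.2.symm.trans hp'.2.2.2)
  exact ha.facet_unique h1 hF hm' hm

namespace Represents

/-- A good dart determines a facet. -/
theorem dartFacet_spec (h : Represents G C) {p : ℕ} {a b : Fin n} (ha : C.Simple a)
    (hp : G.IsDart p a b) : C.IsFacet (dartFacet C G p) ∧ C.Misses (dartFacet C G p) a b := by
  obtain ⟨F, hF, hm⟩ := ha.exists_facet (h.mem_nbr hp)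
  rw [dartFacet_eq ha hp hF hm]
  exact ⟨hF, hm⟩

/-- The components of the link graph are the sets of darts belonging to one facet. -/
theorem classes (h : Represents G C) (hr : C.rank = d + 1) (hC : C.FewNonsimple)
    (hH : ∀ p r, (∃ k ∈ H.L p, H.t k = r) ↔
      ∃ v u v' u' : Fin n, G.IsDart p v u ∧ G.IsDart r v' u' ∧ C.Linked v u v' u') :
    Classes G H d (dartFacet C G) := by
  refine ⟨fun p _ k hk => ?_, fun X hX p q hp hq hpq hXp => ?_⟩
  · obtain ⟨v, u, v', u', h1, h2, h3⟩ := (hH p (H.t k)).1 ⟨k, hk, rfl⟩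
    refine ⟨(h.goodDart_iff hr).2 ⟨v', u', h2, h3.2.1⟩, ?_⟩
    obtain ⟨hF, hm⟩ := h.dartFacet_spec h3.1 h1
    exact dartFacet_eq h3.2.1 h2 hF (h3.misses hF hm)
  · obtain ⟨v, u, hpv, hv⟩ := (h.goodDart_iff hr).1 hp
    obtain ⟨v', u', hqv, hv'⟩ := (h.goodDart_iff hr).1 hq
    obtain ⟨hF, hm⟩ := h.dartFacet_spec hv hpv
    have hm' := (h.dartFacet_spec hv' hqv).2
    rw [← hpq] at hm'
    obtain ⟨r, hrv, hXr⟩ := hC.mem_of_linked hF (X := fun v u => ∃ p, G.IsDart p v u ∧ X p)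
      (by
        rintro v u v' u' ⟨p, hp, hXp⟩ hl
        obtain ⟨r, hr⟩ := h.exists_dart v' u' hl.2.2.2.2.2.1
        obtain ⟨k, hk, rfl⟩ := (hH p r).2 ⟨v, u, v', u', hp, hr, hl⟩
        exact ⟨_, hr, hX p hXp k hk⟩) hv hm ⟨p, hpv, hXp⟩ hv' hm'
    rwa [h.unique q r _ _ hqv hrv]

/-- The vertices listed for a class of darts are those of the corresponding facet. -/
theorem lists_facet (h : Represents G C) (hr : C.rank = d + 1) (hC : C.FewNonsimple)
    {F : Finset (Fin n)} {l : List ℕ} (hl : Lists G d (dartFacet C G) F l) :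
    C.IsFacet F ∧ ∃ l' : List (Fin n), l'.map Fin.val = l ∧ l'.Nodup ∧ l'.toFinset = F := by
  obtain ⟨hn, hmem, p, hp, rfl⟩ := hl
  obtain ⟨v, u, hpv, hv⟩ := (h.goodDart_iff hr).1 hp
  have hF := (h.dartFacet_spec hv hpv).1
  set F := dartFacet C G p
  have hlF : ∀ x, x ∈ l ↔ ∃ w ∈ F, w.val = x := by
    intro x
    rw [hmem]
    constructor
    · rintro ⟨q, hq, hqF, hx⟩
      obtain ⟨a, b, hqa, ha⟩ := (h.goodDart_iff hr).1 hq
      have hm := (h.dartFacet_spec ha hqa).2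
      rw [hqF] at hm
      rcases hx with rfl | ⟨r, hr', hrq, rfl⟩
      · exact ⟨a, hm.1, hqa.2.2.1.symm⟩
      · rw [hqa.2.2.1] at hr'
        obtain ⟨c, hc⟩ := h.exists_isDart hr'
        refine ⟨c, ha.mem_of_misses hF hm (h.mem_nbr hc) ?_, hc.2.2.2.symm⟩
        rintro rfl
        exact hrq (h.unique r q _ _ hc hqa)
    · rintro ⟨w, hw, rfl⟩
      obtain ⟨a, b, ha, hm, hwa⟩ := (hC.mem_facet_iff hF).1 hw
      obtain ⟨q, hq⟩ := h.exists_dart a b hm.2.1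
      refine ⟨q, (h.goodDart_iff hr).2 ⟨a, b, hq, ha⟩, dartFacet_eq ha hq hF hm, ?_⟩
      rcases hwa with rfl | ⟨hwa, hwb⟩
      · exact .inl hq.2.2.1.symm
      · obtain ⟨r, hr'⟩ := h.exists_dart a w hwa
        refine .inr ⟨r, ?_, ?_, hr'.2.2.2.symm⟩
        · rw [hq.2.2.1]
          exact (DartData.isDart_iff_mem_L.1 hr').1
        · rintro rfl
          exact hwb (Fin.ext (hr'.2.2.2.symm.trans hq.2.2.2))
  obtain ⟨l', rfl⟩ : ∃ l' : List (Fin n), l'.map Fin.val = l := by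
    rw [← Set.mem_range, Set.range_list_map]
    intro x hx
    obtain ⟨w, -, rfl⟩ := (hlF x).1 hx
    exact ⟨w, rfl⟩
  refine ⟨hF, l', rfl, hn.of_map _, ?_⟩
  ext w
  rw [List.mem_toFinset, ← List.mem_map_of_injective Fin.val_injective, hlF]
  constructor
  · rintro ⟨w', hw', he⟩
    rwa [← Fin.ext he]
  · exact fun hw => ⟨w, hw, rfl⟩

/-- Every facet arises from a dart, as it has a simple vertex. -/
theorem exists_goodDart (h : Represents G C) (hr : C.rank = d + 1) (hC : C.FewNonsimple)
    {F : Finset (Fin n)} (hF : C.IsFacet F) : ∃ p, GoodDart G d p ∧ dartFacet C G p = F := by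
  obtain ⟨v, hvF, hv⟩ := hC.exists_simple hF
  obtain ⟨u, hm⟩ := hv.exists_misses hF hvF
  obtain ⟨p, hp⟩ := h.exists_dart v u hm.2.1
  exact ⟨p, (h.goodDart_iff hr).2 ⟨v, u, hp, hv⟩, dartFacet_eq hv hp hF hm⟩

end Represents

end Representation

/-! ### Finding the facets in linear time -/

section Assembly

open VertexConfig

variable {n d : ℕ} {W : Type*} [AddCommGroup W] [Module ℝ W] [FiniteDimensional ℝ W]
  {C : VertexConfig (Fin n) W}

theorem exists_pairs {α : Type*} {L : List (List α)} (h : ∀ l ∈ L, l.length = 2) :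
    ∃ es : List (α × α), es.map (fun e => [e.1, e.2]) = L := by
  rw [← Set.mem_range, Set.range_list_map]
  intro l hl
  obtain ⟨a, b, rfl⟩ := List.length_eq_two.1 (h l hl)
  exact ⟨(a, b), rfl⟩

/-- The darts written by the program when it reads the list of the edges are the ordered pairs of
adjacent vertices, each occurring once. -/
theorem represents_dartsOf {es : List (Fin n × Fin n)} {G : DartData}
    (hn : (es.map fun e => ({e.1, e.2} : Finset (Fin n))).Nodup)
    (hes : ∀ S : Finset (Fin n), S ∈ es.map (fun e => ({e.1, e.2} : Finset (Fin n))) ↔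
      IsFace C.pt S ∧ rk C.pt S = 2)
    (hG : G.Lists (dartsOf (es.map (Prod.map Fin.val Fin.val)))) : Represents G C := by
  have hnbr : ∀ a b : Fin n, b ∈ C.nbr a ↔ ({a, b} : Finset (Fin n)) ∈
      es.map (fun e => ({e.1, e.2} : Finset (Fin n))) := fun a b => by
    rw [hes, C.mem_nbr, rk_eq_two_iff]
    constructor
    · exact fun h => ⟨h.2, Finset.card_pair h.1.symm⟩
    · rintro ⟨h1, h2⟩
      refine ⟨?_, h1⟩
      rintro rfl
      simp at h2
  have hne : ∀ e ∈ es, e.2 ∈ C.nbr e.1 := fun e he => (hnbr _ _).2 (List.mem_map.2 ⟨e, he, rfl⟩)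
  refine represents_of_nodup hG ?_ fun e => ?_
  · rw [dartsOf, List.flatMap_map, List.nodup_flatMap]
    refine ⟨fun e he => ?_, (List.pairwise_map.1 hn).imp fun {e e'} hee => ?_⟩
    · have := ((C.mem_nbr).1 (hne e he)).1
      simp [Fin.val_inj, this.symm]
    · rw [Function.onFun, List.disjoint_left]
      intro x hx hx'
      refine hee ?_
      simp only [Prod.map, List.mem_cons, List.not_mem_nil, or_false] at hx hx'
      rcases hx with rfl | rfl <;> rcases hx' with h | h <;>
        rw [Prod.mk.injEq, Fin.val_inj, Fin.val_inj] at h <;> rw [h.1, h.2]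
      all_goals exact Finset.pair_comm _ _
  · simp only [dartsOf, List.mem_flatMap, List.mem_map, List.mem_cons, List.not_mem_nil, or_false]
    constructor
    · rintro ⟨_, ⟨e', he', rfl⟩, rfl | rfl⟩
      · exact ⟨e'.1, e'.2, hne e' he', rfl⟩
      · exact ⟨e'.2, e'.1, C.mem_nbr_comm.1 (hne e' he'), rfl⟩
    · rintro ⟨a, b, hab, rfl⟩
      obtain ⟨e', he', hS⟩ := List.mem_map.1 ((hnbr a b).1 hab)
      refine ⟨_, ⟨e', he', rfl⟩, ?_⟩
      have h1 := ((C.mem_nbr).1 hab).1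
      have ha : a ∈ ({e'.1, e'.2} : Finset (Fin n)) := by rw [hS]; simp
      have hb : b ∈ ({e'.1, e'.2} : Finset (Fin n)) := by rw [hS]; simp
      simp only [Finset.mem_insert, Finset.mem_singleton] at ha hb
      rcases ha with rfl | rfl <;> rcases hb with rfl | rfl
      · exact absurd rfl h1
      · exact .inl rfl
      · exact .inr rfl
      · exact absurd rfl h1

theorem sum_length_le {L : List (List (Fin n))} (hl : ∀ l ∈ L, l.Nodup)
    (hn : (L.map List.toFinset).Nodup) (hp : ∀ S ∈ L.map List.toFinset, S ∈ C.properFaces) :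
    (L.map fun l => l.length + 1).sum ≤ ∑ T ∈ C.properFaces, (T.card + 1) := by
  have h1 : (L.map fun l => l.length + 1) = (L.map List.toFinset).map fun T => T.card + 1 := by
    rw [List.map_map]
    refine List.map_congr_left fun l h => ?_
    rw [Function.comp_apply, List.toFinset_card_of_nodup (hl l h)]
  rw [h1, ← List.sum_toFinset _ hn]
  exact Finset.sum_le_sum_of_subset fun S hS => hp S (List.mem_toFinset.1 hS)

/-- A bound for the total size of the proper faces of a `d`-polytope, relative to the number of its
vertices. -/
def sizeBound (d : ℕ) : ℕ := 2 ^ (d + 1) + (d + 1 + 1) * (2 ^ (d + 1) * (1 + 2 ^ (d + 1)))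

/-- Lists of labels and the sets they represent are obtained from the output words one by one. -/
theorem exists_lists {α : Type*} [DecidableEq α] {f : α → ℕ} {Q : Finset α → Prop}
    {R : Finset α → List ℕ → Prop} {labs : List (Finset α)} {outs : List (List ℕ)}
    (h : List.Forall₂ R labs outs)
    (hR : ∀ F l, R F l → Q F ∧ ∃ l' : List α, l'.map f = l ∧ l'.Nodup ∧ l'.toFinset = F) :
    (∀ F ∈ labs, Q F) ∧ ∃ L : List (List α), L.map (List.map f) = outs ∧
      L.map List.toFinset = labs ∧ ∀ l ∈ L, l.Nodup := by
  induction h with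
  | nil => exact ⟨by simp, [], rfl, rfl, by simp⟩
  | cons h _ ih =>
    obtain ⟨hQ, L, h1, h2, h3⟩ := ih
    obtain ⟨hF, l', rfl, h4, rfl⟩ := hR _ _ h
    exact ⟨by simpa using ⟨hF, hQ⟩, l' :: L, by simp [h1], by simp [h2], by simpa using ⟨h4, h3⟩⟩

/-- Edges and 2-faces are proper faces, so that the size of the input is bounded by `sizeBound d * n`,
which turns the running time of `findFacets` into a multiple of `n`. -/
theorem findsFacetsWithin {E : Type*} [NormedAddCommGroup E] [NormedSpace ℝ E]
    [FiniteDimensional ℝ E] {P : Set E} (hd : 3 ≤ d) (hP : IsDPolytope d P)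
    (h : FacetNonsimpleAtMost d (d - 2) P) :
    FindsFacetsWithin (findFacets d)
      (((22 * d + 95) + 9 * (linkCost d + 9)) * sizeBound d + 15) d P := by
  rintro n label edges faces ⟨hel, hen, heS⟩ ⟨hfl, hfn, hfS⟩
  set C := config hP label with hCdef
  have hr : C.rank = d + 1 := rank_config hP
  have hC : C.FewNonsimple := fewNonsimple_config hP hd h
  have heS' : ∀ S : Finset (Fin n), S ∈ edges.map List.toFinset ↔
      IsFace C.pt S ∧ rk C.pt S = 2 := fun S => (heS S).trans (exists_isKFace_iff hP)
  have hfS' : ∀ S : Finset (Fin n), S ∈ faces.map List.toFinset ↔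
      IsFace C.pt S ∧ rk C.pt S = 3 := fun S => (hfS S).trans (exists_isKFace_iff hP)
  have hproper : ∀ S : Finset (Fin n), IsFace C.pt S → rk C.pt S ≤ 3 → S ∈ C.properFaces := by
    intro S hS hle
    refine mem_properFaces.2 ⟨hS, ?_⟩
    rintro rfl
    have : C.rank ≤ 3 := hle
    omega
  have hn : 1 ≤ n := by
    have h1 := rk_le_card (x := C.pt) Finset.univ
    rw [Finset.card_univ, Fintype.card_fin] at h1
    have : C.rank ≤ n := h1
    omega
  have hbound := hC.sum_card_properFaces_le
  rw [hr, Fintype.card_fin] at hbound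
  change _ ≤ sizeBound d * n at hbound
  have hsize : ∀ (L : List (List (Fin n))) (k : ℕ), k ≤ 3 → (∀ l ∈ L, l.Nodup) →
      (L.map List.toFinset).Nodup → (∀ S : Finset (Fin n), S ∈ L.map List.toFinset ↔
        IsFace C.pt S ∧ rk C.pt S = k) →
      (L.map fun l => l.length + 1).sum ≤ sizeBound d * n := fun L k hk h1 h2 h3 =>
    (sum_length_le h1 h2 fun S hS => hproper S ((h3 S).1 hS).1 (((h3 S).1 hS).2.trans_le hk)).trans
      hbound
  obtain ⟨es, hes⟩ : ∃ es : List (Fin n × Fin n), es.map (fun e => [e.1, e.2]) = edges := by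
    refine exists_pairs fun l hl => ?_
    have h1 := ((heS' l.toFinset).1 (List.mem_map_of_mem hl)).2
    rwa [rk_eq_two_iff, List.toFinset_card_of_nodup (hel l hl)] at h1
  have hsets : edges.map List.toFinset = es.map fun e => ({e.1, e.2} : Finset (Fin n)) := by
    rw [← hes, List.map_map]
    refine List.map_congr_left fun e _ => ?_
    simp
  have hrep : ∀ G : DartData, G.Lists (dartsOf (es.map (Prod.map Fin.val Fin.val))) →
      Represents G C := fun G hG =>
    represents_dartsOf (by rwa [← hsets]) (by rwa [← hsets]) hG
  obtain ⟨t, τ, hexec, ht, G, labs, outs, hG, hnodup, hlists, hall, hout⟩ :=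
    wp_findFacets d n (es.map (Prod.map Fin.val Fin.val)) (faces.map (List.map Fin.val))
      (encodeTwoSkeleton n edges faces) (by
        simp [encodeTwoSkeleton, encode, ← hes, List.flatMap_map]) (dartFacet C)
      fun G H hG hH => (hrep G hG).classes hr hC fun p r => (hrep G hG).exists_link_iff hr hfS' hH
  obtain ⟨hlabs, facets, rfl, rfl, hfacets⟩ := exists_lists hlists
    fun F l => (hrep G hG).lists_facet hr hC
  refine ⟨t, τ, facets, hexec, ht.trans ?_, ⟨hfacets, hnodup, fun S => ?_⟩, fun i hi => ?_⟩
  · have h1 := hsize faces 3 le_rfl hfl hfn hfS'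
    have h2 := hsize edges 2 (by norm_num) hel hen heS'
    have h3 : (es.map (Prod.map Fin.val Fin.val)).length ≤ sizeBound d * n := by
      refine le_trans ?_ h2
      rw [List.length_map, ← hes, List.map_map]
      simp [Function.comp_def]
      omega
    have h4 : size (faces.map (List.map Fin.val)) ≤ sizeBound d * n := by
      refine le_trans (le_of_eq ?_) h1
      simp [size, Function.comp_def]
    calc _ ≤ (22 * d + 95) * (sizeBound d * n) + 9 * (linkCost d + 9) * (sizeBound d * n) + 15 * n :=
        add_le_add (add_le_add (Nat.mul_le_mul_left _ h3) (Nat.mul_le_mul_left _ h4)) (by omega)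
      _ = _ := by ring
  · rw [exists_isKFace_iff hP]
    have hfacet : IsFace (lift label) S ∧ rk (lift label) S = d - 1 + 1 ↔ C.IsFacet S := by
      rw [VertexConfig.IsFacet, hr, hCdef, config_pt]
      exact and_congr_right fun _ => by omega
    rw [hfacet]
    refine ⟨hlabs S, fun hS => ?_⟩
    obtain ⟨p, hp, rfl⟩ := (hrep G hG).exists_goodDart hr hC hS
    exact hall p hp
  · have := hout i (by simpa [encode, List.flatMap_map] using hi)
    rw [zero_add] at this
    simpa [encode, List.flatMap_map] using this

end Assembly

end Recon

theorem mainTheorem3 (d : ℕ) (hd : 3 ≤ d) :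
    (∀ (N : ℕ) (P : Set (EuclideanSpace ℝ (Fin N))),
      Recon.IsDPolytope d P → Recon.FacetNonsimpleAtMost d (d - 2) P →
        Recon.ReconstructibleFromSkeleton d 2 P) ∧
    ∃ (p : Recon.Prog) (C : ℕ), ∀ (N : ℕ) (P : Set (EuclideanSpace ℝ (Fin N))),
      Recon.IsDPolytope d P → Recon.FacetNonsimpleAtMost d (d - 2) P →
        Recon.FindsFacetsWithin p C d P := by
  refine ⟨fun N P hP h => Recon.reconstructible hd hP h, Recon.findFacets d, _,
    fun N P hP h => Recon.findsFacetsWithin hd hP h⟩
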